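/- Let $G$ be a simply connected Lie group and $K\subset G$ a compact connected subgroup, with Lie algebras $\mathfrak k\subset\mathfrak g$, and put $V=T_o(G/K)=\mathfrak g/\mathfrak k$. Let $\mathcal T$ be a finite-dimensional space of tensors on $V$ of a fixed type $(r,s)$ (multilinear maps $V^r\to V^{\otimes s}$), or of tuples of tensors of fixed types. $G$-invariant tensor fields on $G/K$ are identified with their values at the origin $o$, i.e. with the $\mathrm{Ad}(K)$-invariant elements $\mathcal T^K$ of $\mathcal T$. Let $\mathrm{Aut}(G/K)$ be the group of Lie group automorphisms $f$ of $G$ with $f(K)=K$ (acting on $G/K$ by $aK\mapsto f(a)K$); it acts on $\mathcal T^K$ by pull-back $f^*$, through the map induced by $df|_e$ on $\mathfrak g/\mathfrak k$. Let $\Gamma\subset\mathcal T^K$ be invariant under $\mathrm{Aut}(G/K)$ and under multiplication by positive scalars, and let $q:\Gamma\to\mathcal T^K$ be locally Lipschitz with $q(f^*\gamma)=f^*q(\gamma)$ for all $f\in\mathrm{Aut}(G/K)$ and $q(a\gamma)=a^{\alpha}q(\gamma)$ for all $a>0$, $\gamma\in\Gamma$, where $\alpha<1$ is fixed. Consider the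 flow in $\Gamma$ $$\tfrac{d}{dt}\gamma(t)=q(\gamma(t)),\qquad \gamma(0)=\gamma. \qquad (*)$$ Let $\gamma\in\Gamma$ be a semi-algebraic soliton: $q(\gamma)=c\,\gamma+\theta(D_{\mathfrak p})\gamma$ for some $c\in\mathbb R$ and some derivation $D$ of $\mathfrak g$ with $D\mathfrak k\subset\mathfrak k$, where $D_{\mathfrak p}$ is the endomorphism of $\mathfrak g/\mathfrak k$ induced by $D$ and $\theta$ is the natural representation of $\mathfrak{gl}(V)$ on tensors. Let $I=\{t\in\mathbb R:(1-\alpha)ct+1>0\}$ and $c(t)=((1-\alpha)ct+1)^{1/(1-\alpha)}\neq 0$ for $t\in I$. Then there exist $f(t)\in\mathrm{Aut}(G/K)$, $t\in I$, with $f(0)=\mathrm{id}$ and $t\mapsto df(t)|_e$ smooth on $I$, such that (i) the solution of $(*)$ is given by $\gamma(t)=c(t)f(t)^*\gamma$: this curve is a solution of $(*)$ on $I$, and every solution of $(*)$ on an open interval $J\ni 0$ coincides with it on $J\cap I$; (ii) $f(t)|_K=\mathrm{id}$ for all $t\in I$. -/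

import Mathlib

open Set Topology Module
open scoped Manifold ContDiff TensorProduct

noncomputable section

/-! ### Tensors on a finite-dimensional real vector space -/

section Tensors

variable {V : Type*} [AddCommGroup V] [Module ℝ V]

/-- Tensors of type `(r, s)` on `V`: multilinear maps `V × ⋯ × V → V ⊗ ⋯ ⊗ V`
(`r` arguments, `s` tensor factors). -/
abbrev TensorOfType (V : Type*) [AddCommGroup V] [Module ℝ V] (r s : ℕ) : Type _ :=
  MultilinearMap ℝ (fun _ : Fin r => V) (⨂[ℝ] _ : Fin s, V)

/-- Tuples of tensors on `V`, the `i`-th one of type `(r i, s i)`. -/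
def TensorTuple (V : Type*) [AddCommGroup V] [Module ℝ V] {ι : Type*} (r s : ι → ℕ) : Type _ :=
  ∀ i, TensorOfType V (r i) (s i)

variable {ι : Type*} {r s : ι → ℕ}

instance : AddCommGroup (TensorTuple V r s) :=
  inferInstanceAs (AddCommGroup (∀ i, TensorOfType V (r i) (s i)))

instance : Module ℝ (TensorTuple V r s) :=
  inferInstanceAs (Module ℝ (∀ i, TensorOfType V (r i) (s i)))

instance [Fintype ι] [FiniteDimensional ℝ V] : FiniteDimensional ℝ (TensorTuple V r s) :=
  inferInstanceAs (Module.Finite ℝ (∀ i, TensorOfType V (r i) (s i)))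

/-- The norm of the finite-dimensional space of tensors is the sup norm in the coordinates of some
basis. All norms on it are equivalent, so derivatives of curves and the local Lipschitz property do
not depend on this choice. -/
instance [Fintype ι] [FiniteDimensional ℝ V] : NormedAddCommGroup (TensorTuple V r s) :=
  NormedAddCommGroup.induced _ _ (Module.finBasis ℝ (TensorTuple V r s)).equivFun
    (Module.finBasis ℝ (TensorTuple V r s)).equivFun.injective

instance [Fintype ι] [FiniteDimensional ℝ V] : NormedSpace ℝ (TensorTuple V r s) :=
  NormedSpace.induced _ _ _ (Module.finBasis ℝ (TensorTuple V r s)).equivFun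

/-- The pull-back `h^*γ = h⁻¹ · γ(h ·, …, h ·)`, where `h⁻¹` acts on all factors of
`V ⊗ ⋯ ⊗ V`. -/
def TensorTuple.pullback (h : V ≃ₗ[ℝ] V) (γ : TensorTuple V r s) : TensorTuple V r s := fun i =>
  (PiTensorProduct.map fun _ => h.symm.toLinearMap).compMultilinearMap
    ((γ i).compLinearMap fun _ => h.toLinearMap)

/-- The representation `θ` of `gl(V)` on tensors,
`θ(A)γ = θ_s(A) γ - γ(A ·, …, ·) - ⋯ - γ(·, …, A ·)`,
with `θ_s(A)` the sum over all factors of `V ⊗ ⋯ ⊗ V` of `A` acting on that factor. -/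
def TensorTuple.theta (A : V →ₗ[ℝ] V) (γ : TensorTuple V r s) : TensorTuple V r s := fun i =>
  (∑ j : Fin (s i), PiTensorProduct.map
      (Function.update (fun _ => LinearMap.id) j A)).compMultilinearMap (γ i)
    - ∑ j : Fin (r i), (γ i).compLinearMap (Function.update (fun _ => LinearMap.id) j A)

end Tensors

/-! ### Homogeneous spaces `G/K` at the Lie algebra level -/

instance : ENat.LEInfty (minSmoothness ℝ 3) where
  out := by
    rw [minSmoothness_of_isRCLikeNormedField]
    exact ENat.LEInfty.out

section Homogeneous

variable {n : ℕ} {G : Type*} [TopologicalSpace G] [ChartedSpace (EuclideanSpace ℝ (Fin n)) G]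
  [Group G]

instance (x : G) : FiniteDimensional ℝ (TangentSpace (𝓡 n) x) :=
  inferInstanceAs (FiniteDimensional ℝ (EuclideanSpace ℝ (Fin n)))

/-- The differential at the identity of a map `φ : G → G` (used for homomorphisms), as an
endomorphism of the Lie algebra of `G`. -/
def diffAtOne (n : ℕ) {G : Type*} [TopologicalSpace G]
    [ChartedSpace (EuclideanSpace ℝ (Fin n)) G] [Group G] (φ : G → G) :
    EuclideanSpace ℝ (Fin n) →L[ℝ] EuclideanSpace ℝ (Fin n) :=
  mfderiv (𝓡 n) (𝓡 n) φ 1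

/-- The initial velocity `σ'(0)` of a curve `σ` in `G` (used for curves with `σ(0) = 1`), as an
element of the Lie algebra of `G`. -/
def initialVelocity (n : ℕ) {G : Type*} [TopologicalSpace G]
    [ChartedSpace (EuclideanSpace ℝ (Fin n)) G] (σ : ℝ → G) : EuclideanSpace ℝ (Fin n) :=
  mfderiv 𝓘(ℝ, ℝ) (𝓡 n) σ 0 (1 : ℝ)

lemma initialVelocity_comp_mul (c : ℝ) (σ : ℝ → G) (hσ : ContMDiff 𝓘(ℝ, ℝ) (𝓡 n) ∞ σ) :
    initialVelocity n (fun t => σ (c * t)) = c • initialVelocity n σ := by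
  have hm : HasMFDerivAt 𝓘(ℝ, ℝ) 𝓘(ℝ, ℝ) (fun t : ℝ => c * t) 0
      (c • ContinuousLinearMap.id ℝ ℝ) := by
    have h := ((hasFDerivAt_id (𝕜 := ℝ) (0 : ℝ)).const_mul c).hasMFDerivAt
    exact h
  have h := mfderiv_comp_apply_of_eq (I := 𝓘(ℝ, ℝ)) (I' := 𝓘(ℝ, ℝ)) (I'' := 𝓡 n)
    (g := σ) (f := fun t : ℝ => c * t) (x := (0 : ℝ)) (y := (0 : ℝ))
    (hσ.mdifferentiableAt (by simp)) hm.mdifferentiableAt (mul_zero c) (1 : ℝ)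
  rw [hm.mfderiv] at h
  refine h.trans ?_
  have h2 : (c • ContinuousLinearMap.id ℝ ℝ) (1 : ℝ) = c • (1 : ℝ) := rfl
  exact (congrArg (mfderiv 𝓘(ℝ, ℝ) (𝓡 n) σ 0) h2).trans
    ((mfderiv 𝓘(ℝ, ℝ) (𝓡 n) σ 0).map_smul c (1 : ℝ))

lemma initialVelocity_comp (φ : G → G) (hφ : ContMDiff (𝓡 n) (𝓡 n) ∞ φ) (σ : ℝ → G)
    (hσ : ContMDiff 𝓘(ℝ, ℝ) (𝓡 n) ∞ σ) (h0 : σ 0 = 1) :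
    initialVelocity n (φ ∘ σ) = diffAtOne n φ (initialVelocity n σ) :=
  mfderiv_comp_apply_of_eq (x := (0 : ℝ)) (y := (1 : G))
    (hφ.mdifferentiableAt (by simp)) (hσ.mdifferentiableAt (by simp)) h0 (1 : ℝ)

lemma diffAtOne_comp (φ ψ : G → G) (hφ : ContMDiff (𝓡 n) (𝓡 n) ∞ φ)
    (hψ : ContMDiff (𝓡 n) (𝓡 n) ∞ ψ) (h1 : ψ 1 = 1) (X : EuclideanSpace ℝ (Fin n)) :
    diffAtOne n (φ ∘ ψ) X = diffAtOne n φ (diffAtOne n ψ X) :=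
  mfderiv_comp_apply_of_eq (x := (1 : G)) (y := (1 : G))
    (hφ.mdifferentiableAt (by simp)) (hψ.mdifferentiableAt (by simp)) h1 X

lemma diffAtOne_id (X : EuclideanSpace ℝ (Fin n)) : diffAtOne n (id : G → G) X = X := by
  unfold diffAtOne
  rw [mfderiv_id]
  rfl

variable [LieGroup (𝓡 n) ∞ G]

lemma initialVelocity_mul (σ τ : ℝ → G) (hσ : ContMDiff 𝓘(ℝ, ℝ) (𝓡 n) ∞ σ)
    (hτ : ContMDiff 𝓘(ℝ, ℝ) (𝓡 n) ∞ τ) (hσ0 : σ 0 = 1) (hτ0 : τ 0 = 1) :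
    initialVelocity n (fun t => σ t * τ t) = initialVelocity n σ + initialVelocity n τ := by
  have hF : MDifferentiableAt (𝓘(ℝ, ℝ).prod 𝓘(ℝ, ℝ)) (𝓡 n)
      (fun z : ℝ × ℝ => σ z.1 * τ z.2) ((0 : ℝ), (0 : ℝ)) :=
    ((hσ.comp contMDiff_fst).mul (hτ.comp contMDiff_snd)).mdifferentiableAt (by simp)
  have hd : HasMFDerivAt 𝓘(ℝ, ℝ) (𝓘(ℝ, ℝ).prod 𝓘(ℝ, ℝ)) (fun t : ℝ => (t, t)) 0
      ((ContinuousLinearMap.id ℝ ℝ).prod (ContinuousLinearMap.id ℝ ℝ)) :=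
    (hasMFDerivAt_id (I := 𝓘(ℝ, ℝ)) (0 : ℝ)).prodMk (hasMFDerivAt_id (I := 𝓘(ℝ, ℝ)) (0 : ℝ))
  have h := mfderiv_comp_apply_of_eq (I := 𝓘(ℝ, ℝ)) (I' := 𝓘(ℝ, ℝ).prod 𝓘(ℝ, ℝ)) (I'' := 𝓡 n)
    (g := fun z : ℝ × ℝ => σ z.1 * τ z.2) (f := fun t : ℝ => (t, t)) (x := (0 : ℝ))
    (y := ((0 : ℝ), (0 : ℝ))) hF hd.mdifferentiableAt rfl (1 : ℝ)
  rw [hd.mfderiv] at h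
  refine h.trans ((mfderiv_prod_eq_add_apply hF).trans ?_)
  have h1 : (fun t => σ t * τ 0) = σ := by simp [hτ0]
  have h2 : (fun t => σ 0 * τ t) = τ := by simp [hσ0]
  exact congrArg₂ (· + ·) (congrArg (initialVelocity n) h1) (congrArg (initialVelocity n) h2)

/-- The Lie algebra of a closed subgroup `K` of `G`, as a vector subspace of the Lie algebra of
`G`: all initial velocities of smooth curves of `G` that start at the identity and stay in `K`. -/
def subgroupLieAlgebra (n : ℕ) {G : Type*} [TopologicalSpace G]
    [ChartedSpace (EuclideanSpace ℝ (Fin n)) G] [Group G] [LieGroup (𝓡 n) ∞ G]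
    (K : Subgroup G) : Submodule ℝ (GroupLieAlgebra (𝓡 n) G) where
  carrier := {X | ∃ σ : ℝ → G, ContMDiff 𝓘(ℝ, ℝ) (𝓡 n) ∞ σ ∧ (∀ t, σ t ∈ K) ∧ σ 0 = 1 ∧
    initialVelocity n σ = X}
  zero_mem' := by
    refine ⟨fun _ => 1, contMDiff_const, fun _ => K.one_mem, rfl, ?_⟩
    unfold initialVelocity
    rw [mfderiv_const]
    rfl
  add_mem' := by
    rintro X Y ⟨σ, hσ, hσK, hσ0, rfl⟩ ⟨τ, hτ, hτK, hτ0, rfl⟩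
    exact ⟨fun t => σ t * τ t, hσ.mul hτ, fun t => K.mul_mem (hσK t) (hτK t),
      by simp [hσ0, hτ0], initialVelocity_mul σ τ hσ hτ hσ0 hτ0⟩
  smul_mem' := by
    rintro c X ⟨σ, hσ, hσK, hσ0, rfl⟩
    refine ⟨fun t => σ (c * t), hσ.comp ?_, fun t => hσK _, by simp [hσ0],
      initialVelocity_comp_mul c σ hσ⟩
    exact (contDiff_const.mul contDiff_id).contMDiff

/-- The tangent space `T_o(G/K) = 𝔤/𝔨` of `G/K` at the origin `o = K`. -/
abbrev OriginTangent (n : ℕ) {G : Type*} [TopologicalSpace G]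
    [ChartedSpace (EuclideanSpace ℝ (Fin n)) G] [Group G] [LieGroup (𝓡 n) ∞ G]
    (K : Subgroup G) : Type :=
  GroupLieAlgebra (𝓡 n) G ⧸ subgroupLieAlgebra n K

/-- `Aut(G/K)`: the equivariant diffeomorphisms `aK ↦ φ(a)K` of `G/K`, given by the Lie group
automorphisms `φ` of `G` that take `K` onto `K`. -/
structure EquivariantAut (n : ℕ) {G : Type*} [TopologicalSpace G]
    [ChartedSpace (EuclideanSpace ℝ (Fin n)) G] [Group G] (K : Subgroup G) extends G ≃* G where
  contMDiff_toFun : ContMDiff (𝓡 n) (𝓡 n) ∞ toFun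
  contMDiff_invFun : ContMDiff (𝓡 n) (𝓡 n) ∞ invFun
  map_subgroup : K.map toMulEquiv.toMonoidHom = K

namespace EquivariantAut

variable {K : Subgroup G}

lemma apply_mem (φ : EquivariantAut n K) {x : G} (hx : x ∈ K) : φ.toMulEquiv x ∈ K := by
  have h := Subgroup.mem_map_of_mem φ.toMulEquiv.toMonoidHom hx
  rwa [φ.map_subgroup] at h

/-- The inverse automorphism. -/
def symm (φ : EquivariantAut n K) : EquivariantAut n K where
  toMulEquiv := φ.toMulEquiv.symm
  contMDiff_toFun := φ.contMDiff_invFun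
  contMDiff_invFun := φ.contMDiff_toFun
  map_subgroup := by
    ext x
    constructor
    · rintro ⟨y, hy, rfl⟩
      rw [SetLike.mem_coe, ← φ.map_subgroup] at hy
      obtain ⟨z, hz, rfl⟩ := hy
      simpa using hz
    · intro hx
      exact ⟨φ.toMulEquiv x, φ.apply_mem hx, φ.toMulEquiv.symm_apply_apply x⟩

/-- Conjugation `x ↦ a x a⁻¹` by an element `a` of `K`. -/
def conj (a : K) : EquivariantAut n K where
  toMulEquiv := MulAut.conj (a : G)
  contMDiff_toFun := (contMDiff_const.mul contMDiff_id).mul contMDiff_const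
  contMDiff_invFun := (contMDiff_const.mul contMDiff_id).mul contMDiff_const
  map_subgroup := by
    ext x
    simp only [Subgroup.mem_map]
    constructor
    · rintro ⟨y, hy, rfl⟩
      exact K.mul_mem (K.mul_mem a.2 hy) (K.inv_mem a.2)
    · intro hx
      refine ⟨(a : G)⁻¹ * x * a, K.mul_mem (K.mul_mem (K.inv_mem a.2) hx) a.2, ?_⟩
      simp [mul_assoc]

/-- The differential `dφ|_e : 𝔤 → 𝔤` of the automorphism `φ` of `G`. -/
def differential (φ : EquivariantAut n K) :
    EuclideanSpace ℝ (Fin n) →L[ℝ] EuclideanSpace ℝ (Fin n) :=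
  diffAtOne n φ.toMulEquiv

lemma differential_symm_apply (φ : EquivariantAut n K) (X : EuclideanSpace ℝ (Fin n)) :
    φ.symm.differential (φ.differential X) = X := by
  have h := diffAtOne_comp (n := n) φ.symm.toMulEquiv φ.toMulEquiv φ.symm.contMDiff_toFun
    φ.contMDiff_toFun (map_one _) X
  have h' : (φ.symm.toMulEquiv : G → G) ∘ φ.toMulEquiv = id :=
    funext fun x => φ.toMulEquiv.symm_apply_apply x
  rw [h', diffAtOne_id] at h
  exact h.symm

lemma differential_mem (φ : EquivariantAut n K) :
    subgroupLieAlgebra n K ≤ (subgroupLieAlgebra n K).comap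
      (φ.differential.toLinearMap : GroupLieAlgebra (𝓡 n) G →ₗ[ℝ] GroupLieAlgebra (𝓡 n) G) := by
  rintro X ⟨σ, hσ, hσK, hσ0, rfl⟩
  exact ⟨φ.toMulEquiv ∘ σ, φ.contMDiff_toFun.comp hσ, fun t => φ.apply_mem (hσK t),
    by simp [hσ0], initialVelocity_comp _ φ.contMDiff_toFun σ hσ hσ0⟩

/-- The differential at the origin `o` of the equivariant diffeomorphism `aK ↦ φ(a)K` of `G/K`,
i.e. the map induced by `dφ|_e` on `T_o(G/K) = 𝔤/𝔨`. -/
def diffAtOrigin (φ : EquivariantAut n K) : OriginTangent n K ≃ₗ[ℝ] OriginTangent n K :=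
  LinearEquiv.ofLinearMap
    ((subgroupLieAlgebra n K).mapQ _ _ φ.differential_mem)
    ((subgroupLieAlgebra n K).mapQ _ _ φ.symm.differential_mem)
    (by
      ext X
      exact congrArg (Submodule.Quotient.mk (p := subgroupLieAlgebra n K))
        (φ.symm.differential_symm_apply X))
    (by
      ext X
      exact congrArg (Submodule.Quotient.mk (p := subgroupLieAlgebra n K))
        (φ.differential_symm_apply X))

end EquivariantAut

/-- The space of `G`-invariant tensor fields (more precisely: tuples of them) on `G/K`, identified
with their values at the origin, which are the `Ad(K)`-invariant tensors on `T_o(G/K) = 𝔤/𝔨`. -/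
def IsInvariantTensor {ι : Type*} {r s : ι → ℕ} {K : Subgroup G}
    (γ : TensorTuple (OriginTangent n K) r s) : Prop :=
  ∀ a : K, γ.pullback (EquivariantAut.conj (n := n) a).diffAtOrigin = γ

/-- The pull-back `f^*γ` of a `G`-invariant tensor field `γ` on `G/K` by `f ∈ Aut(G/K)`, in terms of
the values at the origin (which is fixed by `f`). -/
def EquivariantAut.pullback {ι : Type*} {r s : ι → ℕ} {K : Subgroup G} (f : EquivariantAut n K)
    (γ : TensorTuple (OriginTangent n K) r s) : TensorTuple (OriginTangent n K) r s :=
  TensorTuple.pullback f.diffAtOrigin γ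

/-- The soliton equation `q(γ) = c γ + θ(D_𝔭) γ` for some derivation `D` of `𝔤` with `D 𝔨 ⊆ 𝔨`,
where `D_𝔭` is the map induced by `D` on `𝔤/𝔨`. -/
def IsSemialgebraicSoliton {ι : Type*} {r s : ι → ℕ} {K : Subgroup G}
    (q : TensorTuple (OriginTangent n K) r s → TensorTuple (OriginTangent n K) r s)
    (γ : TensorTuple (OriginTangent n K) r s) (c : ℝ) : Prop :=
  ∃ (D : LieDerivation ℝ (GroupLieAlgebra (𝓡 n) G) (GroupLieAlgebra (𝓡 n) G))
    (hD : subgroupLieAlgebra n K ≤ (subgroupLieAlgebra n K).comap D.toLinearMap),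
    q γ = c • γ + TensorTuple.theta ((subgroupLieAlgebra n K).mapQ _ D.toLinearMap hD) γ

end Homogeneous

/-- The interval of those `t` for which `(1 - α) c t + 1` is positive: the maximal interval of
definition of the scaling factor `((1 - α) c t + 1) ^ (1 / (1 - α))`. -/
def selfSimilarInterval (α c : ℝ) : Set ℝ := {t | 0 < (1 - α) * c * t + 1}

/-- `δ` is a solution in `Γ` on the time set `J` (an open interval around `0` in all uses) of
the flow `d/dt γ(t) = q(γ(t))`, `γ(0) = γ₀`. -/
structure IsFlowSolution {W : Type*} [NormedAddCommGroup W] [NormedSpace ℝ W] (Γ : Set W)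
    (q : W → W) (γ₀ : W) (J : Set ℝ) (δ : ℝ → W) : Prop where
  initial : δ 0 = γ₀
  mem : ∀ t ∈ J, δ t ∈ Γ
  hasDerivAt : ∀ t ∈ J, HasDerivAt δ (q (δ t)) t

end

/-! Suppose automorphisms `F_τ` of `G` preserve `K` and have differential `exp(-τA)`. Then `F_τ^*γ`
has derivative `F_τ^*(θ(A)γ)` in `τ`. If `θ(A)γ = q(γ) - cγ`, the curve `a·F_τ^*γ` with `a' = c a^α`
and `τ' = a^(α-1)` has derivative `a^α F_τ^*(q(γ)) = q(a·F_τ^*γ)`, by the homogeneity and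
equivariance of `q`. With `u = (1-α)ct + 1` the scalar equations are solved by `a = u^(1/(1-α))` and
`τ' = 1/u` (`exists_scaling`). Uniqueness holds because `q` is locally Lipschitz on `Γ`.

What remains is to find the `F_τ`, fixing `K` pointwise. They are not generated by `D` itself but by
`A = D + [·, Z]` with `Z ∈ 𝔨`. This is harmless: `γ` is `Ad(K)`-invariant, so the additional term of
`θ(A)γ` vanishes (`IsInvariantTensor.theta_eq_zero`).

The element `Z` comes from group cocycles `w(xy) = w(x) + Ad(x)w(y)`. The 1-form `Ad(g) ∘ D ∘
(Maurer-Cartan form)` is closed because `D` is a derivation, and its local primitive is a local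
cocycle. This amounts to a local homomorphism into the affine transformations of `𝔤`, which extends
to all of `G` by simple connectedness (`exists_monoidHom_eventuallyEq`, `exists_cocycle`). Since `D𝔨
⊆ 𝔨` and the connected closed group `K` is generated by its smooth curves
(`Subgroup.le_of_forall_curve_mem`), `w` maps `K` into `𝔨`. The Haar average `Z` of `w` over `K`
satisfies `w = Z - Ad(·)Z` on `K`, so `w + Ad(·)Z - Z` is a cocycle that vanishes on `K` and has
derivative `A` at the identity (`exists_cocycle_eq_zero_on`).

For such a cocycle the vector field `g ↦ w(g)g` is multiplicative: products of integral curves are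
integral curves. Its local flow therefore consists of local homomorphisms, which extend to
automorphisms of `G`. They fix `K` because the field vanishes there, and their differentials are
`exp(tA)` because `A` is the linearization of the field at the identity
(`IsCocycleOf.exists_equivariantAut`). Iteration gives all times `t`. -/

/-! ### Extension of local homomorphisms from a simply connected group -/

section LocalHomomorphisms

variable {G : Type*} [TopologicalSpace G] [Group G] [IsTopologicalGroup G]

/-- A subgroup of a connected topological group containing a neighbourhood of `1` is everything. -/
lemma Subgroup.mem_of_mem_nhds_one [PreconnectedSpace G] (S : Subgroup G)
    (h : (S : Set G) ∈ 𝓝 (1 : G)) (x : G) : x ∈ S := by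
  have hopen : IsOpen (S : Set G) := S.isOpen_of_mem_nhds h
  have hclosed : IsClosed (S : Set G) := S.isClosed_of_isOpen hopen
  have huniv : (S : Set G) = univ := IsClopen.eq_univ ⟨hclosed, hopen⟩ ⟨1, S.one_mem⟩
  have hx : x ∈ (S : Set G) := huniv ▸ mem_univ x
  exact hx

/-- The bundle with discrete fibre `H` over `G` associated with a local homomorphism `φ`. -/
noncomputable def localHomBundle {H : Type*} [Group H] [TopologicalSpace H] [DiscreteTopology H]
    (φ : G → H) (W : Set G) (hW : IsOpen W) (h1 : (1 : G) ∈ W)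
    (hφ : ∀ a b c x : G, a⁻¹ * x ∈ W → b⁻¹ * x ∈ W → c⁻¹ * x ∈ W →
      φ (a⁻¹ * b) * φ (b⁻¹ * c) = φ (a⁻¹ * c)) : FiberBundleCore G G H where
  baseSet a := {x | a⁻¹ * x ∈ W}
  isOpen_baseSet a := hW.preimage (continuous_const_mul a⁻¹)
  indexAt := id
  mem_baseSet_at x := by simpa using h1
  coordChange a b _ v := v * φ (a⁻¹ * b)
  coordChange_self a x hx v := by
    have h := hφ a a a x hx hx hx
    simp only [inv_mul_cancel] at h ⊢
    rw [mul_eq_left.mp h, mul_one]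
  continuousOn_coordChange a b :=
    ((continuous_of_discreteTopology (f := fun v : H => v * φ (a⁻¹ * b))).comp
      continuous_snd).continuousOn
  coordChange_comp a b c x hx v := by
    rw [mul_assoc, hφ a b c x hx.1.1 hx.1.2 hx.2]

/-- A local homomorphism from a neighbourhood of `1` in a simply connected group to an arbitrary
group extends to a global homomorphism. -/
theorem exists_monoidHom_eventuallyEq [SimplyConnectedSpace G] [LocallyPathConnectedSpace G]
    {H : Type*} [Group H] (φ : G → H)
    (hφ : ∀ᶠ p : G × G in 𝓝 (1, 1), φ (p.1 * p.2) = φ p.1 * φ p.2) :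
    ∃ Φ : G →* H, ∀ᶠ x in 𝓝 (1 : G), Φ x = φ x := by
  -- With the discrete topology on `H`, a bundle with fibre `H` is a covering of `G`.
  let _ : TopologicalSpace H := ⊥
  have : DiscreteTopology H := ⟨rfl⟩
  have hquot : Filter.Tendsto (fun p : G × G × G => (p.1 * p.2.1⁻¹, p.2.1 * p.2.2⁻¹))
      (𝓝 (1, 1, 1)) (𝓝 ((1 : G), (1 : G))) := by
    have hc : Continuous (fun p : G × G × G => (p.1 * p.2.1⁻¹, p.2.1 * p.2.2⁻¹)) := by fun_prop
    simpa using hc.tendsto (1, 1, 1)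
  have hev := hquot.eventually hφ
  rw [nhds_prod_eq, nhds_prod_eq] at hev
  -- Quotients appear because `(a⁻¹x)(b⁻¹x)⁻¹ = a⁻¹b`: applied to three such points, this is the
  -- cocycle condition for the transition functions.
  obtain ⟨W₀, hW₀, hW₀'⟩ : ∃ W₀ ∈ 𝓝 (1 : G), ∀ a ∈ W₀, ∀ b ∈ W₀, ∀ c ∈ W₀,
      φ (a * b⁻¹ * (b * c⁻¹)) = φ (a * b⁻¹) * φ (b * c⁻¹) := by
    obtain ⟨s, hs, t, ht, hst⟩ := Filter.mem_prod_iff.mp hev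
    obtain ⟨t₁, ht₁, t₂, ht₂, ht₁₂⟩ := Filter.mem_prod_iff.mp ht
    refine ⟨s ∩ (t₁ ∩ t₂), Filter.inter_mem hs (Filter.inter_mem ht₁ ht₂),
      fun a ha b hb c hc => ?_⟩
    exact hst (show (a, b, c) ∈ s ×ˢ t from ⟨ha.1, ht₁₂ ⟨hb.2.1, hc.2.2⟩⟩)
  -- `W` has to be connected, so that sections of the covering are constant in the trivialization
  -- over each translate `aW`.
  obtain ⟨W, ⟨hWo, h1W, hWc⟩, hWW₀⟩ :=
    (LocallyConnectedSpace.open_connected_basis (1 : G)).mem_iff.mp hW₀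
  have hcocycle : ∀ a b c x : G, a⁻¹ * x ∈ W → b⁻¹ * x ∈ W → c⁻¹ * x ∈ W →
      φ (a⁻¹ * b) * φ (b⁻¹ * c) = φ (a⁻¹ * c) := by
    intro a b c x ha hb hc
    have h := hW₀' _ (hWW₀ ha) _ (hWW₀ hb) _ (hWW₀ hc)
    have e1 : a⁻¹ * x * (b⁻¹ * x)⁻¹ = a⁻¹ * b := by group
    have e2 : b⁻¹ * x * (c⁻¹ * x)⁻¹ = b⁻¹ * c := by group
    rw [e1, e2] at h
    rw [← h]
    congr 1
    group
  let Z := localHomBundle φ W hWo h1W hcocycle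
  have hφ1 : φ 1 = 1 := by
    have h := hcocycle 1 1 1 1 (by simpa using h1W) (by simpa using h1W) (by simpa using h1W)
    simpa using h
  have hcov : IsCoveringMap Z.proj := FiberBundle.isCoveringMap (F := H) (E := Z.Fiber)
  -- Simple connectedness enters here: the identity of `G` lifts to a global section of the
  -- covering. Its fibre coordinate at `x`, in the trivialization indexed by `x` itself, is the
  -- homomorphism sought.
  obtain ⟨s, ⟨hs1, hsp⟩, -⟩ := hcov.existsUnique_continuousMap_lifts (ContinuousMap.id G) (1 : G)
    (⟨1, (1 : H)⟩ : Z.TotalSpace) rfl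
  have hsp' : ∀ x, (s x).1 = x := fun x => congrFun hsp x
  let Φ : G → H := fun x => (s x).2
  -- In the trivialization indexed by `a` the section is a continuous map from the connected set
  -- `aW` to a discrete space, hence constant.
  have hloc : ∀ a x : G, a⁻¹ * x ∈ W → Φ x * φ (x⁻¹ * a) = Φ a := by
    intro a x hx
    have hcont : ContinuousOn (fun y => (Z.localTriv a (s y)).2) {y | a⁻¹ * y ∈ W} := by
      refine continuous_snd.comp_continuousOn ((Z.localTriv a).continuousOn.comp
        s.continuous.continuousOn ?_)
      intro y hy
      rw [Z.mem_localTriv_source]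
      change a⁻¹ * (s y).1 ∈ W
      rw [hsp']
      exact hy
    have hval : ∀ y, (Z.localTriv a (s y)).2 = Φ y * φ (y⁻¹ * a) := by
      intro y
      rw [Z.localTriv_apply]
      change Φ y * φ ((s y).1⁻¹ * a) = _
      rw [hsp']
    have hpre : IsPreconnected {y | a⁻¹ * y ∈ W} := by
      have : {y | a⁻¹ * y ∈ W} = (fun y => a * y) '' W := by
        ext y
        constructor
        · intro hy
          exact ⟨a⁻¹ * y, hy, by simp⟩
        · rintro ⟨z, hz, rfl⟩
          simpa using hz
      rw [this]
      exact hWc.isPreconnected.image _ (continuous_const_mul a).continuousOn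
    have h := hpre.constant hcont hx (show a⁻¹ * a ∈ W by simpa using h1W)
    rw [hval, hval] at h
    simpa [hφ1] using h
  have hmul : ∀ a, ∀ y ∈ W, Φ (a * y) = Φ a * φ y := by
    intro a y hy
    have h := hloc a (a * y) (by simpa using hy)
    have h2 := hcocycle 1 y 1 y (by simpa using hy) (by simpa using h1W) (by simpa using hy)
    simp only [inv_one, one_mul, mul_one, hφ1] at h2
    have e : (a * y)⁻¹ * a = y⁻¹ := by group
    rw [e] at h
    rw [← h, mul_assoc, mul_eq_one_iff_eq_inv.mp h2]
    simp
  have hΦ1 : Φ 1 = 1 := by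
    have h := congrArg (fun p : Z.TotalSpace => (p.2 : H)) hs1
    exact h
  have hΦφ : ∀ y ∈ W, Φ y = φ y := by
    intro y hy
    simpa [hΦ1] using hmul 1 y hy
  -- Multiplicativity is known for right factors in `W`. The right factors for which it holds form a
  -- subgroup, which is then everything.
  let S : Subgroup G :=
    { carrier := {y | ∀ a, Φ (a * y) = Φ a * Φ y}
      one_mem' := fun a => by simp [hΦ1]
      mul_mem' := fun {x y} hx hy a => by
        rw [← mul_assoc, hy, hx, hy x, mul_assoc]
      inv_mem' := fun {x} hx a => by
        have h1 := hx (a * x⁻¹)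
        have h2 := hx x⁻¹
        simp only [inv_mul_cancel_right, inv_mul_cancel, hΦ1] at h1 h2
        rw [h1, mul_assoc, mul_eq_one_iff_eq_inv'.mp h2.symm, inv_mul_cancel, mul_one] }
  have hS : (S : Set G) ∈ 𝓝 (1 : G) := by
    filter_upwards [hWo.mem_nhds h1W] with y hy a
    rw [hmul a y hy, hΦφ y hy]
  refine ⟨⟨⟨Φ, hΦ1⟩, fun a y => S.mem_of_mem_nhds_one hS y a⟩, ?_⟩
  filter_upwards [hWo.mem_nhds h1W] with y hy using hΦφ y hy

end LocalHomomorphisms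

/-! ### A chart of the group centred at the identity -/

section UnitChart

variable (n : ℕ) {G : Type*} [TopologicalSpace G] [ChartedSpace (EuclideanSpace ℝ (Fin n)) G]
  [Group G]

/-- The preferred chart at the identity of a Lie group, translated so as to take `1` to `0`. -/
noncomputable def unitCoord (x : G) : EuclideanSpace ℝ (Fin n) :=
  extChartAt (𝓡 n) (1 : G) x - extChartAt (𝓡 n) (1 : G) 1

variable (G) in
/-- The inverse of the chart `unitCoord`. -/
noncomputable def unitParam (v : EuclideanSpace ℝ (Fin n)) : G :=
  (extChartAt (𝓡 n) (1 : G)).symm (v + extChartAt (𝓡 n) (1 : G) 1)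

variable (G) in
/-- The domain of the chart `unitCoord`. -/
def unitSource : Set G := (extChartAt (𝓡 n) (1 : G)).source

variable (G) in
/-- The range of the chart `unitCoord`. -/
def unitTarget : Set (EuclideanSpace ℝ (Fin n)) :=
  {v | v + extChartAt (𝓡 n) (1 : G) 1 ∈ (extChartAt (𝓡 n) (1 : G)).target}

lemma isOpen_unitSource : IsOpen (unitSource n G) := isOpen_extChartAt_source 1

lemma isOpen_unitTarget : IsOpen (unitTarget n G) :=
  (isOpen_extChartAt_target (1 : G)).preimage (continuous_add_const _)

lemma one_mem_unitSource : (1 : G) ∈ unitSource n G := mem_extChartAt_source 1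

lemma unitSource_mem_nhds : unitSource n G ∈ 𝓝 (1 : G) :=
  (isOpen_unitSource n).mem_nhds (one_mem_unitSource n)

lemma zero_mem_unitTarget : (0 : EuclideanSpace ℝ (Fin n)) ∈ unitTarget n G := by
  simp only [unitTarget, mem_ofPred_eq, zero_add]
  exact mem_extChartAt_target 1

lemma unitTarget_mem_nhds : unitTarget n G ∈ 𝓝 (0 : EuclideanSpace ℝ (Fin n)) :=
  (isOpen_unitTarget n).mem_nhds (zero_mem_unitTarget n)

@[simp] lemma unitCoord_one : unitCoord n (1 : G) = 0 := sub_self _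

@[simp] lemma unitParam_zero : unitParam n G 0 = 1 := by
  rw [unitParam, zero_add]
  exact extChartAt_to_inv 1

variable {n}

lemma unitCoord_unitParam {v : EuclideanSpace ℝ (Fin n)} (hv : v ∈ unitTarget n G) :
    unitCoord n (unitParam n G v) = v := by
  rw [unitCoord, unitParam, (extChartAt (𝓡 n) (1 : G)).right_inv hv, add_sub_cancel_right]

lemma unitParam_unitCoord {x : G} (hx : x ∈ unitSource n G) :
    unitParam n G (unitCoord n x) = x := by
  rw [unitParam, unitCoord, sub_add_cancel]
  exact (extChartAt (𝓡 n) (1 : G)).left_inv hx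

lemma unitParam_mem {v : EuclideanSpace ℝ (Fin n)} (hv : v ∈ unitTarget n G) :
    unitParam n G v ∈ unitSource n G := (extChartAt (𝓡 n) (1 : G)).map_target hv

lemma unitCoord_mem {x : G} (hx : x ∈ unitSource n G) : unitCoord n x ∈ unitTarget n G := by
  rw [unitTarget, mem_ofPred_eq, unitCoord, sub_add_cancel]
  exact (extChartAt (𝓡 n) (1 : G)).map_source hx

variable [LieGroup (𝓡 n) ∞ G]

lemma contMDiffAt_unitCoord {x : G} (hx : x ∈ unitSource n G) :
    ContMDiffAt (𝓡 n) 𝓘(ℝ, EuclideanSpace ℝ (Fin n)) ∞ (unitCoord n : G → _) x := by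
  have : IsManifold (𝓡 n) ∞ G := inferInstance
  have h : ContMDiffAt (𝓡 n) 𝓘(ℝ, EuclideanSpace ℝ (Fin n)) ∞ (extChartAt (𝓡 n) (1 : G)) x := by
    refine contMDiffAt_extChartAt' ?_
    rwa [unitSource, extChartAt_source] at hx
  exact h.sub contMDiffAt_const

lemma contMDiffAt_unitParam {v : EuclideanSpace ℝ (Fin n)} (hv : v ∈ unitTarget n G) :
    ContMDiffAt 𝓘(ℝ, EuclideanSpace ℝ (Fin n)) (𝓡 n) ∞ (unitParam n G) v := by
  have : IsManifold (𝓡 n) ∞ G := inferInstance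
  have h := (contMDiffOn_extChartAt_symm (I := 𝓡 n) (n := ∞) (1 : G)).contMDiffAt
    ((isOpen_extChartAt_target (1 : G)).mem_nhds hv)
  have h2 : ContMDiffAt 𝓘(ℝ, EuclideanSpace ℝ (Fin n)) 𝓘(ℝ, EuclideanSpace ℝ (Fin n)) ∞
    (fun w => w + extChartAt (𝓡 n) (1 : G) 1) v := (contDiff_id.add contDiff_const).contMDiff v
  exact ContMDiffAt.comp v h h2

lemma continuousAt_unitParam {v : EuclideanSpace ℝ (Fin n)} (hv : v ∈ unitTarget n G) :
    ContinuousAt (unitParam n G) v := (contMDiffAt_unitParam hv).continuousAt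

lemma continuousAt_unitCoord {x : G} (hx : x ∈ unitSource n G) :
    ContinuousAt (unitCoord n : G → _) x := (contMDiffAt_unitCoord hx).continuousAt

lemma tendsto_unitParam : Filter.Tendsto (unitParam n G) (𝓝 0) (𝓝 1) := by
  have h := continuousAt_unitParam (zero_mem_unitTarget (G := G) n)
  rwa [ContinuousAt, unitParam_zero] at h

lemma tendsto_unitCoord : Filter.Tendsto (unitCoord n : G → _) (𝓝 1) (𝓝 0) := by
  have h := continuousAt_unitCoord (one_mem_unitSource (G := G) n)
  rwa [ContinuousAt, unitCoord_one] at h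

/-- A smooth map into `G` read in the chart at the identity is smooth. -/
lemma ContMDiffAt.contDiffAt_unitCoord {F : Type*} [NormedAddCommGroup F] [NormedSpace ℝ F]
    {f : F → G} {x : F} (hf : ContMDiffAt 𝓘(ℝ, F) (𝓡 n) ∞ f x) (hx : f x ∈ unitSource n G) :
    ContDiffAt ℝ ∞ (fun y => unitCoord n (f y)) x :=
  (ContMDiffAt.comp x (contMDiffAt_unitCoord hx) hf).contDiffAt

end UnitChart

/-! ### Differentials and velocities at the identity in the centred chart -/

section UnitChartDerivatives

variable {n : ℕ} {G : Type*} [TopologicalSpace G] [ChartedSpace (EuclideanSpace ℝ (Fin n)) G]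
  [Group G] [LieGroup (𝓡 n) ∞ G]

/-- As `φ` fixes `1`, the manifold derivative uses the same chart on both sides, and translating
that chart does not change derivatives. -/
lemma diffAtOne_eq_fderiv (φ : G → G) (hφ : MDifferentiableAt (𝓡 n) (𝓡 n) φ 1)
    (h1 : φ 1 = 1) :
    diffAtOne n φ = fderiv ℝ (fun v => unitCoord n (φ (unitParam n G v))) 0 := by
  have e : fderiv ℝ (fun v => unitCoord n (φ (unitParam n G v))) 0 =
      fderiv ℝ (fun w => extChartAt (𝓡 n) (1 : G) (φ ((extChartAt (𝓡 n) (1 : G)).symm w)))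
        (extChartAt (𝓡 n) (1 : G) 1) := by
    have h := fderiv_comp_add_right (𝕜 := ℝ) (x := (0 : EuclideanSpace ℝ (Fin n)))
      (f := fun w => extChartAt (𝓡 n) (1 : G) (φ ((extChartAt (𝓡 n) (1 : G)).symm w)))
      (extChartAt (𝓡 n) (1 : G) 1)
    rw [zero_add] at h
    rw [← h]
    exact fderiv_sub_const _
  rw [e]
  have h2 : fderivWithin ℝ (writtenInExtChartAt (𝓡 n) (𝓡 n) 1 φ) (range (𝓡 n))
      (extChartAt (𝓡 n) (1 : G) 1) =
      fderiv ℝ (fun w => extChartAt (𝓡 n) (1 : G) (φ ((extChartAt (𝓡 n) (1 : G)).symm w)))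
        (extChartAt (𝓡 n) (1 : G) 1) := by
    simp only [writtenInExtChartAt, h1, modelWithCornersSelf_coe, range_id, fderivWithin_univ]
    rfl
  exact hφ.mfderiv.trans h2

lemma initialVelocity_eq_deriv (σ : ℝ → G) (hσ : MDifferentiableAt 𝓘(ℝ, ℝ) (𝓡 n) σ 0)
    (h0 : σ 0 = 1) : initialVelocity n σ = deriv (fun t => unitCoord n (σ t)) 0 := by
  have e : deriv (fun t => unitCoord n (σ t)) 0 =
      deriv (fun t => extChartAt (𝓡 n) (1 : G) (σ t)) 0 := deriv_sub_const _
  rw [e]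
  have h2 : fderivWithin ℝ (writtenInExtChartAt 𝓘(ℝ, ℝ) (𝓡 n) 0 σ) (range 𝓘(ℝ, ℝ))
      (extChartAt 𝓘(ℝ, ℝ) (0 : ℝ) 0) = fderiv ℝ (fun t => extChartAt (𝓡 n) (1 : G) (σ t)) 0 := by
    simp only [writtenInExtChartAt, h0, modelWithCornersSelf_coe, range_id, fderivWithin_univ]
    rfl
  have h3 : initialVelocity n σ = fderivWithin ℝ (writtenInExtChartAt 𝓘(ℝ, ℝ) (𝓡 n) 0 σ)
      (range 𝓘(ℝ, ℝ)) (extChartAt 𝓘(ℝ, ℝ) (0 : ℝ) 0) (1 : ℝ) :=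
    congrArg (fun L : ℝ →L[ℝ] EuclideanSpace ℝ (Fin n) => L 1) hσ.mfderiv
  rw [h3, h2, fderiv_apply_one_eq_deriv]

lemma HasDerivAt.of_initialVelocity (σ : ℝ → G) (hσ : ContMDiff 𝓘(ℝ, ℝ) (𝓡 n) ∞ σ)
    (h0 : σ 0 = 1) : HasDerivAt (fun t => unitCoord n (σ t)) (initialVelocity n σ) 0 := by
  rw [initialVelocity_eq_deriv σ (hσ.mdifferentiableAt (by simp)) h0]
  have h : ContDiffAt ℝ ∞ (fun t => unitCoord n (σ t)) 0 :=
    (hσ 0).contDiffAt_unitCoord (h0 ▸ one_mem_unitSource n)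
  exact (h.differentiableAt (by simp)).hasDerivAt

end UnitChartDerivatives

/-! ### Translations, Maurer-Cartan form and adjoint representation in coordinates -/

section CoordDeriv

variable {n : ℕ} {G : Type*} [TopologicalSpace G] [ChartedSpace (EuclideanSpace ℝ (Fin n)) G]
  [Group G]

variable (n) in
/-- The derivative at `x` of a map `φ : G → G`, read in the chart at the identity. -/
noncomputable def coordDeriv (φ : G → G) (x : G) :
    EuclideanSpace ℝ (Fin n) →L[ℝ] EuclideanSpace ℝ (Fin n) :=
  fderiv ℝ (fun v => unitCoord n (φ (unitParam n G v))) (unitCoord n x)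

variable [LieGroup (𝓡 n) ∞ G]

lemma ContMDiffAt.contDiffAt_coord {φ : G → G} {x : G} (hφ : ContMDiffAt (𝓡 n) (𝓡 n) ∞ φ x)
    (hx : x ∈ unitSource n G) (hφx : φ x ∈ unitSource n G) :
    ContDiffAt ℝ ∞ (fun v => unitCoord n (φ (unitParam n G v))) (unitCoord n x) := by
  refine ContMDiffAt.contDiffAt_unitCoord ?_ (by rwa [unitParam_unitCoord hx])
  refine ContMDiffAt.comp_of_eq (f := unitParam n G) (y := x) hφ
    (contMDiffAt_unitParam (unitCoord_mem hx)) (unitParam_unitCoord hx)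

lemma ContMDiffAt.hasFDerivAt_coord {φ : G → G} {x : G} (hφ : ContMDiffAt (𝓡 n) (𝓡 n) ∞ φ x)
    (hx : x ∈ unitSource n G) (hφx : φ x ∈ unitSource n G) :
    HasFDerivAt (fun v => unitCoord n (φ (unitParam n G v))) (coordDeriv n φ x)
      (unitCoord n x) :=
  ((hφ.contDiffAt_coord hx hφx).differentiableAt (by simp)).hasFDerivAt

/-- One fixed chart is used at all points, so differentials are endomorphisms of a single vector
space; the price is that all points must stay in its domain. The product identities below are
instances for suitable `φ` and `ψ`. -/
lemma coordDeriv_comp {φ ψ : G → G} {x : G} (hψ : ContMDiffAt (𝓡 n) (𝓡 n) ∞ ψ (φ x))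
    (hφ : ContMDiffAt (𝓡 n) (𝓡 n) ∞ φ x) (hx : x ∈ unitSource n G)
    (hφx : φ x ∈ unitSource n G) (hψx : ψ (φ x) ∈ unitSource n G) :
    coordDeriv n (fun y => ψ (φ y)) x = (coordDeriv n ψ (φ x)).comp (coordDeriv n φ x) := by
  have hψ' := hψ.hasFDerivAt_coord hφx hψx
  have e : unitCoord n (φ x) = (fun v => unitCoord n (φ (unitParam n G v))) (unitCoord n x) := by
    simp only [unitParam_unitCoord hx]
  rw [e] at hψ'
  have hcomp := hψ'.comp (unitCoord n x) (hφ.hasFDerivAt_coord hx hφx)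
  refine HasFDerivAt.fderiv (hcomp.congr_of_eventuallyEq ?_)
  have hcont : ContinuousAt (fun v => φ (unitParam n G v)) (unitCoord n x) :=
    ContinuousAt.comp_of_eq (y := x) hφ.continuousAt
      (continuousAt_unitParam (unitCoord_mem hx)) (unitParam_unitCoord hx)
  have hnhds : unitSource n G ∈ 𝓝 (φ (unitParam n G (unitCoord n x))) := by
    rw [unitParam_unitCoord hx]
    exact (isOpen_unitSource n).mem_nhds hφx
  filter_upwards [hcont.preimage_mem_nhds hnhds] with v hv
  simp only [Function.comp_apply]
  rw [unitParam_unitCoord hv]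

lemma coordDeriv_id {x : G} (hx : x ∈ unitSource n G) :
    coordDeriv n (fun y : G => y) x = ContinuousLinearMap.id ℝ _ := by
  refine HasFDerivAt.fderiv ((hasFDerivAt_id _).congr_of_eventuallyEq ?_)
  filter_upwards [(isOpen_unitTarget n).mem_nhds (unitCoord_mem hx)] with v hv
  exact unitCoord_unitParam hv

variable (n)

/-- Left translation by `g`, from the Lie algebra to the tangent space at `g`. -/
noncomputable def leftDeriv (g : G) := coordDeriv n (fun y => g * y) 1

/-- Right translation by `g`, from the Lie algebra to the tangent space at `g`. -/
noncomputable def rightDeriv (g : G) := coordDeriv n (fun y => y * g) 1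

/-- The Maurer-Cartan form: left translation by `g⁻¹`, from the tangent space at `g` to the Lie
algebra. -/
noncomputable def maurerCartan (g : G) := coordDeriv n (fun y => g⁻¹ * y) g

/-- The adjoint representation. -/
noncomputable def adjointRep (g : G) := coordDeriv n (fun y => g * y * g⁻¹) 1

variable {n}

lemma contMDiffAt_const_mul (g x : G) : ContMDiffAt (𝓡 n) (𝓡 n) ∞ (fun y : G => g * y) x :=
  contMDiff_mul_left x

lemma contMDiffAt_mul_const (g x : G) : ContMDiffAt (𝓡 n) (𝓡 n) ∞ (fun y : G => y * g) x :=
  contMDiff_mul_right x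

lemma contMDiffAt_conj (g x : G) : ContMDiffAt (𝓡 n) (𝓡 n) ∞ (fun y : G => g * y * g⁻¹) x :=
  (contMDiffAt_mul_const g⁻¹ (g * x)).comp x (contMDiffAt_const_mul g x)

lemma adjointRep_mul (g h : G) : adjointRep n (g * h) = (adjointRep n g).comp (adjointRep n h) := by
  have e : (fun y : G => g * h * y * (g * h)⁻¹) = fun y => g * (h * y * h⁻¹) * g⁻¹ := by
    funext y; group
  have h1 : h * 1 * h⁻¹ = 1 := by simp
  have h2 : g * 1 * g⁻¹ = 1 := by simp
  have H := coordDeriv_comp (n := n) (x := (1 : G)) (contMDiffAt_conj g (h * 1 * h⁻¹))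
    (contMDiffAt_conj h 1) (one_mem_unitSource n) (by rw [h1]; exact one_mem_unitSource n)
    (by rw [h1, h2]; exact one_mem_unitSource n)
  rw [h1] at H
  rw [adjointRep, e, H]
  rfl

lemma adjointRep_one : adjointRep n (1 : G) = ContinuousLinearMap.id ℝ _ := by
  have e : (fun y : G => 1 * y * 1⁻¹) = fun y => y := by funext y; simp
  rw [adjointRep, e, coordDeriv_id (one_mem_unitSource n)]

lemma leftDeriv_one : leftDeriv n (1 : G) = ContinuousLinearMap.id ℝ _ := by
  have e : (fun y : G => 1 * y) = fun y => y := by funext y; simp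
  rw [leftDeriv, e, coordDeriv_id (one_mem_unitSource n)]

lemma rightDeriv_one : rightDeriv n (1 : G) = ContinuousLinearMap.id ℝ _ := by
  have e : (fun y : G => y * 1) = fun y => y := by funext y; simp
  rw [rightDeriv, e, coordDeriv_id (one_mem_unitSource n)]

lemma maurerCartan_one : maurerCartan n (1 : G) = ContinuousLinearMap.id ℝ _ := by
  have e : (fun y : G => 1⁻¹ * y) = fun y => y := by funext y; simp
  rw [maurerCartan, e, coordDeriv_id (one_mem_unitSource n)]

lemma maurerCartan_comp_leftDeriv {g : G} (hg : g ∈ unitSource n G) :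
    (maurerCartan n g).comp (leftDeriv n g) = ContinuousLinearMap.id ℝ _ := by
  have H := coordDeriv_comp (n := n) (x := (1 : G)) (φ := fun y => g * y) (ψ := fun y => g⁻¹ * y)
    (contMDiffAt_const_mul _ _) (contMDiffAt_const_mul _ _) (one_mem_unitSource n)
    (by simpa using hg) (by simpa using one_mem_unitSource n)
  simp only [inv_mul_cancel_left, mul_one] at H
  rw [coordDeriv_id (one_mem_unitSource n)] at H
  exact H.symm

lemma leftDeriv_mul {g h : G} (hh : h ∈ unitSource n G) (hgh : g * h ∈ unitSource n G) :
    leftDeriv n (g * h) = (coordDeriv n (fun y => g * y) h).comp (leftDeriv n h) := by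
  have H := coordDeriv_comp (n := n) (x := (1 : G)) (φ := fun y => h * y) (ψ := fun y => g * y)
    (contMDiffAt_const_mul _ _) (contMDiffAt_const_mul _ _) (one_mem_unitSource n)
    (by simpa using hh) (by simpa using hgh)
  simp only [← mul_assoc, mul_one] at H
  exact H

lemma maurerCartan_mul {g h : G} (hh : h ∈ unitSource n G) (hgh : g * h ∈ unitSource n G) :
    (maurerCartan n (g * h)).comp (coordDeriv n (fun y => g * y) h) = maurerCartan n h := by
  have H := coordDeriv_comp (n := n) (x := h) (φ := fun y => g * y) (ψ := fun y => (g * h)⁻¹ * y)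
    (contMDiffAt_const_mul _ _) (contMDiffAt_const_mul _ _) hh hgh
    (by simpa using one_mem_unitSource n)
  simp only [mul_inv_rev, inv_mul_cancel_left, mul_assoc] at H
  rw [maurerCartan, maurerCartan, H]
  simp only [mul_inv_rev, mul_assoc]

lemma rightDeriv_mul {g h : G} (hg : g ∈ unitSource n G) (hgh : g * h ∈ unitSource n G) :
    rightDeriv n (g * h) = (coordDeriv n (fun y => y * h) g).comp (rightDeriv n g) := by
  have H := coordDeriv_comp (n := n) (x := (1 : G)) (φ := fun y => y * g) (ψ := fun y => y * h)
    (contMDiffAt_mul_const _ _) (contMDiffAt_mul_const _ _) (one_mem_unitSource n)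
    (by simpa using hg) (by simpa using hgh)
  simp only [mul_assoc, one_mul] at H
  exact H

/-- Differentiate `(g y g⁻¹) g = g y` at `y = 1`. -/
lemma rightDeriv_comp_adjointRep {g : G} (hg : g ∈ unitSource n G) :
    (rightDeriv n g).comp (adjointRep n g) = leftDeriv n g := by
  have H := coordDeriv_comp (n := n) (x := (1 : G)) (φ := fun y => g * y * g⁻¹)
    (ψ := fun y => y * g) (contMDiffAt_mul_const _ _) (contMDiffAt_conj _ _)
    (one_mem_unitSource n) (by simpa using one_mem_unitSource n) (by simpa using hg)
  simp only [inv_mul_cancel_right, mul_one, mul_inv_cancel] at H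
  exact H.symm

/-- Differentiate `(g y g⁻¹)(g h) = g (y h)` at `y = 1`. This makes the vector fields of cocycles
multiplicative. -/
lemma rightDeriv_mul_comp_adjointRep {g h : G} (hh : h ∈ unitSource n G)
    (hgh : g * h ∈ unitSource n G) :
    (rightDeriv n (g * h)).comp (adjointRep n g) =
      (coordDeriv n (fun y => g * y) h).comp (rightDeriv n h) := by
  have H := coordDeriv_comp (n := n) (x := (1 : G)) (φ := fun y => g * y * g⁻¹)
    (ψ := fun y => y * (g * h)) (contMDiffAt_mul_const _ _) (contMDiffAt_conj _ _)
    (one_mem_unitSource n) (by simpa using one_mem_unitSource n) (by simpa using hgh)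
  have H2 := coordDeriv_comp (n := n) (x := (1 : G)) (φ := fun y => y * h)
    (ψ := fun y => g * y) (contMDiffAt_const_mul _ _) (contMDiffAt_mul_const _ _)
    (one_mem_unitSource n) (by simpa using hh) (by simpa using hgh)
  have e : (fun y : G => g * y * g⁻¹ * (g * h)) = fun y => g * (y * h) := by
    funext y; group
  rw [e] at H
  simp only [one_mul, mul_one, mul_inv_cancel] at H H2
  rw [rightDeriv, rightDeriv, adjointRep, ← H, ← H2]

end CoordDeriv

/-! ### Smooth dependence of these differentials on the base point -/

section Smoothness

variable {n : ℕ} {G : Type*} [TopologicalSpace G] [ChartedSpace (EuclideanSpace ℝ (Fin n)) G]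
  [Group G] [LieGroup (𝓡 n) ∞ G]

local notation "E" => EuclideanSpace ℝ (Fin n)

lemma contDiffAt_unitCoord_mul {p : E × E} (h1 : p.1 ∈ unitTarget n G) (h2 : p.2 ∈ unitTarget n G)
    (h : unitParam n G p.1 * unitParam n G p.2 ∈ unitSource n G) :
    ContDiffAt ℝ ∞ (fun q : E × E => unitCoord n (unitParam n G q.1 * unitParam n G q.2)) p := by
  refine ContMDiffAt.contDiffAt_unitCoord (ContMDiffAt.mul ?_ ?_) h
  · exact ContMDiffAt.comp (g := unitParam n G) p (contMDiffAt_unitParam h1)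
      contDiffAt_fst.contMDiffAt
  · exact ContMDiffAt.comp (g := unitParam n G) p (contMDiffAt_unitParam h2)
      contDiffAt_snd.contMDiffAt

lemma contDiffAt_leftDeriv {u : E} (hu : u ∈ unitTarget n G) :
    ContDiffAt ℝ ∞ (fun u => leftDeriv n (unitParam n G u)) u := by
  have h := ContDiffAt.fderiv (𝕜 := ℝ) (n := ∞) (m := ∞) (x₀ := u)
    (f := fun u v : E => unitCoord n (unitParam n G u * unitParam n G v)) (g := fun _ => 0)
    (contDiffAt_unitCoord_mul (p := (u, 0)) hu (zero_mem_unitTarget n)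
      (by simpa using unitParam_mem hu)) contDiffAt_const (by simp)
  unfold leftDeriv coordDeriv
  rwa [unitCoord_one]

lemma contDiffAt_rightDeriv {u : E} (hu : u ∈ unitTarget n G) :
    ContDiffAt ℝ ∞ (fun u => rightDeriv n (unitParam n G u)) u := by
  have h := ContDiffAt.fderiv (𝕜 := ℝ) (n := ∞) (m := ∞) (x₀ := u)
    (f := fun u v : E => unitCoord n (unitParam n G v * unitParam n G u)) (g := fun _ => 0)
    (by
      have := contDiffAt_unitCoord_mul (p := ((0 : E), u)) (zero_mem_unitTarget n) hu
        (by simpa using unitParam_mem hu)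
      exact ContDiffAt.comp (u, (0 : E)) (f := fun q : E × E => (q.2, q.1)) this
        (contDiffAt_snd.prodMk contDiffAt_fst)) contDiffAt_const (by simp)
  unfold rightDeriv coordDeriv
  rwa [unitCoord_one]

lemma contDiffAt_maurerCartan {u : E} (hu : u ∈ unitTarget n G) :
    ContDiffAt ℝ ∞ (fun u => maurerCartan n (unitParam n G u)) u := by
  have h := ContDiffAt.fderiv (𝕜 := ℝ) (n := ∞) (m := ∞) (x₀ := u)
    (f := fun u v : E => unitCoord n ((unitParam n G u)⁻¹ * unitParam n G v)) (g := id)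
    (by
      refine ContMDiffAt.contDiffAt_unitCoord
        (f := fun q : E × E => (unitParam n G q.1)⁻¹ * unitParam n G q.2)
        (ContMDiffAt.mul (ContMDiffAt.inv ?_) ?_) (by simpa using one_mem_unitSource n)
      · exact ContMDiffAt.comp (g := unitParam n G) (u, u) (contMDiffAt_unitParam hu)
          contDiffAt_fst.contMDiffAt
      · exact ContMDiffAt.comp (g := unitParam n G) (u, u) (contMDiffAt_unitParam hu)
          contDiffAt_snd.contMDiffAt) contDiffAt_id (by simp)
  refine h.congr_of_eventuallyEq ?_
  filter_upwards [(isOpen_unitTarget n).mem_nhds hu] with v hv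
  rw [maurerCartan, coordDeriv, unitCoord_unitParam hv, id]

lemma contDiffAt_adjointRep {u : E} (hu : u ∈ unitTarget n G) :
    ContDiffAt ℝ ∞ (fun u => adjointRep n (unitParam n G u)) u := by
  have h := ContDiffAt.fderiv (𝕜 := ℝ) (n := ∞) (m := ∞) (x₀ := u)
    (f := fun u v : E => unitCoord n (unitParam n G u * unitParam n G v * (unitParam n G u)⁻¹))
    (g := fun _ => 0)
    (by
      have h1 : ContMDiffAt 𝓘(ℝ, E × E) (𝓡 n) ∞ (fun q : E × E => unitParam n G q.1) (u, 0) :=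
        ContMDiffAt.comp (g := unitParam n G) (u, (0 : E)) (contMDiffAt_unitParam hu)
          contDiffAt_fst.contMDiffAt
      have h2 : ContMDiffAt 𝓘(ℝ, E × E) (𝓡 n) ∞ (fun q : E × E => unitParam n G q.2) (u, 0) :=
        ContMDiffAt.comp (g := unitParam n G) (u, (0 : E))
          (contMDiffAt_unitParam (zero_mem_unitTarget n)) contDiffAt_snd.contMDiffAt
      exact ContMDiffAt.contDiffAt_unitCoord
        (f := fun q : E × E => unitParam n G q.1 * unitParam n G q.2 * (unitParam n G q.1)⁻¹)
        ((h1.mul h2).mul h1.inv) (by simpa using one_mem_unitSource n))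
    contDiffAt_const (by simp)
  unfold adjointRep coordDeriv
  rwa [unitCoord_one]

end Smoothness

/-! ### The Lie bracket as antisymmetrized second derivative of the multiplication -/

section Bracket

variable {n : ℕ} {G : Type*} [TopologicalSpace G] [ChartedSpace (EuclideanSpace ℝ (Fin n)) G]
  [Group G] [LieGroup (𝓡 n) ∞ G]

local notation "E" => EuclideanSpace ℝ (Fin n)

variable (n G) in
/-- The second order term of the multiplication in the chart at the identity. -/
noncomputable def mulHessian : E →L[ℝ] E →L[ℝ] E :=
  fderiv ℝ (fun u => leftDeriv n (unitParam n G u)) 0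

lemma hasFDerivAt_leftDeriv :
    HasFDerivAt (fun u => leftDeriv n (unitParam n G u)) (mulHessian n G) 0 :=
  ((contDiffAt_leftDeriv (zero_mem_unitTarget n)).differentiableAt (by simp)).hasFDerivAt

/-- The derivatives of left and right translation at `0` are the two mixed second partial
derivatives of the multiplication at `(0, 0)`, which agree up to the order of the arguments by
symmetry of second derivatives. -/
lemma hasFDerivAt_rightDeriv :
    HasFDerivAt (fun u => rightDeriv n (unitParam n G u)) (mulHessian n G).flip 0 := by
  let M : E × E → E := fun q => unitCoord n (unitParam n G q.1 * unitParam n G q.2)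
  have hM : ContDiffAt ℝ ∞ M (0, 0) := contDiffAt_unitCoord_mul (zero_mem_unitTarget n)
    (zero_mem_unitTarget n) (by simpa using one_mem_unitSource n)
  have hM1 : ∀ u ∈ unitTarget n G, HasFDerivAt M (fderiv ℝ M (u, 0)) (u, 0) := fun u hu =>
    ((contDiffAt_unitCoord_mul (p := (u, 0)) hu (zero_mem_unitTarget n)
      (by simpa using unitParam_mem hu)).differentiableAt (by simp)).hasFDerivAt
  have hM2 : ∀ u ∈ unitTarget n G, HasFDerivAt M (fderiv ℝ M (0, u)) (0, u) := fun u hu =>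
    ((contDiffAt_unitCoord_mul (p := (0, u)) (zero_mem_unitTarget n) hu
      (by simpa using unitParam_mem hu)).differentiableAt (by simp)).hasFDerivAt
  have hD : HasFDerivAt (fderiv ℝ M) (fderiv ℝ (fderiv ℝ M) (0, 0)) (0, 0) :=
    ((hM.fderiv_right (m := 1) (by norm_cast)).differentiableAt (by simp)).hasFDerivAt
  have hsymm : ∀ p q, fderiv ℝ (fderiv ℝ M) (0, 0) p q = fderiv ℝ (fderiv ℝ M) (0, 0) q p :=
    fun p q => hM.isSymmSndFDerivAt (by
      rw [minSmoothness_of_isRCLikeNormedField]; norm_cast) p q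
  have hL : ∀ u ∈ unitTarget n G, leftDeriv n (unitParam n G u) =
      (fderiv ℝ M (u, 0)).comp (ContinuousLinearMap.inr ℝ E E) := by
    intro u hu
    have h := HasFDerivAt.comp (f := fun e : E => (u, e)) (0 : E) (hM1 u hu)
      (hasFDerivAt_prodMk_right u (0 : E))
    rw [leftDeriv, coordDeriv, unitCoord_one]
    exact h.fderiv
  have hR : ∀ u ∈ unitTarget n G, rightDeriv n (unitParam n G u) =
      (fderiv ℝ M (0, u)).comp (ContinuousLinearMap.inl ℝ E E) := by
    intro u hu
    have h := HasFDerivAt.comp (f := fun e : E => (e, u)) (0 : E) (hM2 u hu)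
      (hasFDerivAt_prodMk_left (0 : E) u)
    rw [rightDeriv, coordDeriv, unitCoord_one]
    exact h.fderiv
  have hL' : HasFDerivAt (fun u => leftDeriv n (unitParam n G u)) _ 0 :=
    ((HasFDerivAt.comp (f := fun e : E => (e, (0 : E))) (0 : E) hD
      (hasFDerivAt_prodMk_left (0 : E) (0 : E))).clm_comp
      (hasFDerivAt_const (ContinuousLinearMap.inr ℝ E E) (0 : E))).congr_of_eventuallyEq
      (Filter.mem_of_superset (unitTarget_mem_nhds n) hL)
  have hR' : HasFDerivAt (fun u => rightDeriv n (unitParam n G u)) _ 0 :=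
    ((HasFDerivAt.comp (f := fun e : E => ((0 : E), e)) (0 : E) hD
      (hasFDerivAt_prodMk_right (0 : E) (0 : E))).clm_comp
      (hasFDerivAt_const (ContinuousLinearMap.inl ℝ E E) (0 : E))).congr_of_eventuallyEq
      (Filter.mem_of_superset (unitTarget_mem_nhds n) hR)
  refine hR'.congr_fderiv ?_
  have e := hL'.unique hasFDerivAt_leftDeriv
  rw [← e]
  ext1 a
  ext1 b
  simp only [ContinuousLinearMap.flip_apply]
  simp [hsymm (0, a) (b, 0)]

/-- Product rule for `dR_u ∘ Ad(u) = dL_u` at `u = 0`, where all factors are the identity. -/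
lemma hasFDerivAt_adjointRep :
    HasFDerivAt (fun u => adjointRep n (unitParam n G u))
      (mulHessian n G - (mulHessian n G).flip) 0 := by
  have hA : HasFDerivAt (fun u => adjointRep n (unitParam n G u)) _ 0 :=
    ((contDiffAt_adjointRep (zero_mem_unitTarget n)).differentiableAt (by simp)).hasFDerivAt
  have h := (hasFDerivAt_rightDeriv.clm_comp hA).congr_of_eventuallyEq
    (f₁ := fun u => leftDeriv n (unitParam n G u))
    (Filter.mem_of_superset (unitTarget_mem_nhds n) fun u hu =>
      (rightDeriv_comp_adjointRep (unitParam_mem hu)).symm)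
  have e := h.unique hasFDerivAt_leftDeriv
  refine hA.congr_fderiv (ContinuousLinearMap.ext fun a => ContinuousLinearMap.ext fun b => ?_)
  have e' := congrArg (fun L => L a b) e
  simp only [unitParam_zero, rightDeriv_one, adjointRep_one] at e'
  exact eq_sub_of_add_eq e'

/-- Product rule at `u = 0` for the identity saying that the Maurer-Cartan form inverts left
translation. -/
lemma hasFDerivAt_maurerCartan :
    HasFDerivAt (fun u => maurerCartan n (unitParam n G u)) (-mulHessian n G) 0 := by
  have hA : HasFDerivAt (fun u => maurerCartan n (unitParam n G u)) _ 0 :=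
    ((contDiffAt_maurerCartan (zero_mem_unitTarget n)).differentiableAt (by simp)).hasFDerivAt
  have h := (hA.clm_comp hasFDerivAt_leftDeriv).congr_of_eventuallyEq
    (f₁ := fun _ => ContinuousLinearMap.id ℝ E)
    (Filter.mem_of_superset (unitTarget_mem_nhds n) fun u hu =>
      (maurerCartan_comp_leftDeriv (unitParam_mem hu)).symm)
  have e := h.unique (hasFDerivAt_const _ _)
  refine hA.congr_fderiv (ContinuousLinearMap.ext fun a => ContinuousLinearMap.ext fun b => ?_)
  have e' := congrArg (fun L => L a b) e
  simp only [unitParam_zero, maurerCartan_one, leftDeriv_one] at e'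
  exact eq_neg_of_add_eq_zero_right e'

open VectorField

/-- The pull-back applies the inverse of the derivative of the inverse chart, which is the
derivative of the chart; the chain rule then gives the derivative of left translation read in the
chart. -/
lemma mpullbackWithin_mulInvariantVectorField (b : E) {w : E}
    (hw : w ∈ (extChartAt (𝓡 n) (1 : G)).target) :
    mpullbackWithin 𝓘(ℝ, E) (𝓡 n) (extChartAt (𝓡 n) (1 : G)).symm
      (mulInvariantVectorField (I := 𝓡 n) (G := G) b) (range (𝓡 n)) w =
      leftDeriv n ((extChartAt (𝓡 n) (1 : G)).symm w) b := by
  have hinv : (mfderivWithin 𝓘(ℝ, E) (𝓡 n) (extChartAt (𝓡 n) (1 : G)).symm (range (𝓡 n)) w).inverse =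
      mfderiv (𝓡 n) 𝓘(ℝ, E) (extChartAt (𝓡 n) (1 : G)) ((extChartAt (𝓡 n) (1 : G)).symm w) :=
    ContinuousLinearMap.inverse_eq (mfderivWithin_extChartAt_symm_comp_mfderiv_extChartAt hw)
      (mfderiv_extChartAt_comp_mfderivWithin_extChartAt_symm hw)
  refine (congrArg (fun L : E →L[ℝ] E => L (mulInvariantVectorField (I := 𝓡 n) (G := G) b
    ((extChartAt (𝓡 n) (1 : G)).symm w))) hinv).trans ?_
  set g := (extChartAt (𝓡 n) (1 : G)).symm w with hg
  have hgS : g ∈ unitSource n G := (extChartAt (𝓡 n) (1 : G)).map_target hw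
  have hκ : MDifferentiableAt (𝓡 n) 𝓘(ℝ, E) (extChartAt (𝓡 n) (1 : G)) g :=
    mdifferentiableAt_extChartAt (by rwa [unitSource, extChartAt_source] at hgS)
  have hmul : MDifferentiableAt (𝓡 n) (𝓡 n) (fun y : G => g * y) 1 :=
    (contMDiffAt_const_mul g 1).mdifferentiableAt (by simp)
  have hcomp := mfderiv_comp_apply_of_eq (x := (1 : G)) hκ hmul (mul_one g) b
  refine hcomp.symm.trans ?_
  have hd : MDifferentiableAt (𝓡 n) 𝓘(ℝ, E)
      ((extChartAt (𝓡 n) (1 : G)) ∘ fun y : G => g * y) 1 := by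
    refine MDifferentiableAt.comp (1 : G) ?_ hmul
    rwa [mul_one]
  refine (congrArg (fun L : E →L[ℝ] E => L b) hd.mfderiv).trans ?_
  refine congrArg (fun L : E →L[ℝ] E => L b) ?_
  rw [leftDeriv, coordDeriv, unitCoord_one]
  have h := fderiv_comp_add_right (𝕜 := ℝ) (x := (0 : E))
    (f := fun w => extChartAt (𝓡 n) (1 : G) (g * (extChartAt (𝓡 n) (1 : G)).symm w))
    (extChartAt (𝓡 n) (1 : G) 1)
  rw [zero_add] at h
  have e : fderivWithin ℝ (writtenInExtChartAt (𝓡 n) 𝓘(ℝ, E) 1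
      ((extChartAt (𝓡 n) (1 : G)) ∘ fun y : G => g * y)) (range (𝓡 n))
      (extChartAt (𝓡 n) (1 : G) 1) =
      fderiv ℝ (fun w => extChartAt (𝓡 n) (1 : G) (g * (extChartAt (𝓡 n) (1 : G)).symm w))
        (extChartAt (𝓡 n) (1 : G) 1) := by
    simp only [writtenInExtChartAt, modelWithCornersSelf_coe, range_id, fderivWithin_univ]
    rfl
  refine e.trans (h.symm.trans ?_)
  exact (fderiv_sub_const _).symm

/-- In the chart, the bracket of two fields `V`, `W` is `DW(V) - DV(W)`. The left invariant field of
`c` has value `c` and derivative `mulHessian(·, c)` at the identity. -/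
theorem lie_eq_mulHessian (a b : GroupLieAlgebra (𝓡 n) G) :
    ⁅a, b⁆ = mulHessian n G a b - mulHessian n G b a := by
  set e₀ : E := extChartAt (𝓡 n) (1 : G) 1 with he₀
  have hV : ∀ c : E, HasFDerivAt (mpullbackWithin 𝓘(ℝ, E) (𝓡 n) (extChartAt (𝓡 n) (1 : G)).symm
      (mulInvariantVectorField (I := 𝓡 n) (G := G) c) (range (𝓡 n)))
      ((mulHessian n G).flip c) e₀ := by
    intro c
    have h1 : HasFDerivAt (fun u => leftDeriv n (unitParam n G u) c) ((mulHessian n G).flip c)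
        (e₀ - e₀) := by
      rw [sub_self]
      exact ((ContinuousLinearMap.apply ℝ E c).hasFDerivAt.comp (0 : E)
        (hasFDerivAt_leftDeriv (n := n) (G := G))).congr_fderiv (by ext1 a; rfl)
    have h2 := HasFDerivAt.comp (f := fun w : E => w - e₀) e₀ h1
      ((hasFDerivAt_id e₀).sub_const e₀)
    refine (h2.congr_fderiv (by ext1 a; rfl)).congr_of_eventuallyEq ?_
    filter_upwards [(isOpen_extChartAt_target (1 : G)).mem_nhds (mem_extChartAt_target 1)]
      with w hw
    rw [mpullbackWithin_mulInvariantVectorField c hw]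
    simp [unitParam, he₀]
  have hV0 : ∀ c : E, mpullbackWithin 𝓘(ℝ, E) (𝓡 n) (extChartAt (𝓡 n) (1 : G)).symm
      (mulInvariantVectorField (I := 𝓡 n) (G := G) c) (range (𝓡 n)) e₀ = c := by
    intro c
    rw [mpullbackWithin_mulInvariantVectorField c (mem_extChartAt_target 1), extChartAt_to_inv,
      leftDeriv_one]
    rfl
  have hid : (mfderiv (𝓡 n) 𝓘(ℝ, E) (extChartAt (𝓡 n) (1 : G)) 1).inverse =
      ContinuousLinearMap.id ℝ E := by
    have h : mfderiv (𝓡 n) 𝓘(ℝ, E) (extChartAt (𝓡 n) (1 : G)) 1 = ContinuousLinearMap.id ℝ E :=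
      mfderiv_extChartAt_self
    rw [h]
    exact ContinuousLinearMap.inverse_id
  let W : E → E → E := fun c => mpullbackWithin 𝓘(ℝ, E) (𝓡 n) (extChartAt (𝓡 n) (1 : G)).symm
    (mulInvariantVectorField (I := 𝓡 n) (G := G) c) (range (𝓡 n))
  have hb : ⁅a, b⁆ = (mfderiv (𝓡 n) 𝓘(ℝ, E) (extChartAt (𝓡 n) (1 : G)) 1).inverse
      (@lieBracketWithin ℝ _ E _ _ (W a) (W b)
        ((extChartAt (𝓡 n) (1 : G)).symm ⁻¹' univ ∩ range (𝓡 n)) e₀) := rfl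
  refine hb.trans ((congrArg (fun L : E →L[ℝ] E => L (@lieBracketWithin ℝ _ E _ _ (W a) (W b)
    ((extChartAt (𝓡 n) (1 : G)).symm ⁻¹' univ ∩ range (𝓡 n)) e₀)) hid).trans ?_)
  have hset : (extChartAt (𝓡 n) (1 : G)).symm ⁻¹' univ ∩ range (𝓡 n) = univ := by simp
  have hl : @lieBracketWithin ℝ _ E _ _ (W a) (W b)
      ((extChartAt (𝓡 n) (1 : G)).symm ⁻¹' univ ∩ range (𝓡 n)) e₀ =
      fderiv ℝ (W b) e₀ (W a e₀) - fderiv ℝ (W a) e₀ (W b e₀) := by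
    rw [hset, lieBracketWithin_univ]
    rfl
  refine hl.trans ?_
  have h1 : fderiv ℝ (W a) e₀ = (mulHessian n G).flip a := (hV a).fderiv
  have h2 : fderiv ℝ (W b) e₀ = (mulHessian n G).flip b := (hV b).fderiv
  rw [h1, h2]
  exact congrArg₂ (· - ·) (congrArg ((mulHessian n G).flip b) (hV0 a))
    (congrArg ((mulHessian n G).flip a) (hV0 b))

end Bracket

/-! ### Local flows near a zero, their linearization, and uniqueness of solutions -/

section LocalFlow

variable {W : Type*} [NormedAddCommGroup W] [NormedSpace ℝ W]

/-- Variation of constants: conjugating by `exp(-tA)` leaves only the deviation of `z` from the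
linear equation `z' = Az`. -/
lemma hasDerivAt_exp_neg_smul_apply [CompleteSpace W] (A : W →L[ℝ] W) {z : ℝ → W} {z' : W} {t : ℝ}
    (hz : HasDerivAt z z' t) :
    HasDerivAt (fun s => NormedSpace.exp (s • (-A)) (z s))
      (NormedSpace.exp (t • (-A)) (z' - A (z t))) t := by
  have h := (hasDerivAt_exp_smul_const (𝕂 := ℝ) (-A) t).clm_apply hz
  refine h.congr_deriv ?_
  simp only [mul_apply_eq_comp, neg_apply, map_neg, map_sub]
  abel

lemma exp_smul_apply_exp_neg_smul [CompleteSpace W] (A : W →L[ℝ] W) (t : ℝ) (v : W) :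
    NormedSpace.exp (t • A) (NormedSpace.exp (t • (-A)) v) = v := by
  let _ : NormedAlgebra ℚ (W →L[ℝ] W) := NormedAlgebra.restrictScalars ℚ ℝ _
  have h : NormedSpace.exp (t • A) * NormedSpace.exp (t • (-A)) = 1 := by
    rw [← NormedSpace.exp_add_of_commute, smul_neg, add_neg_cancel, NormedSpace.exp_zero]
    rw [smul_neg]
    exact (Commute.refl _).neg_right
  exact congrArg (fun L : W →L[ℝ] W => L v) h

/-- The local flow of a vector field near a zero of the vector field, and its linearization. -/
theorem exists_local_flow [FiniteDimensional ℝ W] {F : W → W} {A : W →L[ℝ] W}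
    (hF : HasStrictFDerivAt F A 0) (h0 : F 0 = 0) :
    ∃ ε > 0, ∃ (α : W → ℝ → W) (L : NNReal),
      (∀ U ∈ 𝓝 (0 : W), ∀ᶠ x in 𝓝 0, α x 0 = x ∧ ∀ t ∈ Ioo (-ε) ε,
        HasDerivAt (α x) (F (α x t)) t ∧ α x t ∈ U) ∧
      (∃ U ∈ 𝓝 (0 : W), ∀ t ∈ Ioo (-ε) ε, LipschitzOnWith L (fun x => α x t) U) ∧
      ∀ t ∈ Ioo (-ε) ε, HasStrictFDerivAt (fun x => α x t) (NormedSpace.exp (t • A)) 0 := by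
  have : CompleteSpace W := FiniteDimensional.complete ℝ W
  obtain ⟨k, s, hs, hk⟩ := hF.exists_lipschitzOnWith
  -- A globally Lipschitz extension allows Picard-Lindelöf on a ball of fixed radius; small
  -- trajectories do not notice the change.
  obtain ⟨g, hg, hFg⟩ := hk.extend_finite_dimension
  set K := lipschitzExtensionConstant W * k with hK
  have hg0 : g 0 = 0 := by rw [← hFg (mem_of_mem_nhds hs), h0]
  -- On the unit ball the speed is at most `K`, so `Kε ≤ 1/2` keeps trajectories that start within
  -- radius `1/2` inside it.
  set ε : ℝ := 1 / (2 * (K + 1)) with hε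
  have hεpos : 0 < ε := by positivity
  have hpl : IsPicardLindelof (fun _ => g) (tmin := -ε) (tmax := ε)
      ⟨0, by constructor <;> linarith⟩ (0 : W) 1 (1 / 2) K K := by
    refine IsPicardLindelof.of_time_independent (fun x hx => ?_) hg.lipschitzOnWith ?_
    · have h := hg.dist_le_mul x 0
      rw [hg0, dist_zero_right, dist_zero_right] at h
      rw [mem_closedBall_zero_iff] at hx
      refine h.trans ?_
      calc (K : ℝ) * ‖x‖ ≤ K * 1 := by gcongr; exact hx
        _ = K := mul_one _
    · simp only [sub_zero, sub_neg_eq_add, zero_add, max_self, NNReal.coe_one, NNReal.coe_div,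
        NNReal.coe_ofNat]
      rw [hε, mul_one_div, div_le_iff₀ (by positivity)]
      ring_nf
      linarith
  obtain ⟨α, hα, L, hL⟩ := hpl.exists_forall_mem_closedBall_eq_hasDerivWithinAt_lipschitzOnWith
  have hr : Metric.closedBall (0 : W) ((1 / 2 : NNReal) : ℝ) ∈ 𝓝 0 :=
    Metric.closedBall_mem_nhds _ (by norm_num)
  have hα' : ∀ x ∈ Metric.closedBall (0 : W) ((1 / 2 : NNReal) : ℝ), ∀ t ∈ Ioo (-ε) ε,
      HasDerivAt (α x) (g (α x t)) t := fun x hx t ht =>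
    ((hα x hx).2 t (Ioo_subset_Icc_self ht)).hasDerivAt (Icc_mem_nhds ht.1 ht.2)
  have hα0 : ∀ t ∈ Ioo (-ε) ε, α 0 t = 0 := by
    refine ODE_solution_unique_of_mem_Ioo (v := fun _ => g) (s := fun _ => univ) (K := K)
      (t₀ := 0) (g := fun _ => (0 : W)) (fun _ _ => hg.lipschitzOnWith) ⟨by linarith, hεpos⟩
      (fun t ht => ⟨hα' 0 (mem_of_mem_nhds hr) t ht, mem_univ _⟩) (fun t _ => ⟨?_, mem_univ _⟩)
      (hα 0 (mem_of_mem_nhds hr)).1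
    rw [hg0]
    exact hasDerivAt_const t (0 : W)
  -- Comparison with the stationary solution `0`: trajectories that start close to `0` stay close to
  -- `0`, uniformly in `t`, and so remain where `g = F`.
  have hbound : ∀ x ∈ Metric.closedBall (0 : W) ((1 / 2 : NNReal) : ℝ), ∀ t ∈ Ioo (-ε) ε,
      ‖α x t‖ ≤ L * ‖x‖ := by
    intro x hx t ht
    have h := (hL t (Ioo_subset_Icc_self ht)).dist_le_mul x hx 0 (mem_of_mem_nhds hr)
    simpa [hα0 t ht] using h
  have hsmall : ∀ U ∈ 𝓝 (0 : W), ∀ᶠ x in 𝓝 (0 : W), x ∈ Metric.closedBall (0 : W)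
      ((1 / 2 : NNReal) : ℝ) ∧ ∀ t ∈ Ioo (-ε) ε, α x t ∈ U := by
    intro U hU
    obtain ⟨η, hη, hηU⟩ := Metric.mem_nhds_iff.1 hU
    have hη' : Metric.ball (0 : W) (η / (L + 1)) ∈ 𝓝 0 :=
      Metric.ball_mem_nhds _ (by positivity)
    filter_upwards [hr, hη'] with x hx hx'
    refine ⟨hx, fun t ht => hηU ?_⟩
    rw [mem_ball_zero_iff] at hx' ⊢
    rw [lt_div_iff₀ (by positivity)] at hx'
    have := hbound x hx t ht
    nlinarith [norm_nonneg x]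
  refine ⟨ε, hεpos, α, L, ?_, ⟨_, hr, fun t ht => hL t (Ioo_subset_Icc_self ht)⟩, ?_⟩
  · intro U hU
    filter_upwards [hsmall _ (Filter.inter_mem hs hU)] with x hx
    refine ⟨(hα x hx.1).1, fun t ht => ⟨?_, (hx.2 t ht).2⟩⟩
    rw [hFg (hx.2 t ht).1]
    exact hα' x hx.1 t ht
  · intro t ht
    obtain ⟨M, hM⟩ : ∃ M, ∀ τ ∈ Icc (-ε) ε, ‖NormedSpace.exp (τ • (-A))‖ ≤ M := by
      refine isCompact_Icc.exists_bound_of_continuousOn ?_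
      exact fun τ _ =>
        (hasDerivAt_exp_smul_const (𝕂 := ℝ) (-A) τ).continuousAt.continuousWithinAt
    have hM0 : 0 ≤ M := (norm_nonneg _).trans (hM 0 ⟨by linarith, hεpos.le⟩)
    refine .of_isLittleO (Asymptotics.isLittleO_iff.2 fun δ hδ => ?_)
    set N := ‖NormedSpace.exp (t • A)‖ with hN
    have hN0 : 0 ≤ N := norm_nonneg _
    -- The denominator absorbs the bounds for both exponentials, the Lipschitz constant of the flow
    -- and the length of time.
    set η : ℝ := δ / ((N + 1) * (M + 1) * (L + 1) * (ε + 1)) with hη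
    have hηpos : 0 < η := by positivity
    have hFs := (Asymptotics.isLittleO_iff.1 hF.isLittleO) hηpos
    rw [nhds_prod_eq, Filter.eventually_prod_self_iff'] at hFs
    obtain ⟨U, hU, hUF⟩ := hFs
    have hboth := (hsmall _ (Filter.inter_mem hs hU))
    rw [nhds_prod_eq]
    filter_upwards [hboth.prod_mk hboth] with p hp
    obtain ⟨⟨hp1, hp1'⟩, hp2, hp2'⟩ := hp
    set z : ℝ → W := fun τ => α p.1 τ - α p.2 τ with hz
    have hzL : ∀ τ ∈ Ioo (-ε) ε, ‖z τ‖ ≤ L * ‖p.1 - p.2‖ := fun τ hτ => by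
      have h := (hL τ (Ioo_subset_Icc_self hτ)).dist_le_mul p.1 hp1 p.2 hp2
      rwa [dist_eq_norm, dist_eq_norm] at h
    -- For the difference of two solutions only the remainder of `F` at two points survives. Strict
    -- differentiability bounds it by `η` times their distance, and the mean value inequality
    -- concludes.
    have hd : ∀ τ ∈ Ioo (-ε) ε, HasDerivWithinAt (fun τ => NormedSpace.exp (τ • (-A)) (z τ))
        (NormedSpace.exp (τ • (-A)) (F (α p.1 τ) - F (α p.2 τ) - A (α p.1 τ - α p.2 τ)))
        (Ioo (-ε) ε) τ := by
      intro τ hτ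
      refine (hasDerivAt_exp_neg_smul_apply A ?_).hasDerivWithinAt
      rw [hFg (hp1' τ hτ).1, hFg (hp2' τ hτ).1]
      exact (hα' p.1 hp1 τ hτ).sub (hα' p.2 hp2 τ hτ)
    have hb : ∀ τ ∈ Ioo (-ε) ε, ‖NormedSpace.exp (τ • (-A))
        (F (α p.1 τ) - F (α p.2 τ) - A (α p.1 τ - α p.2 τ))‖ ≤ M * (η * (L * ‖p.1 - p.2‖)) := by
      intro τ hτ
      refine (ContinuousLinearMap.le_opNorm _ _).trans ?_
      gcongr
      · exact hM τ (Ioo_subset_Icc_self hτ)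
      · refine (hUF _ (hp1' τ hτ).2 _ (hp2' τ hτ).2).trans ?_
        gcongr
        exact hzL τ hτ
    have h0m : (0 : ℝ) ∈ Ioo (-ε) ε := ⟨by linarith, hεpos⟩
    have hmv := (convex_Ioo (-ε) ε).norm_image_sub_le_of_norm_hasDerivWithin_le hd hb h0m ht
    have he : α p.1 t - α p.2 t - NormedSpace.exp (t • A) (p.1 - p.2) =
        NormedSpace.exp (t • A) (NormedSpace.exp (t • (-A)) (z t)
          - NormedSpace.exp ((0 : ℝ) • (-A)) (z 0)) := by
      rw [map_sub (NormedSpace.exp (t • A)) (NormedSpace.exp (t • (-A)) (z t)),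
        exp_smul_apply_exp_neg_smul, zero_smul, NormedSpace.exp_zero]
      simp only [hz, (hα p.1 hp1).1, (hα p.2 hp2).1, one_apply_eq_self]
    rw [he]
    refine (ContinuousLinearMap.le_opNorm _ _).trans ?_
    have ht' : ‖t - 0‖ ≤ ε := by
      rw [sub_zero, Real.norm_eq_abs, abs_le]
      exact ⟨ht.1.le, ht.2.le⟩
    calc N * _ ≤ N * (M * (η * (L * ‖p.1 - p.2‖)) * ε) := by
          gcongr
          exact hmv.trans (by gcongr)
      _ = (N * M * L * ε) * η * ‖p.1 - p.2‖ := by ring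
      _ ≤ ((N + 1) * (M + 1) * (L + 1) * (ε + 1)) * η * ‖p.1 - p.2‖ := by
          have hL0 : (0 : ℝ) ≤ L := L.2
          gcongr <;> linarith
      _ = δ * ‖p.1 - p.2‖ := by
          rw [hη, mul_div_cancel₀]
          positivity

/-- Solutions of an autonomous differential equation with a locally Lipschitz right hand side on an
open interval are unique. -/
theorem ODE_solution_unique_of_locallyLipschitzOn {v : W → W} {s : Set W}
    (hv : LocallyLipschitzOn s v) {J : Set ℝ} (hJ : IsOpen J) (hJc : J.OrdConnected) {f g : ℝ → W}
    (hf : ∀ t ∈ J, HasDerivAt f (v (f t)) t ∧ f t ∈ s)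
    (hg : ∀ t ∈ J, HasDerivAt g (v (g t)) t ∧ g t ∈ s) {t₀ : ℝ} (ht₀ : t₀ ∈ J)
    (heq : f t₀ = g t₀) : EqOn f g J := by
  have key : ∀ t ∈ J, f t = g t → f =ᶠ[𝓝 t] g := by
    intro t ht he
    obtain ⟨K, U, hU, hK⟩ := hv (hf t ht).2
    have hmem : ∀ h : ℝ → W, (∀ t ∈ J, HasDerivAt h (v (h t)) t ∧ h t ∈ s) → h t = f t →
        ∀ᶠ τ in 𝓝 t, HasDerivAt h (v (h τ)) τ ∧ h τ ∈ U := by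
      intro h hh e
      have hc : Filter.Tendsto h (𝓝 t) (𝓝[s] (f t)) := by
        refine tendsto_nhdsWithin_iff.2 ⟨e ▸ (hh t ht).1.continuousAt, ?_⟩
        filter_upwards [hJ.mem_nhds ht] with τ hτ using (hh τ hτ).2
      filter_upwards [hJ.mem_nhds ht, hc.eventually hU] with τ hτ hτ' using ⟨(hh τ hτ).1, hτ'⟩
    exact ODE_solution_unique_of_eventually (v := fun _ => v) (s := fun _ => U)
      (Filter.Eventually.of_forall fun _ => hK) (hmem f hf rfl) (hmem g hg he.symm) he
  -- The times near which `f` and `g` agree form an open set that is also closed relative to the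
  -- connected set `J`.
  have hsub : J ⊆ {t | f =ᶠ[𝓝 t] g} := by
    refine hJc.isPreconnected.subset_of_closure_inter_subset
      isOpen_setOfPred_eventually_nhds ⟨t₀, ht₀, key t₀ ht₀ heq⟩ ?_
    rintro t ⟨htc, htJ⟩
    refine key t htJ ?_
    have hfr : ∃ᶠ τ in 𝓝 t, f τ = g τ :=
      (mem_closure_iff_frequently.1 htc).mono fun τ hτ => hτ.self_of_nhds
    by_contra hne
    have hc := ((hf t htJ).1.continuousAt.sub (hg t htJ).1.continuousAt).eventually_ne
      (sub_ne_zero.2 hne)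
    exact hfr (hc.mono fun τ hτ => sub_ne_zero.1 hτ)
  exact fun t ht => (hsub ht).self_of_nhds

lemma ContDiffAt.locallyLipschitzOn {W' : Type*} [NormedAddCommGroup W'] [NormedSpace ℝ W']
    {v : W → W'} {s : Set W} (hv : ∀ x ∈ s, ContDiffAt ℝ 1 v x) : LocallyLipschitzOn s v := by
  intro x hx
  obtain ⟨K, t, ht, hK⟩ := (hv x hx).exists_lipschitzOnWith
  exact ⟨K, t, mem_nhdsWithin_of_mem_nhds ht, hK⟩

end LocalFlow

/-! ### Integration of a derivation to a cocycle of the adjoint representation -/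

section Cocycle

variable {n : ℕ} {G : Type*} [TopologicalSpace G] [ChartedSpace (EuclideanSpace ℝ (Fin n)) G]
  [Group G] [LieGroup (𝓡 n) ∞ G]

local notation "E" => EuclideanSpace ℝ (Fin n)

lemma adjointRep_inv_apply (g : G) (v : E) : adjointRep n g⁻¹ (adjointRep n g v) = v := by
  have h := adjointRep_mul (n := n) g⁻¹ g
  rw [inv_mul_cancel, adjointRep_one] at h
  exact (congrArg (fun L : E →L[ℝ] E => L v) h).symm

lemma adjointRep_apply_inv (g : G) (v : E) : adjointRep n g (adjointRep n g⁻¹ v) = v := by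
  have h := adjointRep_inv_apply g⁻¹ v
  rwa [inv_inv] at h

/-- The `1`-form on `G` with values in the Lie algebra whose primitive is the cocycle of the
endomorphism `D` of the Lie algebra. -/
noncomputable def cocycleForm (D : E →L[ℝ] E) (g : G) : E →L[ℝ] E :=
  (adjointRep n g).comp (D.comp (maurerCartan n g))

lemma cocycleForm_one (D : E →L[ℝ] E) : cocycleForm D (1 : G) = D := by
  rw [cocycleForm, adjointRep_one, maurerCartan_one]
  rfl

/-- The Maurer-Cartan form is left invariant and `Ad` is multiplicative. This equivariance reduces
closedness to the identity element and yields the cocycle property of the primitive. -/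
lemma cocycleForm_mul (D : E →L[ℝ] E) {g h : G} (hh : h ∈ unitSource n G)
    (hgh : g * h ∈ unitSource n G) :
    (cocycleForm D (g * h)).comp (coordDeriv n (fun y => g * y) h) =
      (adjointRep n g).comp (cocycleForm D h) := by
  ext1 v
  have h1 := congrArg (fun L : E →L[ℝ] E => L v) (maurerCartan_mul hh hgh)
  have h2 := congrArg (fun L : E →L[ℝ] E => L (D (maurerCartan n h v))) (adjointRep_mul (n := n) g h)
  refine Eq.trans ?_ h2
  exact congrArg (fun x => adjointRep n (g * h) (D x)) h1

lemma contDiffAt_cocycleForm (D : E →L[ℝ] E) {u : E} (hu : u ∈ unitTarget n G) :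
    ContDiffAt ℝ ∞ (fun u => cocycleForm D (unitParam n G u)) u :=
  (contDiffAt_adjointRep hu).clm_comp (contDiffAt_const.clm_comp (contDiffAt_maurerCartan hu))

/-- Product rule for `Ad ∘ D ∘ (Maurer-Cartan)`. Antisymmetrized in `a` and `b`, the right side is
`[a, Db] + [Da, b] - D[a, b]`, so closedness at the identity is the derivation property. -/
lemma hasFDerivAt_cocycleForm_zero (D : E →L[ℝ] E) (a b : E) :
    fderiv ℝ (fun u => cocycleForm D (unitParam n G u)) 0 a b =
      mulHessian n G a (D b) - mulHessian n G (D b) a - D (mulHessian n G a b) := by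
  have h := hasFDerivAt_adjointRep (n := n) (G := G) |>.clm_comp
    ((hasFDerivAt_const D (0 : E)).clm_comp (hasFDerivAt_maurerCartan (n := n) (G := G)))
  have e : fderiv ℝ (fun u => cocycleForm D (unitParam n G u)) 0 = _ := h.fderiv
  rw [e]
  simp only [unitParam_zero, adjointRep_one, maurerCartan_one]
  have e1 : ∀ x y z : E, x - y + D (-z) = x - y - D z := fun x y z => by
    rw [map_neg, sub_eq_add_neg (x - y)]
  refine Eq.trans ?_ (e1 _ _ _)
  rw [add_comm]
  simp

/-- Infinitesimal version of the cocycle condition for the bracket `H a b - H b a`. -/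
def IsDerivationOf (H : E →L[ℝ] E →L[ℝ] E) (D : E →L[ℝ] E) : Prop :=
  ∀ a b, D (H a b - H b a) = (H (D a) b - H b (D a)) + (H a (D b) - H (D b) a)

/-- The form is closed at `u` because left translation by `g⁻¹`, read as `T`, takes `u` to `0`. By
equivariance the form is `Ad(g)` applied to its pull-back under `T`, and the term with the second
derivative of `T` is symmetric. -/
lemma fderiv_cocycleForm_symm {D : E →L[ℝ] E} (hD : IsDerivationOf (mulHessian n G) D) {u : E}
    (hu : u ∈ unitTarget n G) (a b : E) :
    fderiv ℝ (fun u => cocycleForm D (unitParam n G u)) u a b =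
      fderiv ℝ (fun u => cocycleForm D (unitParam n G u)) u b a := by
  set g := unitParam n G u with hg
  have hgS : g ∈ unitSource n G := unitParam_mem hu
  have hgu : unitCoord n g = u := unitCoord_unitParam hu
  set T : E → E := fun v => unitCoord n (g⁻¹ * unitParam n G v) with hT
  have hTs : ContDiffAt ℝ ∞ T u := by
    have h := (contMDiffAt_const_mul g⁻¹ g).contDiffAt_coord hgS
      (by simpa using one_mem_unitSource n)
    rwa [hgu] at h
  have hTu : T u = 0 := by simp [hT, ← hg]
  have hev : ∀ᶠ v in 𝓝 u, v ∈ unitTarget n G ∧ g⁻¹ * unitParam n G v ∈ unitSource n G := by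
    refine Filter.Eventually.and ((isOpen_unitTarget n).mem_nhds hu) ?_
    have hc : ContinuousAt (fun v => g⁻¹ * unitParam n G v) u :=
      (contMDiffAt_const_mul (n := n) g⁻¹ (unitParam n G u)).continuousAt.comp (continuousAt_unitParam hu)
    refine hc.preimage_mem_nhds ?_
    simp only [← hg, inv_mul_cancel]
    exact unitSource_mem_nhds n
  have hform : ∀ᶠ v in 𝓝 u, cocycleForm D (unitParam n G v) =
      (adjointRep n g).comp ((cocycleForm D (unitParam n G (T v))).comp (fderiv ℝ T v)) := by
    filter_upwards [hev] with v hv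
    have h := cocycleForm_mul D (g := g⁻¹) (unitParam_mem hv.1) hv.2
    have e1 : coordDeriv n (fun y => g⁻¹ * y) (unitParam n G v) = fderiv ℝ T v := by
      rw [coordDeriv, unitCoord_unitParam hv.1]
    have e2 : unitParam n G (T v) = g⁻¹ * unitParam n G v := unitParam_unitCoord hv.2
    rw [e1, ← e2] at h
    rw [h]
    ext1 x
    exact (adjointRep_apply_inv g _).symm
  have hβ : HasFDerivAt (fun u => cocycleForm D (unitParam n G u))
      (fderiv ℝ (fun u => cocycleForm D (unitParam n G u)) 0) (T u) := by
    rw [hTu]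
    exact ((contDiffAt_cocycleForm D (zero_mem_unitTarget n)).differentiableAt
      (by simp)).hasFDerivAt
  have hT1 : HasFDerivAt T (fderiv ℝ T u) u := (hTs.differentiableAt (by simp)).hasFDerivAt
  have hT2 : HasFDerivAt (fderiv ℝ T) (fderiv ℝ (fderiv ℝ T) u) u :=
    ((hTs.fderiv_right (m := 1) (by norm_cast)).differentiableAt (by simp)).hasFDerivAt
  have hsymm : ∀ p q, fderiv ℝ (fderiv ℝ T) u p q = fderiv ℝ (fderiv ℝ T) u q p :=
    fun p q => hTs.isSymmSndFDerivAt (by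
      rw [minSmoothness_of_isRCLikeNormedField]; norm_cast) p q
  have hder := (((hasFDerivAt_const (adjointRep n g) u).clm_comp
    ((hβ.comp u hT1).clm_comp hT2)).congr_of_eventuallyEq hform).fderiv
  have hval : ∀ p q, fderiv ℝ (fun u => cocycleForm D (unitParam n G u)) u p q = adjointRep n g
      (cocycleForm D (unitParam n G (T u)) (fderiv ℝ (fderiv ℝ T) u p q) +
      fderiv ℝ (fun u => cocycleForm D (unitParam n G u)) 0 (fderiv ℝ T u p) (fderiv ℝ T u q)) := by
    intro p q
    rw [hder]
    simp
  rw [hval, hval, hsymm a b]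
  congr 2
  rw [hasFDerivAt_cocycleForm_zero, hasFDerivAt_cocycleForm_zero]
  have h := hD (fderiv ℝ T u a) (fderiv ℝ T u b)
  rw [map_sub] at h
  rw [sub_eq_iff_eq_add] at h
  rw [h]
  abel

/-- Every derivation `D` of the Lie algebra integrates to a local cocycle. -/
theorem exists_local_cocycle {D : E →L[ℝ] E} (hD : IsDerivationOf (mulHessian n G) D) :
    ∃ f : E → E, f 0 = 0 ∧
      (∀ᶠ u in 𝓝 0, HasFDerivAt f (cocycleForm D (unitParam n G u)) u) ∧
      ∀ᶠ p : E × E in 𝓝 (0, 0), f (unitCoord n (unitParam n G p.1 * unitParam n G p.2)) =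
        f p.1 + adjointRep n (unitParam n G p.1) (f p.2) := by
  obtain ⟨r, hr, hrT⟩ := Metric.mem_nhds_iff.1 (unitTarget_mem_nhds (G := G) n)
  -- Poincaré lemma on a ball.
  obtain ⟨f₀, hf₀⟩ := (convex_ball (0 : E) r).exists_forall_hasFDerivAt_of_fderiv_symmetric
    Metric.isOpen_ball
    (fun u hu => ((contDiffAt_cocycleForm D (hrT hu)).differentiableAt
      (by simp)).differentiableWithinAt)
    (fun u hu => fderiv_cocycleForm_symm hD (hrT hu))
  set f : E → E := fun u => f₀ u - f₀ 0 with hf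
  have hf' : ∀ u ∈ Metric.ball (0 : E) r, HasFDerivAt f (cocycleForm D (unitParam n G u)) u :=
    fun u hu => (hf₀ u hu).sub_const _
  have hf0 : f 0 = 0 := sub_self _
  refine ⟨f, hf0, Filter.mem_of_superset (Metric.ball_mem_nhds 0 hr) hf', ?_⟩
  set M : E × E → E := fun q => unitCoord n (unitParam n G q.1 * unitParam n G q.2) with hM
  have hMc : ∀ᶠ p in 𝓝 ((0 : E), (0 : E)), unitParam n G p.1 * unitParam n G p.2 ∈ unitSource n G ∧
      M p ∈ Metric.ball (0 : E) r := by
    have hc : Filter.Tendsto (fun q : E × E => unitParam n G q.1 * unitParam n G q.2)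
        (𝓝 (0, 0)) (𝓝 1) := by
      have := topologicalGroup_of_lieGroup (𝓡 n) ∞ (G := G)
      have h := ((tendsto_unitParam (n := n) (G := G)).comp (continuous_fst.tendsto ((0 : E), (0 : E)))).mul
        ((tendsto_unitParam (n := n) (G := G)).comp (continuous_snd.tendsto ((0 : E), (0 : E))))
      rwa [mul_one] at h
    exact (hc.eventually (unitSource_mem_nhds n)).and
      ((tendsto_unitCoord.comp hc).eventually (Metric.ball_mem_nhds 0 hr))
  obtain ⟨ρ, hρ, hρM⟩ := Metric.mem_nhds_iff.1 hMc
  refine Filter.mem_of_superset (Metric.ball_mem_nhds _ (lt_min hρ hr)) fun p hp => ?_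
  rw [← ball_prod_same] at hp
  have hsub : Metric.ball (0 : E) (min ρ r) ⊆ Metric.ball (0 : E) ρ :=
    Metric.ball_subset_ball (min_le_left _ _)
  have hsub' : Metric.ball (0 : E) (min ρ r) ⊆ Metric.ball (0 : E) r :=
    Metric.ball_subset_ball (min_le_right _ _)
  have h0 : (0 : E) ∈ Metric.ball (0 : E) (min ρ r) := Metric.mem_ball_self (lt_min hρ hr)
  have hpM : ∀ v ∈ Metric.ball (0 : E) (min ρ r), unitParam n G p.1 * unitParam n G v ∈
      unitSource n G ∧ M (p.1, v) ∈ Metric.ball (0 : E) r := fun v hv =>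
    hρM (show (p.1, v) ∈ Metric.ball ((0 : E), (0 : E)) ρ by
      rw [← ball_prod_same]; exact ⟨hsub hp.1, hsub hv⟩)
  set g := unitParam n G p.1 with hg
  have hd1 : ∀ v ∈ Metric.ball (0 : E) (min ρ r), HasFDerivAt (fun v => f (M (p.1, v)))
      ((adjointRep n g).comp (cocycleForm D (unitParam n G v))) v := by
    intro v hv
    have hvT := hrT (hsub' hv)
    have h1 := (contMDiffAt_const_mul g (unitParam n G v)).hasFDerivAt_coord (unitParam_mem hvT)
      (hpM v hv).1
    rw [unitCoord_unitParam hvT] at h1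
    have h2 := (hf' _ (hpM v hv).2).comp v h1
    refine h2.congr_fderiv ?_
    rw [← cocycleForm_mul D (unitParam_mem hvT) (hpM v hv).1]
    congr 2
    exact unitParam_unitCoord (hpM v hv).1
  have hd2 : ∀ v ∈ Metric.ball (0 : E) (min ρ r), HasFDerivAt (fun v => f p.1 + adjointRep n g (f v))
      ((adjointRep n g).comp (cocycleForm D (unitParam n G v))) v := fun v hv =>
    ((adjointRep n g).hasFDerivAt.comp v (hf' v (hsub' hv))).const_add _
  -- For a fixed first factor, both sides of the cocycle identity have the same derivative in the
  -- second one, by equivariance, and agree when it is `0`.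
  refine Metric.isOpen_ball.eqOn_of_fderiv_eq (convex_ball (0 : E) (min ρ r)).isPreconnected
    (fun v hv => (hd1 v hv).differentiableAt.differentiableWithinAt)
    (fun v hv => (hd2 v hv).differentiableAt.differentiableWithinAt)
    (fun v hv => (hd1 v hv).fderiv.trans (hd2 v hv).fderiv.symm) h0 ?_ hp.2
  simp only [hM, unitParam_zero, mul_one, hf0, map_zero, add_zero]
  rw [unitCoord_unitParam (hrT (hsub' hp.1))]

/-- The affine transformation `v ↦ a + Ad(x) v` of the Lie algebra. -/
noncomputable def adjointAffine (a : E) (x : G) : Equiv.Perm E where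
  toFun v := a + adjointRep n x v
  invFun v := adjointRep n x⁻¹ (v - a)
  left_inv v := by simp only [add_sub_cancel_left, adjointRep_inv_apply]
  right_inv v := by simp only [adjointRep_apply_inv, add_sub_cancel]

/-- Every derivation `D` of the Lie algebra of a simply connected Lie group integrates to a
cocycle of the adjoint representation. -/
theorem exists_cocycle [SimplyConnectedSpace G] {D : E →L[ℝ] E}
    (hD : IsDerivationOf (mulHessian n G) D) :
    ∃ w : G → E, (∀ x y, w (x * y) = w x + adjointRep n x (w y)) ∧
      ∀ᶠ u in 𝓝 0, HasFDerivAt (fun u => w (unitParam n G u))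
        (cocycleForm D (unitParam n G u)) u := by
  have := topologicalGroup_of_lieGroup (𝓡 n) ∞ (G := G)
  have : LocallyPathConnectedSpace G := ChartedSpace.locallyPathConnectedSpace E G
  obtain ⟨f, hf0, hf', hfmul⟩ := exists_local_cocycle hD
  have hcoord : Filter.Tendsto (fun p : G × G => (unitCoord n p.1, unitCoord n p.2))
      (𝓝 (1, 1)) (𝓝 (0, 0)) := by
    rw [nhds_prod_eq, nhds_prod_eq]
    exact tendsto_unitCoord.prodMap tendsto_unitCoord
  -- A cocycle is the translation part of a homomorphism into affine maps with linear part `Ad`. The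
  -- abstract group of permutations suffices as target, since the extension theorem needs no
  -- topology on it.
  obtain ⟨Φ, hΦ⟩ := exists_monoidHom_eventuallyEq
    (fun x : G => adjointAffine (f (unitCoord n x)) x) (by
      have h1 := hcoord.eventually hfmul
      have h2 : ∀ᶠ p : G × G in 𝓝 (1, 1), p.1 ∈ unitSource n G ∧ p.2 ∈ unitSource n G := by
        rw [nhds_prod_eq]
        exact (Filter.Eventually.prod_mk (unitSource_mem_nhds n) (unitSource_mem_nhds n))
      filter_upwards [h1, h2] with p hp hp'
      rw [unitParam_unitCoord hp'.1, unitParam_unitCoord hp'.2] at hp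
      ext1 v
      have h3 := congrArg (fun L : E →L[ℝ] E => L v) (adjointRep_mul (n := n) p.1 p.2)
      refine (congrArg₂ (· + ·) hp h3).trans ?_
      refine (add_assoc _ _ _).trans ?_
      exact congrArg (f (unitCoord n p.1) + ·)
        (map_add (adjointRep n p.1) (f (unitCoord n p.2)) (adjointRep n p.2 v)).symm)
  -- Where `Φ x` is affine with linear part `Ad(x)` is a subgroup containing a neighbourhood of `1`.
  let S : Subgroup G :=
    { carrier := {x | ∀ v, Φ x v = Φ x 0 + adjointRep n x v}
      one_mem' := fun v => by simp [adjointRep_one]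
      mul_mem' := fun {x y} hx hy v => by
        have hx' : ∀ v, Φ x v = Φ x 0 + adjointRep n x v := hx
        have hy' : ∀ v, Φ y v = Φ y 0 + adjointRep n y v := hy
        simp only [map_mul, Equiv.Perm.mul_apply]
        rw [hx' (Φ y v), hy' v, hx' (Φ y 0), adjointRep_mul, map_add, add_assoc]
        rfl
      inv_mem' := fun {x} hx v => by
        have hx' : ∀ v, Φ x v = Φ x 0 + adjointRep n x v := hx
        rw [map_inv, Equiv.Perm.inv_eq_iff_eq, hx', map_add, adjointRep_apply_inv, ← add_assoc,
          ← hx', ← Equiv.Perm.mul_apply, mul_inv_cancel, Equiv.Perm.one_apply, zero_add] }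
  have hS : ∀ x v, Φ x v = Φ x 0 + adjointRep n x v := by
    refine S.mem_of_mem_nhds_one (Filter.mem_of_superset hΦ fun x hx v => ?_)
    have hx' : Φ x = adjointAffine (f (unitCoord n x)) x := hx
    rw [hx']
    simp [adjointAffine]
  refine ⟨fun x => Φ x 0, fun x y => ?_, ?_⟩
  · simp only [map_mul, Equiv.Perm.mul_apply]
    rw [hS]
  · have h1 := (tendsto_unitParam (n := n) (G := G)).eventually hΦ
    filter_upwards [hf', h1.eventually_nhds,
      (isOpen_unitTarget (G := G) n).eventually_mem (zero_mem_unitTarget n)] with u hu hu' huT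
    refine hu.congr_of_eventuallyEq ?_
    filter_upwards [hu', (isOpen_unitTarget n).mem_nhds huT] with v hv hvT
    simp only [hv]
    simp [adjointAffine, unitCoord_unitParam hvT]

end Cocycle

/-! ### The local exponential map -/

section LocalExp

variable {n : ℕ} {G : Type*} [TopologicalSpace G] [ChartedSpace (EuclideanSpace ℝ (Fin n)) G]
  [Group G] [LieGroup (𝓡 n) ∞ G]

local notation "E" => EuclideanSpace ℝ (Fin n)

variable (n G) in
/-- `e B` is, for `B ∈ U`, the integral curve through the identity of the left invariant vector
field defined by `B`, read in the chart at the identity. -/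
structure IsLocalExp (ε : ℝ) (e : E → ℝ → E) (U : Set E) : Prop where
  apply_zero : ∀ B ∈ U, e B 0 = 0
  hasDerivAt : ∀ B ∈ U, ∀ t ∈ Ioo (-ε) ε,
    HasDerivAt (e B) (leftDeriv n (unitParam n G (e B t)) B) t
  mem : ∀ B ∈ U, ∀ t ∈ Ioo (-ε) ε, e B t ∈ unitTarget n G
  mul_mem : ∀ B ∈ U, ∀ s ∈ Ioo (-ε) ε, ∀ t ∈ Ioo (-ε) ε,
    unitParam n G (e B s) * unitParam n G (e B t) ∈ unitSource n G

lemma contDiffAt_leftDeriv_apply (B : E) {u : E} (hu : u ∈ unitTarget n G) :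
    ContDiffAt ℝ ∞ (fun u => leftDeriv n (unitParam n G u) B) u :=
  (contDiffAt_leftDeriv hu).clm_apply contDiffAt_const

lemma locallyLipschitzOn_leftDeriv_apply (B : E) :
    LocallyLipschitzOn (unitTarget n G) (fun u => leftDeriv n (unitParam n G u) B) :=
  ContDiffAt.locallyLipschitzOn fun _ hu => (contDiffAt_leftDeriv_apply B hu).of_le (by simp)

namespace IsLocalExp

lemma zero_mem {ε : ℝ} (hε : 0 < ε) : (0 : ℝ) ∈ Ioo (-ε) ε := ⟨by linarith, hε⟩

/-- As functions of `t`, both sides are integral curves of the same left invariant field through the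
same point at `t = 0`. -/
lemma map_add {ε : ℝ} {e : E → ℝ → E} {U : Set E} (he : IsLocalExp n G ε e U) (hε : 0 < ε) {B : E} (hB : B ∈ U) {s t : ℝ}
    (hs : s ∈ Ioo (-ε) ε) (ht : t ∈ Ioo (-ε) ε) (hst : s + t ∈ Ioo (-ε) ε) :
    unitParam n G (e B (s + t)) = unitParam n G (e B s) * unitParam n G (e B t) := by
  set g := unitParam n G (e B s) with hg
  have hJ : IsOpen (Ioo (-ε) ε ∩ Ioo (-ε - s) (ε - s)) := isOpen_Ioo.inter isOpen_Ioo
  have hJ' : (Ioo (-ε) ε ∩ Ioo (-ε - s) (ε - s)).OrdConnected := ordConnected_Ioo.inter ordConnected_Ioo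
  have h : EqOn (fun t => e B (s + t)) (fun t => unitCoord n (g * unitParam n G (e B t)))
      (Ioo (-ε) ε ∩ Ioo (-ε - s) (ε - s)) := by
    refine ODE_solution_unique_of_locallyLipschitzOn (locallyLipschitzOn_leftDeriv_apply (G := G) B)
      hJ hJ' ?_ ?_ (t₀ := 0) ⟨zero_mem hε, ?_, ?_⟩ ?_
    · intro τ hτ
      have hτ' : s + τ ∈ Ioo (-ε) ε := ⟨by linarith [hτ.2.1], by linarith [hτ.2.2]⟩
      exact ⟨(he.hasDerivAt B hB _ hτ').comp_const_add s τ, he.mem B hB _ hτ'⟩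
    · intro τ hτ
      have hm := he.mem B hB τ hτ.1
      have hmm := he.mul_mem B hB s hs τ hτ.1
      refine ⟨?_, unitCoord_mem hmm⟩
      have h1 := (contMDiffAt_const_mul g (unitParam n G (e B τ))).hasFDerivAt_coord
        (unitParam_mem hm) hmm
      rw [unitCoord_unitParam hm] at h1
      refine (h1.comp_hasDerivAt τ (he.hasDerivAt B hB τ hτ.1)).congr_deriv ?_
      rw [unitParam_unitCoord hmm, leftDeriv_mul (unitParam_mem hm) hmm]
      rfl
    · linarith [hs.1]
    · linarith [hs.2]
    · simp only [add_zero, he.apply_zero B hB, unitParam_zero, mul_one]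
      exact (unitCoord_unitParam (he.mem B hB s hs)).symm
  have h' := h (x := t) ⟨ht, by linarith [hst.1], by linarith [hst.2]⟩
  simp only at h'
  rw [h', unitParam_unitCoord (he.mul_mem B hB s hs t ht)]

lemma smul_apply {ε : ℝ} {e : E → ℝ → E} {U : Set E} (he : IsLocalExp n G ε e U) (hε : 0 < ε) {B : E} (hB : B ∈ U) {c : ℝ}
    (hc : |c| ≤ 1) (hcB : c • B ∈ U) {t : ℝ} (ht : t ∈ Ioo (-ε) ε) :
    e (c • B) t = e B (c * t) := by
  have hct : ∀ t ∈ Ioo (-ε) ε, c * t ∈ Ioo (-ε) ε := by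
    intro t ht
    rw [mem_Ioo, ← abs_lt] at ht ⊢
    rw [abs_mul]
    exact lt_of_le_of_lt (mul_le_of_le_one_left (abs_nonneg t) hc) ht
  refine ODE_solution_unique_of_locallyLipschitzOn
    (locallyLipschitzOn_leftDeriv_apply (G := G) (c • B)) isOpen_Ioo ordConnected_Ioo
    (f := e (c • B)) (g := fun t => e B (c * t)) (t₀ := 0)
    (fun τ hτ => ⟨he.hasDerivAt _ hcB τ hτ, he.mem _ hcB τ hτ⟩)
    (fun τ hτ => ⟨?_, he.mem _ hB _ (hct τ hτ)⟩) (zero_mem hε) ?_ ht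
  · have h := (he.hasDerivAt B hB _ (hct τ hτ)).scomp τ ((hasDerivAt_id τ).const_mul c)
    refine h.congr_deriv ?_
    rw [mul_one, _root_.map_smul]
  · simp only [mul_zero, he.apply_zero _ hcB, he.apply_zero _ hB]

lemma contDiffAt {ε : ℝ} {e : E → ℝ → E} {U : Set E} (he : IsLocalExp n G ε e U) {B : E} (hB : B ∈ U) {t : ℝ}
    (ht : t ∈ Ioo (-ε) ε) : ContDiffAt ℝ ∞ (e B) t := by
  obtain ⟨a, ha1, ha2⟩ := exists_between ht.1
  obtain ⟨b, hb1, hb2⟩ := exists_between ht.2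
  have hsub : Icc a b ⊆ Ioo (-ε) ε := fun x hx => ⟨ha1.trans_le hx.1, hx.2.trans_lt hb2⟩
  have h := ODE.contDiffOn_enat_Icc_of_hasDerivWithinAt (n := ⊤) (tmin := a) (tmax := b)
    (f := fun _ u => leftDeriv n (unitParam n G u) B) (u := unitTarget n G) (α := e B)
    (fun p hp => (ContDiffAt.comp p (contDiffAt_leftDeriv_apply B hp.2)
      contDiffAt_snd).contDiffWithinAt)
    (fun t ht => (he.hasDerivAt B hB t (hsub ht)).hasDerivWithinAt)
    (fun t ht => he.mem B hB t (hsub ht))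
  exact h.contDiffAt (Icc_mem_nhds ha2 hb1)

lemma map_nat_mul {ε : ℝ} {e : E → ℝ → E} {U : Set E} (he : IsLocalExp n G ε e U) (hε : 0 < ε) {B : E} (hB : B ∈ U) {t : ℝ}
    (ht : t ∈ Ioo (-ε) ε) (m : ℕ) (hm : m * t ∈ Ioo (-ε) ε) :
    unitParam n G (e B (m * t)) = unitParam n G (e B t) ^ m := by
  induction m with
  | zero => simp [he.apply_zero B hB]
  | succ m ih =>
    have hm' : m * t ∈ Ioo (-ε) ε := by
      rw [mem_Ioo, ← abs_lt] at hm ⊢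
      refine lt_of_le_of_lt ?_ hm
      rw [abs_mul, abs_mul]
      gcongr
      simp
    have e1 : ((m + 1 : ℕ) : ℝ) * t = m * t + t := by push_cast; ring
    rw [e1] at hm ⊢
    rw [he.map_add hε hB hm' ht hm, ih hm', pow_succ]

end IsLocalExp

/-- By variation of constants, `exp(-sA)(v + sAv)` has derivative zero when `A² = 0`. -/
lemma exp_smul_nilpotent_apply {W : Type*} [NormedAddCommGroup W] [NormedSpace ℝ W]
    [CompleteSpace W] (A : W →L[ℝ] W) (hA : ∀ v, A (A v) = 0) (t : ℝ) (v : W) :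
    NormedSpace.exp (t • A) v = v + t • A v := by
  have h : ∀ s : ℝ, HasDerivAt (fun s : ℝ => NormedSpace.exp (s • (-A)) (v + s • A v)) 0 s := by
    intro s
    refine (hasDerivAt_exp_neg_smul_apply A
      (((hasDerivAt_id s).smul_const (A v)).const_add v)).congr_deriv ?_
    simp [hA]
  have hc := is_const_of_deriv_eq_zero (fun s => (h s).differentiableAt) (fun s => (h s).deriv) t 0
  simp only [zero_smul, NormedSpace.exp_zero, one_apply_eq_self, add_zero] at hc
  conv_lhs => rw [← hc]
  exact exp_smul_apply_exp_neg_smul A t _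

/-- The local exponential map of a Lie group. -/
theorem exists_isLocalExp : ∃ ε > 0, ∃ (e : E → ℝ → E) (L : NNReal),
    (∀ N ∈ 𝓝 (0 : E), ∃ U ∈ 𝓝 (0 : E), IsLocalExp n G ε e U ∧
      (∀ B ∈ U, ∀ t ∈ Ioo (-ε) ε, e B t ∈ N) ∧
      ∀ t ∈ Ioo (-ε) ε, LipschitzOnWith L (fun B => e B t) U) ∧
    ∀ t ∈ Ioo (-ε) ε, HasStrictFDerivAt (fun B => e B t) (t • ContinuousLinearMap.id ℝ E) 0 := by
  -- The parameter `B` becomes a second, constant component of the state. The extended field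
  -- vanishes at `0`, and its linearization `(u, B) ↦ (B, 0)` has square zero, so the derivative in
  -- `B` at time `t` is `t • id`.
  set F : E × E → E × E := fun p => (leftDeriv n (unitParam n G p.1) p.2, 0) with hF
  set A : E × E →L[ℝ] E × E :=
    (ContinuousLinearMap.inl ℝ E E).comp (ContinuousLinearMap.snd ℝ E E) with hA
  have hFs : HasStrictFDerivAt F A 0 := by
    have hc : ContDiffAt ℝ ∞ F 0 := by
      refine ContDiffAt.prodMk ?_ contDiffAt_const
      exact (ContDiffAt.comp (0 : E × E) (contDiffAt_leftDeriv (zero_mem_unitTarget n))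
        contDiffAt_fst).clm_apply contDiffAt_snd
    refine hc.hasStrictFDerivAt' (n := ∞) ?_ (by simp)
    have h1 : HasFDerivAt (fun p : E × E => leftDeriv n (unitParam n G p.1))
        ((mulHessian n G).comp (ContinuousLinearMap.fst ℝ E E)) 0 :=
      HasFDerivAt.comp (0 : E × E) (g := fun u => leftDeriv n (unitParam n G u))
        hasFDerivAt_leftDeriv hasFDerivAt_fst
    refine (HasFDerivAt.prodMk (h1.clm_apply hasFDerivAt_snd) (hasFDerivAt_const 0 _)).congr_fderiv
      (ContinuousLinearMap.ext fun p => ?_)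
    simp [hA, leftDeriv_one]
  obtain ⟨ε, hε, α, L, hα, ⟨U₀, hU₀, hL⟩, hs⟩ := exists_local_flow hFs (by simp [hF])
  have hi : Filter.Tendsto (fun B : E => ((0 : E), B)) (𝓝 0) (𝓝 0) :=
    (Continuous.prodMk_right (0 : E)).tendsto 0
  refine ⟨ε, hε, fun B t => (α (0, B) t).1, L, ?_, ?_⟩
  · intro N hN
    have := topologicalGroup_of_lieGroup (𝓡 n) ∞ (G := G)
    have hmul : ∀ᶠ p : E × E in 𝓝 0 ×ˢ 𝓝 0, unitParam n G p.1 * unitParam n G p.2 ∈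
        unitSource n G := by
      have h := (tendsto_unitParam (n := n) (G := G)).comp
        (Filter.tendsto_fst (f := 𝓝 (0 : E)) (g := 𝓝 (0 : E))) |>.mul
        ((tendsto_unitParam (n := n) (G := G)).comp
        (Filter.tendsto_snd (f := 𝓝 (0 : E)) (g := 𝓝 (0 : E))))
      rw [mul_one] at h
      exact h.eventually (unitSource_mem_nhds n)
    obtain ⟨N', hN', hN'mul⟩ := Filter.eventually_prod_self_iff'.1 hmul
    have hN'' : (N ∩ N' ∩ unitTarget n G) ×ˢ (univ : Set E) ∈ 𝓝 (0 : E × E) :=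
      prod_mem_nhds (Filter.inter_mem (Filter.inter_mem hN hN') (unitTarget_mem_nhds n)) Filter.univ_mem
    have hev := hi.eventually ((hα _ hN'').and hU₀)
    refine ⟨_, hev, ⟨?_, ?_, ?_, ?_⟩, ?_, ?_⟩
    · intro B hB
      simp only [hB.1.1]
    · intro B hB t ht
      have hsnd : ∀ t ∈ Ioo (-ε) ε, HasDerivAt (fun t => (α (0, B) t).2) 0 t := fun t ht =>
        (hB.1.2 t ht).1.snd
      have hconst : (α (0, B) t).2 = (α (0, B) 0).2 :=
        isOpen_Ioo.is_const_of_deriv_eq_zero isPreconnected_Ioo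
          (fun t ht => (hsnd t ht).differentiableAt.differentiableWithinAt)
          (fun t ht => (hsnd t ht).deriv) ht (IsLocalExp.zero_mem hε)
      rw [hB.1.1] at hconst
      have h := (hB.1.2 t ht).1.fst
      simp only [hF, hconst] at h
      exact h
    · intro B hB t ht
      exact (hB.1.2 t ht).2.1.2
    · intro B hB s hs t ht
      exact hN'mul _ (hB.1.2 s hs).2.1.1.2 _ (hB.1.2 t ht).2.1.1.2
    · intro B hB t ht
      exact (hB.1.2 t ht).2.1.1.1
    · intro t ht
      refine LipschitzOnWith.of_dist_le_mul fun x hx y hy => ?_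
      refine (le_max_left _ _).trans (((hL t ht).dist_le_mul _ hx.2 _ hy.2).trans_eq ?_)
      simp [Prod.dist_eq]
  · intro t ht
    have h := (hasStrictFDerivAt_fst (𝕜 := ℝ) (p := α ((0 : E), (0 : E)) t)).comp (0 : E)
      ((hs t ht).comp (f := fun B : E => ((0 : E), B)) (0 : E)
        (ContinuousLinearMap.inr ℝ E E).hasStrictFDerivAt)
    refine h.congr_fderiv ?_
    ext1 B
    have hexp := exp_smul_nilpotent_apply A (fun v => by simp [hA]) t ((0 : E), B)
    simp only [ContinuousLinearMap.comp_apply, ContinuousLinearMap.inr_apply]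
    rw [hexp]
    simp [hA]

end LocalExp

/-! ### Closed connected subgroups are generated by their smooth curves -/

section ClosedSubgroups

variable {n : ℕ} {G : Type*} [TopologicalSpace G] [ChartedSpace (EuclideanSpace ℝ (Fin n)) G]
  [Group G] [LieGroup (𝓡 n) ∞ G]

local notation "E" => EuclideanSpace ℝ (Fin n)

lemma hasStrictFDerivAt_unitCoord_mul :
    HasStrictFDerivAt (fun q : E × E => unitCoord n (unitParam n G q.1 * unitParam n G q.2))
      (ContinuousLinearMap.fst ℝ E E + ContinuousLinearMap.snd ℝ E E) (0, 0) := by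
  set M : E × E → E := fun q => unitCoord n (unitParam n G q.1 * unitParam n G q.2) with hM
  have hMs : HasStrictFDerivAt M (fderiv ℝ M (0, 0)) (0, 0) :=
    (contDiffAt_unitCoord_mul (G := G) (p := ((0 : E), (0 : E))) (zero_mem_unitTarget n)
      (zero_mem_unitTarget n) (by simpa using one_mem_unitSource n)).hasStrictFDerivAt (by simp)
  have h1 : (fderiv ℝ M (0, 0)).comp (ContinuousLinearMap.inl ℝ E E) = ContinuousLinearMap.id ℝ E := by
    refine (HasFDerivAt.comp (f := fun e : E => (e, (0 : E))) (0 : E) hMs.hasFDerivAt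
      (hasFDerivAt_prodMk_left (0 : E) (0 : E))).unique
      ((hasFDerivAt_id (0 : E)).congr_of_eventuallyEq ?_)
    filter_upwards [unitTarget_mem_nhds (G := G) n] with u hu
    simp [hM, unitCoord_unitParam hu]
  have h2 : (fderiv ℝ M (0, 0)).comp (ContinuousLinearMap.inr ℝ E E) = ContinuousLinearMap.id ℝ E := by
    refine (HasFDerivAt.comp (f := fun e : E => ((0 : E), e)) (0 : E) hMs.hasFDerivAt
      (hasFDerivAt_prodMk_right (0 : E) (0 : E))).unique
      ((hasFDerivAt_id (0 : E)).congr_of_eventuallyEq ?_)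
    filter_upwards [unitTarget_mem_nhds (G := G) n] with u hu
    simp [hM, unitCoord_unitParam hu]
  refine hMs.congr_fderiv (ContinuousLinearMap.ext fun p => ?_)
  have e : p = ContinuousLinearMap.inl ℝ E E p.1 + ContinuousLinearMap.inr ℝ E E p.2 := by simp
  have h1' := congrArg (fun L : E →L[ℝ] E => L p.1) h1
  have h2' := congrArg (fun L : E →L[ℝ] E => L p.2) h2
  conv_lhs => rw [e]
  rw [map_add]
  exact congrArg₂ (· + ·) h1' h2'

/-- The linear map `L` is the derivative at `0` of a smooth map to `G` with values in `K`. -/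
def IsDerivOfMapTo (K : Subgroup G) (L : E →L[ℝ] E) : Prop :=
  ∃ Ψ : E → G, ContMDiff 𝓘(ℝ, E) (𝓡 n) ∞ Ψ ∧ (∀ x, Ψ x ∈ K) ∧ Ψ 0 = 1 ∧
    HasFDerivAt (fun x => unitCoord n (Ψ x)) L 0

namespace IsDerivOfMapTo

lemma zero (K : Subgroup G) : IsDerivOfMapTo (n := n) K 0 :=
  ⟨fun _ => 1, contMDiff_const, fun _ => K.one_mem, rfl, hasFDerivAt_const _ _⟩

lemma add {K : Subgroup G} {L₁ L₂ : E →L[ℝ] E} (h₁ : IsDerivOfMapTo K L₁)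
    (h₂ : IsDerivOfMapTo K L₂) : IsDerivOfMapTo K (L₁ + L₂) := by
  obtain ⟨Ψ₁, hΨ₁, hK₁, h0₁, hd₁⟩ := h₁
  obtain ⟨Ψ₂, hΨ₂, hK₂, h0₂, hd₂⟩ := h₂
  refine ⟨fun x => Ψ₁ x * Ψ₂ x, hΨ₁.mul hΨ₂, fun x => K.mul_mem (hK₁ x) (hK₂ x), by simp [h0₁, h0₂],
    ?_⟩
  have hM := (hasStrictFDerivAt_unitCoord_mul (n := n) (G := G)).hasFDerivAt
  have e1 : ((0 : E), (0 : E)) = (unitCoord n (Ψ₁ 0), unitCoord n (Ψ₂ 0)) := by simp [h0₁, h0₂]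
  rw [e1] at hM
  have h := HasFDerivAt.comp (0 : E) hM (hd₁.prodMk hd₂)
  refine (h.congr_fderiv (ContinuousLinearMap.ext fun x => by simp)).congr_of_eventuallyEq ?_
  have hev : ∀ Ψ : E → G, ContMDiff 𝓘(ℝ, E) (𝓡 n) ∞ Ψ → Ψ 0 = 1 →
      ∀ᶠ x in 𝓝 0, Ψ x ∈ unitSource n G := fun Ψ hΨ h0 =>
    hΨ.continuous.continuousAt.preimage_mem_nhds (by rw [h0]; exact unitSource_mem_nhds n)
  filter_upwards [hev Ψ₁ hΨ₁ h0₁, hev Ψ₂ hΨ₂ h0₂] with x hx₁ hx₂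
  simp only [Function.comp_apply, unitParam_unitCoord hx₁, unitParam_unitCoord hx₂]

lemma smulRight {K : Subgroup G} (ℓ : E →L[ℝ] ℝ) {X : E} (hX : X ∈ subgroupLieAlgebra n K) :
    IsDerivOfMapTo K (ℓ.smulRight X) := by
  obtain ⟨σ, hσ, hσK, hσ0, rfl⟩ := hX
  refine ⟨fun x => σ (ℓ x), hσ.comp ℓ.contDiff.contMDiff, fun x => hσK _, by simp [hσ0], ?_⟩
  have h1 : HasFDerivAt (fun t => unitCoord n (σ t)) _ (ℓ 0) :=
    (map_zero ℓ).symm ▸ (HasDerivAt.of_initialVelocity σ hσ hσ0).hasFDerivAt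
  have h := HasFDerivAt.comp (0 : E) h1 ℓ.hasFDerivAt
  exact h.congr_fderiv (ContinuousLinearMap.ext fun x => by simp)

/-- `L` is a sum of rank one maps. Each is realized by a curve in `K` composed with a linear
functional, and pointwise products in `K` realize sums. -/
lemma of_forall_mem {K : Subgroup G} (L : E →L[ℝ] E) (hL : ∀ x, L x ∈ subgroupLieAlgebra n K) :
    IsDerivOfMapTo K L := by
  have hsum : L = ∑ i, (EuclideanSpace.proj (𝕜 := ℝ) i).smulRight
      (L (EuclideanSpace.single i (1 : ℝ))) := by
    refine ContinuousLinearMap.ext fun x => ?_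
    have hx := (EuclideanSpace.basisFun (Fin n) ℝ).sum_repr x
    conv_lhs => rw [← hx]
    simp
  rw [hsum]
  exact Finset.sum_induction _ (IsDerivOfMapTo K) (fun _ _ => add) (zero K)
    fun i _ => smulRight _ (hL _)

end IsDerivOfMapTo

/-- A limit direction of elements of a closed subgroup `K` of the form `exp B` with `B → 0` is
tangent to `K`. -/
lemma IsLocalExp.mem_subgroupLieAlgebra_of_tendsto {ε : ℝ} (hε : 0 < ε) {e : E → ℝ → E} {U : Set E}
    (he : IsLocalExp n G ε e U) {L : NNReal}
    (hL : ∀ t ∈ Ioo (-ε) ε, LipschitzOnWith L (fun B => e B t) U)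
    {K : Subgroup G} (hK : IsClosed (K : Set G)) {v : ℕ → E} {b : ℕ → ℝ} {v₀ : E}
    (hvU : ∀ k, v k ∈ U) (hv₀ : v₀ ∈ U) (hv : Filter.Tendsto v Filter.atTop (𝓝 v₀))
    (hb : ∀ k, 0 < b k) (hb0 : Filter.Tendsto b Filter.atTop (𝓝 0))
    (hmem : ∀ k, b k < ε → unitParam n G (e (v k) (b k)) ∈ K) :
    v₀ ∈ subgroupLieAlgebra n K := by
  have hpos : ∀ t, 0 ≤ t → t < ε → unitParam n G (e v₀ t) ∈ K := by
    intro t ht htε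
    have htI : t ∈ Ioo (-ε) ε := ⟨by linarith, htε⟩
    -- At integral multiples of `b k` the curve of `v k` is a power of an element of `K`. These
    -- multiples tend to `t`, and `K` is closed.
    set s : ℕ → ℝ := fun k => ⌊t / b k⌋₊ * b k with hs
    have hs1 : ∀ k, s k ≤ t := fun k => by
      have := Nat.floor_le (div_nonneg ht (hb k).le)
      rwa [le_div_iff₀ (hb k)] at this
    have hs0 : ∀ k, 0 ≤ s k := fun k => mul_nonneg (Nat.cast_nonneg _) (hb k).le
    have hs2 : ∀ k, t - b k ≤ s k := fun k => by
      have := (Nat.lt_floor_add_one (t / b k)).le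
      rw [div_le_iff₀ (hb k)] at this
      have e1 : ((⌊t / b k⌋₊ : ℝ) + 1) * b k = s k + b k := by rw [hs]; ring
      linarith
    have hsI : ∀ k, s k ∈ Ioo (-ε) ε := fun k =>
      ⟨by linarith [hs0 k], (hs1 k).trans_lt htε⟩
    have hst : Filter.Tendsto s Filter.atTop (𝓝 t) := by
      refine tendsto_of_tendsto_of_tendsto_of_le_of_le ?_ tendsto_const_nhds hs2 hs1
      simpa using tendsto_const_nhds.sub hb0
    have hlim : Filter.Tendsto (fun k => e (v k) (s k)) Filter.atTop (𝓝 (e v₀ t)) := by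
      have h1 : Filter.Tendsto (fun k => e v₀ (s k)) Filter.atTop (𝓝 (e v₀ t)) :=
        (he.hasDerivAt v₀ hv₀ t htI).continuousAt.tendsto.comp hst
      refine tendsto_of_tendsto_of_dist h1 ?_
      have h2 : Filter.Tendsto (fun k => L * dist v₀ (v k)) Filter.atTop (𝓝 0) := by
        simpa using (tendsto_const_nhds (x := v₀)).dist hv |>.const_mul (L : ℝ)
      refine squeeze_zero (fun _ => dist_nonneg) (fun k => ?_) h2
      exact (hL _ (hsI k)).dist_le_mul _ hv₀ _ (hvU k)
    have hlimG := (continuousAt_unitParam (he.mem v₀ hv₀ t htI)).tendsto.comp hlim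
    refine hK.mem_of_tendsto hlimG ?_
    filter_upwards [hb0.eventually_lt_const hε] with k hk
    have hbI : b k ∈ Ioo (-ε) ε := ⟨by linarith [hb k], hk⟩
    have h := he.map_nat_mul hε (hvU k) hbI _ (hsI k)
    simp only [Function.comp_apply, SetLike.mem_coe]
    rw [h]
    exact K.pow_mem (hmem k hk) _
  have hall : ∀ t ∈ Ioo (-ε) ε, unitParam n G (e v₀ t) ∈ K := by
    intro t ht
    rcases le_total 0 t with h0 | h0
    · exact hpos t h0 ht.2
    · have h := he.map_add hε hv₀ ht (t := -t) ⟨by linarith, by linarith [ht.1]⟩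
        (by simpa using hε)
      rw [add_neg_cancel, he.apply_zero v₀ hv₀, unitParam_zero] at h
      rw [← inv_inv (unitParam n G (e v₀ t)), ← eq_inv_of_mul_eq_one_right h.symm]
      exact K.inv_mem (hpos _ (by linarith) (by linarith [ht.1]))
  -- The sine reparametrizes the local curve to one defined on all of `ℝ`, with initial velocity `(ε
  -- / 2) • v₀`.
  have hsin : ∀ s : ℝ, ε / 2 * Real.sin s ∈ Ioo (-ε) ε := fun s => by
    constructor <;> nlinarith [Real.neg_one_le_sin s, Real.sin_le_one s]
  set σ : ℝ → G := fun s => unitParam n G (e v₀ (ε / 2 * Real.sin s)) with hσ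
  have hσs : ContMDiff 𝓘(ℝ, ℝ) (𝓡 n) ∞ σ := by
    intro s
    have h1 : ContDiffAt ℝ ∞ (fun s => e v₀ (ε / 2 * Real.sin s)) s :=
      ContDiffAt.comp s (he.contDiffAt hv₀ (hsin s)) (contDiffAt_const.mul Real.contDiff_sin.contDiffAt)
    exact ContMDiffAt.comp (g := unitParam n G) s (contMDiffAt_unitParam (he.mem v₀ hv₀ _ (hsin s))) h1.contMDiffAt
  have hσ0 : σ 0 = 1 := by simp [hσ, he.apply_zero v₀ hv₀]
  have hvel : initialVelocity n σ ∈ subgroupLieAlgebra n K :=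
    ⟨σ, hσs, fun s => hall _ (hsin s), hσ0, rfl⟩
  have hd : initialVelocity n σ = (ε / 2) • v₀ := by
    refine (HasDerivAt.of_initialVelocity σ hσs hσ0).unique ?_
    have h1 := (he.hasDerivAt v₀ hv₀ (ε / 2 * Real.sin 0) (hsin 0)).scomp 0
      ((Real.hasDerivAt_sin 0).const_mul (ε / 2))
    simp only [Real.sin_zero, mul_zero, he.apply_zero v₀ hv₀, unitParam_zero, leftDeriv_one,
      Real.cos_zero, mul_one] at h1
    refine (h1.congr_deriv rfl).congr_of_eventuallyEq (Filter.Eventually.of_forall fun s => ?_)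
    exact unitCoord_unitParam (he.mem v₀ hv₀ _ (hsin s))
  rw [hd] at hvel
  have h := (subgroupLieAlgebra n K).smul_mem (ε / 2)⁻¹ hvel
  have e1 : (ε / 2)⁻¹ • ((ε / 2) • v₀) = v₀ := inv_smul_smul₀ (by positivity) v₀
  exact e1 ▸ h

/-- A closed connected subgroup of a Lie group is generated by the smooth curves that start at
the identity and stay in the subgroup. -/
theorem Subgroup.le_of_forall_curve_mem {K S : Subgroup G} (hK : IsClosed (K : Set G))
    (hKconn : IsConnected (K : Set G))
    (hS : ∀ σ : ℝ → G, ContMDiff 𝓘(ℝ, ℝ) (𝓡 n) ∞ σ → (∀ t, σ t ∈ K) → σ 0 = 1 → ∀ t, σ t ∈ S) :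
    K ≤ S := by
  have := topologicalGroup_of_lieGroup (𝓡 n) ∞ (G := G)
  have hev : ∀ᶠ h in 𝓝 (1 : G), h ∈ K → h ∈ S := by
    by_contra hcon
    have hfreq : ∃ᶠ h in 𝓝 (1 : G), h ∈ K ∧ h ∉ S := fun h => hcon (h.mono fun x hx hxK => by
      by_contra hxS
      exact hx ⟨hxK, hxS⟩)
    let k : Submodule ℝ E := subgroupLieAlgebra n K
    obtain ⟨c, hc⟩ := k.exists_isCompl
    let p : E →L[ℝ] E := LinearMap.toContinuousLinearMap (k.subtype ∘ₗ k.projectionOnto c hc)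
    have hpk : ∀ x, p x ∈ k := fun x => (k.projectionOnto c hc x).2
    have hpc : ∀ x, x - p x ∈ c := fun x => by
      have h := Submodule.projectionOnto_apply_eq_zero_iff hc (x := x - p x)
      refine h.1 ?_
      rw [map_sub, sub_eq_zero]
      exact (Submodule.projectionOnto_apply_left hc (k.projectionOnto c hc x)).symm
    obtain ⟨Ψ, hΨ, hΨK, hΨ0, hΨd⟩ := IsDerivOfMapTo.of_forall_mem (n := n) (K := K) p hpk
    have hΨS : ∀ x, Ψ x ∈ S := fun x => by
      have h := hS (fun s => Ψ (s • x)) (hΨ.comp (contDiff_id.smul contDiff_const).contMDiff)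
        (fun s => hΨK _) (by simp [hΨ0]) 1
      simpa using h
    obtain ⟨ε, hε, e, L, heN, hes⟩ := exists_isLocalExp (n := n) (G := G)
    obtain ⟨U, hU, heU, -, hL⟩ := heN univ Filter.univ_mem
    have hδ : ε / 2 ∈ Ioo (-ε) ε := ⟨by linarith, by linarith⟩
    -- The exponential is evaluated at time `ε / 2`, where its derivative is `(ε / 2) • id`; the
    -- factor compensates for this.
    set B : E → E := fun x => (ε / 2)⁻¹ • (x - p x) with hB
    have hB0 : B 0 = 0 := by simp [hB]
    have he0 : e 0 (ε / 2) = 0 := by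
      have h := heU.smul_apply hε (mem_of_mem_nhds hU) (c := 0) (by simp)
        (by simpa using mem_of_mem_nhds hU) hδ
      simpa [heU.apply_zero _ (mem_of_mem_nhds hU)] using h
    have hBd : HasStrictFDerivAt B ((ε / 2)⁻¹ • (ContinuousLinearMap.id ℝ E - p)) 0 :=
      ((ContinuousLinearMap.id ℝ E - p).hasStrictFDerivAt).const_smul ((ε / 2)⁻¹)
    have hΨs : HasStrictFDerivAt (fun x => unitCoord n (Ψ x)) p 0 :=
      ((hΨ 0).contDiffAt_unitCoord (by rw [hΨ0]; exact one_mem_unitSource n)).hasStrictFDerivAt'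
        hΨd (by simp)
    -- The derivative at `0` is `p + (id - p) = id`, so every element near `1` is an element of `K ∩
    -- S` times the exponential of a small vector of the complement `c`.
    set Θ : E → E := fun x => unitCoord n (unitParam n G (unitCoord n (Ψ x)) *
      unitParam n G (e (B x) (ε / 2))) with hΘ
    have hΘd : HasStrictFDerivAt Θ (ContinuousLinearMap.id ℝ E) 0 := by
      have h1 : HasStrictFDerivAt (fun x => e (B x) (ε / 2)) _ 0 :=
        (hB0 ▸ hes (ε / 2) hδ : HasStrictFDerivAt (fun B => e B (ε / 2)) _ (B 0)).comp 0 hBd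
      have hM := hasStrictFDerivAt_unitCoord_mul (n := n) (G := G)
      have e1 : ((0 : E), (0 : E)) = (unitCoord n (Ψ 0), e (B 0) (ε / 2)) := by
        rw [hB0, he0, hΨ0, unitCoord_one]
      rw [e1] at hM
      refine (HasStrictFDerivAt.comp (0 : E) hM (hΨs.prodMk h1)).congr_fderiv
        (ContinuousLinearMap.ext fun x => ?_)
      have e2 : (ε / 2) • (ε / 2)⁻¹ • (x - p x) = x - p x := smul_inv_smul₀ (by positivity) _
      have e3 : p x + (x - p x) = x := add_sub_cancel _ _
      exact (congrArg (p x + ·) e2).trans e3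
    have hΘ0 : Θ 0 = 0 := by simp [hΘ, hB0, he0, hΨ0]
    have hmap : Filter.map Θ (𝓝 0) = 𝓝 0 := by
      have h := hΘd.map_nhds_eq_of_surj (LinearMap.range_eq_top.2 fun x => ⟨x, rfl⟩)
      rwa [hΘ0] at h
    have hfreq0 : ∃ᶠ u in 𝓝 (0 : E), unitParam n G u ∈ K ∧ unitParam n G u ∉ S := by
      have h := (hfreq.and_eventually (unitSource_mem_nhds (G := G) n))
      refine (tendsto_unitCoord (n := n) (G := G)).frequently (h.mono fun x hx => ?_)
      rw [unitParam_unitCoord hx.2]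
      exact hx.1
    rw [← hmap, Filter.frequently_map] at hfreq0
    have hBc : Filter.Tendsto B (𝓝 0) (𝓝 0) := by
      have h := hBd.continuousAt.tendsto
      rwa [hB0] at h
    have hgood : ∀ᶠ x in 𝓝 (0 : E), B x ∈ U ∧ Ψ x ∈ unitSource n G ∧
        Ψ x * unitParam n G (e (B x) (ε / 2)) ∈ unitSource n G := by
      have h1 : ContinuousAt Ψ 0 := hΨ.continuous.continuousAt
      have h2 : ContinuousAt (fun x => unitParam n G (e (B x) (ε / 2))) 0 := by
        refine ContinuousAt.comp_of_eq (g := unitParam n G)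
          (continuousAt_unitParam (zero_mem_unitTarget n)) ?_ (by rw [hB0, he0])
        exact ContinuousAt.comp_of_eq (g := fun B => e B (ε / 2)) (hes _ hδ).continuousAt
          hBd.continuousAt hB0
      refine (hBc.eventually hU).and (Filter.Eventually.and (h1.preimage_mem_nhds ?_)
        ((h1.mul h2).preimage_mem_nhds ?_))
      · rw [hΨ0]; exact unitSource_mem_nhds n
      · rw [Pi.mul_apply, hΨ0, hB0, he0, unitParam_zero, mul_one]; exact unitSource_mem_nhds n
    -- Removing the factor in `K ∩ S` from elements of `K` outside `S` leaves exponentials in `K`;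
    -- their exponents are nonzero, as otherwise the element would be in `S`.
    have hfreqB : ∃ᶠ X in 𝓝 (0 : E), X ∈ c ∧ X ≠ 0 ∧ unitParam n G (e X (ε / 2)) ∈ K := by
      refine hBc.frequently ((hfreq0.and_eventually hgood).mono ?_)
      rintro x ⟨⟨hxK, hxS⟩, hxU, hxΨ, hxm⟩
      simp only [hΘ, unitParam_unitCoord hxΨ, unitParam_unitCoord hxm] at hxK hxS
      refine ⟨c.smul_mem _ (hpc x), fun h0 => hxS ?_, (K.mul_mem_cancel_left (hΨK x)).1 hxK⟩
      rw [h0, he0, unitParam_zero, mul_one]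
      exact hΨS x
    obtain ⟨ρ, hρ, hρU⟩ := Metric.nhds_basis_closedBall.mem_iff.1 hU
    obtain ⟨X, hX0, hX⟩ := Filter.exists_seq_forall_of_frequently
      (hfreqB.and_eventually (Metric.closedBall_mem_nhds (0 : E) hρ))
    have hXpos : ∀ m, 0 < ‖X m‖ := fun m => norm_pos_iff.2 (hX m).1.2.1
    -- A limit direction of these exponents lies in `c`, and it is also tangent to `K`. Being of
    -- norm `ρ > 0`, it contradicts `c ∩ k = 0`.
    obtain ⟨v₀, hv₀, φ, hφ, hlim⟩ := (isCompact_sphere (0 : E) ρ).tendsto_subseq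
      (x := fun m => (ρ / ‖X m‖) • X m) fun m => by
        rw [mem_sphere_zero_iff_norm, norm_smul, norm_div, norm_norm, Real.norm_eq_abs,
          abs_of_pos hρ, div_mul_cancel₀ _ (hXpos m).ne']
    have hv₀c : v₀ ∈ c := by
      have hcl : IsClosed (c : Set E) := c.closed_of_finiteDimensional
      exact hcl.mem_of_tendsto hlim
        (Filter.Eventually.of_forall fun m => c.smul_mem _ (hX (φ m)).1.1)
    have hsphere : ∀ m, (ρ / ‖X m‖) • X m ∈ U := fun m => hρU (by
      rw [mem_closedBall_zero_iff, norm_smul, norm_div, norm_norm, Real.norm_eq_abs,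
          abs_of_pos hρ, div_mul_cancel₀ _ (hXpos m).ne'])
    have hv₀k : v₀ ∈ k := by
      refine heU.mem_subgroupLieAlgebra_of_tendsto hε hL hK
        (v := fun m => (ρ / ‖X (φ m)‖) • X (φ m)) (b := fun m => ‖X (φ m)‖ / ρ * (ε / 2))
        (fun m => hsphere _) (hρU (Metric.sphere_subset_closedBall hv₀)) hlim
        (fun m => mul_pos (div_pos (hXpos _) hρ) (by linarith)) ?_ fun m _ => ?_
      · have h1 := (hX0.comp hφ.tendsto_atTop).norm
        have h2 := (h1.div_const ρ).mul_const (ε / 2)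
        simpa using h2
      · have hle : |‖X (φ m)‖ / ρ| ≤ 1 := by
          rw [abs_of_pos (div_pos (hXpos _) hρ), div_le_one hρ]
          exact mem_closedBall_zero_iff.1 (hX (φ m)).2
        have hsm : (‖X (φ m)‖ / ρ) • ((ρ / ‖X (φ m)‖) • X (φ m)) = X (φ m) := by
          rw [smul_smul, div_mul_div_cancel₀ hρ.ne', div_self (hXpos _).ne', one_smul]
        have h := heU.smul_apply hε (hsphere (φ m)) hle (by rw [hsm]; exact hρU (hX (φ m)).2) hδ
        rw [hsm] at h
        rw [← h]
        exact (hX (φ m)).1.2.2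
    have hzero : v₀ = 0 := Submodule.disjoint_def.1 hc.disjoint v₀ hv₀k hv₀c
    rw [hzero, mem_sphere_zero_iff_norm, norm_zero] at hv₀
    exact hρ.ne hv₀
  have hpre : PreconnectedSpace K := isPreconnected_iff_preconnectedSpace.1 hKconn.isPreconnected
  have hnhds : ((S.subgroupOf K : Subgroup K) : Set K) ∈ 𝓝 (1 : K) := by
    have h : ∀ᶠ x : K in 𝓝 1, (x : G) ∈ K → (x : G) ∈ S :=
      (continuous_subtype_val.tendsto (1 : K)).eventually hev
    filter_upwards [h] with x hx using hx x.2
  intro x hx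
  exact Subgroup.mem_subgroupOf.1 ((S.subgroupOf K).mem_of_mem_nhds_one hnhds ⟨x, hx⟩)

end ClosedSubgroups

/-! ### Making the cocycle vanish on the compact subgroup -/

section Averaging

variable {n : ℕ} {G : Type*} [TopologicalSpace G] [ChartedSpace (EuclideanSpace ℝ (Fin n)) G]
  [Group G] [LieGroup (𝓡 n) ∞ G]

local notation "E" => EuclideanSpace ℝ (Fin n)

/-- `w` is a cocycle of the adjoint representation whose derivative at the identity is `D`. -/
structure IsCocycleOf (D : E →L[ℝ] E) (w : G → E) : Prop where
  map_mul : ∀ x y, w (x * y) = w x + adjointRep n x (w y)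
  hasFDerivAt_zero : HasFDerivAt (fun u => w (unitParam n G u)) D 0

namespace IsCocycleOf

lemma map_one {D : E →L[ℝ] E} {w : G → E} (hw : IsCocycleOf D w) : w 1 = 0 := by
  have h := hw.map_mul 1 1
  rw [mul_one, adjointRep_one] at h
  exact left_eq_add.1 h

/-- Describes `w` near `g` by `w` near `1`, which carries continuity and derivatives from the
identity to other points. -/
lemma eq_add_adjointRep {D : E →L[ℝ] E} {w : G → E} (hw : IsCocycleOf D w) (g x : G) :
    w x = w g + adjointRep n g (w (g⁻¹ * x)) := by
  rw [← hw.map_mul, mul_inv_cancel_left]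

lemma continuous {D : E →L[ℝ] E} {w : G → E} (hw : IsCocycleOf D w) : Continuous w := by
  have h1 : ContinuousAt w 1 := by
    have h := hw.hasFDerivAt_zero.continuousAt
    have h2 : ContinuousAt (fun x : G => w (unitParam n G (unitCoord n x))) 1 :=
      ContinuousAt.comp_of_eq (g := fun u => w (unitParam n G u)) h
        (continuousAt_unitCoord (one_mem_unitSource n)) (unitCoord_one n)
    refine h2.congr ?_
    filter_upwards [unitSource_mem_nhds (G := G) n] with x hx
    rw [unitParam_unitCoord hx]
  refine continuous_iff_continuousAt.2 fun g => ?_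
  have h2 : ContinuousAt (fun x => w g + adjointRep n g (w (g⁻¹ * x))) g := by
    refine ContinuousAt.add continuousAt_const ((adjointRep n g).continuous.continuousAt.comp ?_)
    exact ContinuousAt.comp_of_eq (g := w) h1 (contMDiffAt_const_mul (n := n) g⁻¹ g).continuousAt
      (inv_mul_cancel g)
  exact h2.congr (Filter.Eventually.of_forall fun x => (hw.eq_add_adjointRep g x).symm)

lemma hasFDerivAt {D : E →L[ℝ] E} {w : G → E} (hw : IsCocycleOf D w) {u : E}
    (hu : u ∈ unitTarget n G) :
    HasFDerivAt (fun u => w (unitParam n G u)) (cocycleForm D (unitParam n G u)) u := by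
  set g := unitParam n G u with hg
  have hgS : g ∈ unitSource n G := unitParam_mem hu
  have hT : HasFDerivAt (fun v => unitCoord n (g⁻¹ * unitParam n G v)) (maurerCartan n g) u := by
    have h := (contMDiffAt_const_mul g⁻¹ g).hasFDerivAt_coord hgS
      (by simpa using one_mem_unitSource n)
    rwa [hg, unitCoord_unitParam hu] at h
  have hTu : unitCoord n (g⁻¹ * unitParam n G u) = 0 := by simp [← hg]
  have hD : HasFDerivAt (fun u => w (unitParam n G u)) D (unitCoord n (g⁻¹ * unitParam n G u)) := by
    rw [hTu]; exact hw.hasFDerivAt_zero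
  have h := ((adjointRep n g).hasFDerivAt.comp u (HasFDerivAt.comp u hD hT)).const_add (w g)
  refine h.congr_of_eventuallyEq ?_
  have hc : ContinuousAt (fun v => g⁻¹ * unitParam n G v) u :=
    ContinuousAt.comp (g := fun x : G => g⁻¹ * x)
      (contMDiffAt_const_mul (n := n) g⁻¹ (unitParam n G u)).continuousAt (continuousAt_unitParam hu)
  have hev : ∀ᶠ v in 𝓝 u, g⁻¹ * unitParam n G v ∈ unitSource n G := by
    refine hc.preimage_mem_nhds ?_
    rw [← hg, inv_mul_cancel]
    exact unitSource_mem_nhds n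
  filter_upwards [hev] with v hv
  simp only [Function.comp_apply, unitParam_unitCoord hv]
  exact hw.eq_add_adjointRep g _

/-- The cocycle condition is preserved by adding a coboundary. -/
lemma add_coboundary {D : E →L[ℝ] E} {w : G → E} (hw : IsCocycleOf D w) (Z : E) :
    IsCocycleOf (D + (mulHessian n G - (mulHessian n G).flip).flip Z)
      (fun x => w x + (adjointRep n x Z - Z)) where
  map_mul x y := by
    rw [hw.map_mul, adjointRep_mul, map_add, map_sub, ContinuousLinearMap.comp_apply]
    abel
  hasFDerivAt_zero := by
    refine hw.hasFDerivAt_zero.add (HasFDerivAt.sub_const Z ?_)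
    exact (((ContinuousLinearMap.apply ℝ E Z).hasFDerivAt.comp (0 : E)
      (hasFDerivAt_adjointRep (n := n) (G := G))).congr_fderiv
        (ContinuousLinearMap.ext fun _ => rfl))

end IsCocycleOf

lemma diffAtOne_conj (g : G) : diffAtOne n (fun y => g * y * g⁻¹) = adjointRep n g := by
  rw [diffAtOne_eq_fderiv _ ((contMDiffAt_conj g 1).mdifferentiableAt (by simp)) (by simp),
    adjointRep, coordDeriv, unitCoord_one]

lemma adjointRep_mem_subgroupLieAlgebra {K : Subgroup G} {g : G} (hg : g ∈ K) {X : E}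
    (hX : X ∈ subgroupLieAlgebra n K) : adjointRep n g X ∈ subgroupLieAlgebra n K := by
  have h := (EquivariantAut.conj (n := n) (⟨g, hg⟩ : K)).differential_mem hX
  rw [← diffAtOne_conj]
  exact h

/-- Every subspace of a finite dimensional space is the kernel of an endomorphism. -/
lemma Submodule.exists_endomorphism_apply_eq_zero_iff {W : Type*} [NormedAddCommGroup W]
    [NormedSpace ℝ W] [FiniteDimensional ℝ W] (k : Submodule ℝ W) :
    ∃ π : W →L[ℝ] W, ∀ x, π x = 0 ↔ x ∈ k := by
  obtain ⟨c, hc⟩ := k.exists_isCompl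
  refine ⟨LinearMap.toContinuousLinearMap (c.subtype ∘ₗ c.projectionOnto k hc.symm), fun x => ?_⟩
  rw [← Submodule.projectionOnto_apply_eq_zero_iff hc.symm]
  exact Submodule.coe_eq_zero

/-- A cocycle whose derivative preserves the Lie algebra of `K` takes `K` to its Lie algebra. -/
theorem IsCocycleOf.mem_subgroupLieAlgebra {D : E →L[ℝ] E} {w : G → E} (hw : IsCocycleOf D w)
    {K : Subgroup G} (hK : IsClosed (K : Set G)) (hKconn : IsConnected (K : Set G))
    (hD : ∀ X : E, X ∈ subgroupLieAlgebra n K → D X ∈ subgroupLieAlgebra n K) {x : G} (hx : x ∈ K) :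
    w x ∈ subgroupLieAlgebra n K := by
  let k : Submodule ℝ E := subgroupLieAlgebra n K
  obtain ⟨π, hπ⟩ := k.exists_endomorphism_apply_eq_zero_iff
  have hAd : ∀ g ∈ K, ∀ X ∈ k, adjointRep n g X ∈ k := fun g hg X hX =>
    adjointRep_mem_subgroupLieAlgebra hg hX
  have hwinv : ∀ g, w g⁻¹ = -adjointRep n g⁻¹ (w g) := fun g => by
    have h := hw.map_mul g⁻¹ g
    rw [inv_mul_cancel, hw.map_one] at h
    exact eq_neg_of_add_eq_zero_left h.symm
  let S : Subgroup G :=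
    { carrier := {g | g ∈ K ∧ w g ∈ k}
      one_mem' := ⟨K.one_mem, by rw [hw.map_one]; exact k.zero_mem⟩
      mul_mem' := fun {a b} ha hb => ⟨K.mul_mem ha.1 hb.1, by
        rw [hw.map_mul]
        exact k.add_mem ha.2 (hAd a ha.1 _ hb.2)⟩
      inv_mem' := fun {a} ha => ⟨K.inv_mem ha.1, by
        rw [hwinv]
        exact k.neg_mem (hAd _ (K.inv_mem ha.1) _ ha.2)⟩ }
  refine (Subgroup.le_of_forall_curve_mem (n := n) (S := S) hK hKconn ?_ hx).2
  intro σ hσ hσK hσ0 t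
  refine ⟨hσK t, (hπ _).1 ?_⟩
  have hder : ∀ s, HasDerivAt (fun s => π (w (σ s))) 0 s := by
    intro s
    -- Translated back to `1`, the curve has velocity in `𝔨`. The derivative of `w ∘ σ` at `s` is
    -- `Ad(σ s)` of `D` of this velocity, hence in `𝔨`, and is killed by `π`.
    set τ : ℝ → G := fun h => (σ s)⁻¹ * σ (s + h) with hτ
    have hτs : ContMDiff 𝓘(ℝ, ℝ) (𝓡 n) ∞ τ :=
      contMDiff_const.mul (hσ.comp (contDiff_const.add contDiff_id).contMDiff)
    have hτ0 : τ 0 = 1 := by simp [hτ]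
    have hτK : ∀ h, τ h ∈ K := fun h => K.mul_mem (K.inv_mem (hσK s)) (hσK _)
    have hvel : initialVelocity n τ ∈ k := ⟨τ, hτs, hτK, hτ0, rfl⟩
    have h1 : HasDerivAt (fun h => w (τ h)) (D (initialVelocity n τ)) 0 := by
      have hD0 : HasFDerivAt (fun u => w (unitParam n G u)) D (unitCoord n (τ 0)) := by
        rw [hτ0, unitCoord_one]; exact hw.hasFDerivAt_zero
      refine (hD0.comp_hasDerivAt (0 : ℝ) (HasDerivAt.of_initialVelocity τ hτs hτ0)).congr_of_eventuallyEq ?_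
      have hc : ∀ᶠ h in 𝓝 0, τ h ∈ unitSource n G :=
        hτs.continuous.continuousAt.preimage_mem_nhds (by rw [hτ0]; exact unitSource_mem_nhds n)
      filter_upwards [hc] with h hh
      simp only [Function.comp_apply, unitParam_unitCoord hh]
    have h2 : HasDerivAt (fun h => π (w (σ s) + adjointRep n (σ s) (w (τ h)))) 0 0 := by
      refine (π.hasFDerivAt.comp_hasDerivAt (0 : ℝ)
        (((adjointRep n (σ s)).hasFDerivAt.comp_hasDerivAt (0 : ℝ) h1).const_add _)).congr_deriv ?_
      exact (hπ _).2 (hAd _ (hσK s) _ (hD _ hvel))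
    have h3 : HasDerivAt (fun h => π (w (σ (s + h)))) 0 0 := by
      refine h2.congr_of_eventuallyEq (Filter.Eventually.of_forall fun h => ?_)
      simp only [hτ]
      rw [← hw.eq_add_adjointRep]
    have h4 := HasDerivAt.comp_sub_const (x := s) (a := s) (f := fun h => π (w (σ (s + h)))) (f' := 0)
      (by rw [sub_self]; exact h3)
    simpa using h4
  have hconst := is_const_of_deriv_eq_zero (fun s => (hder s).differentiableAt)
    (fun s => (hder s).deriv) t 0
  rw [hconst, hσ0, hw.map_one, map_zero]

open MeasureTheory in
/-- A cocycle becomes a coboundary on a compact subgroup. -/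
theorem IsCocycleOf.exists_eq_sub {D : E →L[ℝ] E} {w : G → E} (hw : IsCocycleOf D w)
    {K : Subgroup G} (hK : IsCompact (K : Set G)) (k : Submodule ℝ E) (hk : ∀ x ∈ K, w x ∈ k) :
    ∃ Z ∈ k, ∀ x ∈ K, w x = Z - adjointRep n x Z := by
  have := topologicalGroup_of_lieGroup (𝓡 n) ∞ (G := G)
  have : CompactSpace K := isCompact_iff_compactSpace.1 hK
  let _ : MeasurableSpace K := borel K
  have : BorelSpace K := ⟨rfl⟩
  let μ : Measure K := Measure.haarMeasure ⊤
  have hμ : IsProbabilityMeasure μ := ⟨by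
    have h := Measure.haarMeasure_self (K₀ := (⊤ : TopologicalSpace.PositiveCompacts K))
    simpa using h⟩
  have hwK : Continuous fun x : K => w x := hw.continuous.comp continuous_subtype_val
  have hint : Integrable (fun x : K => w x) μ :=
    hwK.integrable_of_hasCompactSupport (HasCompactSupport.of_compactSpace _)
  -- Integrating `w(gx) = w(g) + Ad(g)w(x)` over `x` gives `Z = w(g) + Ad(g)Z`, by left invariance
  -- of the probability measure `μ`.
  refine ⟨∫ x : K, w x ∂μ, ?_, fun g hg => ?_⟩
  · obtain ⟨π, hπ⟩ := k.exists_endomorphism_apply_eq_zero_iff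
    rw [← hπ, ← π.integral_comp_comm hint]
    simp only [fun x : K => (hπ _).2 (hk x x.2), integral_zero]
  · have h := integral_mul_left_eq_self (μ := μ) (fun x : K => w x) ⟨g, hg⟩
    have h2 : ∀ x : K, w ((⟨g, hg⟩ : K) * x : K) = w g + adjointRep n g (w x) := fun x =>
      hw.map_mul g x
    simp only [h2] at h
    rw [integral_add (integrable_const _) ((adjointRep n g).integrable_comp hint), integral_const,
      (adjointRep n g).integral_comp_comm hint] at h
    simp only [probReal_univ, one_smul] at h
    exact eq_sub_of_add_eq h

/-- A derivation of the Lie algebra preserving the Lie algebra of a compact connected subgroup `K`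
can be changed by an inner derivation of `K` in such a way that it integrates to a cocycle vanishing
on `K`. -/
theorem exists_cocycle_eq_zero_on [T2Space G] [SimplyConnectedSpace G] {D : E →L[ℝ] E}
    (hD : IsDerivationOf (mulHessian n G) D) {K : Subgroup G} (hK : IsCompact (K : Set G))
    (hKconn : IsConnected (K : Set G))
    (hDK : ∀ X : E, X ∈ subgroupLieAlgebra n K → D X ∈ subgroupLieAlgebra n K) :
    ∃ (Z : E) (w : G → E), Z ∈ subgroupLieAlgebra n K ∧
      IsCocycleOf (D + (mulHessian n G - (mulHessian n G).flip).flip Z) w ∧ ∀ x ∈ K, w x = 0 := by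
  obtain ⟨w, hmul, hder⟩ := exists_cocycle (G := G) hD
  have hw : IsCocycleOf D w := ⟨hmul, by
    have h := hder.self_of_nhds
    rwa [unitParam_zero, cocycleForm_one] at h⟩
  obtain ⟨Z, hZ, hZw⟩ := hw.exists_eq_sub hK (subgroupLieAlgebra n K)
    fun x hx => hw.mem_subgroupLieAlgebra hK.isClosed hKconn hDK hx
  refine ⟨Z, _, hZ, hw.add_coboundary Z, fun x hx => ?_⟩
  rw [hZw x hx]
  abel

end Averaging

/-! ### Automorphisms from flows of multiplicative vector fields -/

section Automorphisms

variable {n : ℕ} {G : Type*} [TopologicalSpace G] [ChartedSpace (EuclideanSpace ℝ (Fin n)) G]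
  [Group G] [LieGroup (𝓡 n) ∞ G]

local notation "E" => EuclideanSpace ℝ (Fin n)

lemma MonoidHom.eq_of_eventuallyEq_one {G' H : Type*} [TopologicalSpace G'] [Group G']
    [IsTopologicalGroup G'] [PreconnectedSpace G'] [Group H] {Φ Ψ : G' →* H}
    (h : ∀ᶠ x in 𝓝 1, Φ x = Ψ x) (x : G') : Φ x = Ψ x :=
  (Φ.eqLocus Ψ).mem_of_mem_nhds_one h x

/-- The derivative of a homomorphism of Lie groups near the identity. -/
lemma MonoidHom.hasFDerivAt_coord {Φ : G →* G} (hc : Continuous Φ) {P : E →L[ℝ] E}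
    (hP : HasFDerivAt (fun u => unitCoord n (Φ (unitParam n G u))) P 0) {v : E}
    (hv : v ∈ unitTarget n G) (hΦv : Φ (unitParam n G v) ∈ unitSource n G) :
    HasFDerivAt (fun u => unitCoord n (Φ (unitParam n G u)))
      ((leftDeriv n (Φ (unitParam n G v))).comp (P.comp (maurerCartan n (unitParam n G v)))) v := by
  set g := unitParam n G v with hg
  have hgS : g ∈ unitSource n G := unitParam_mem hv
  have hT : HasFDerivAt (fun v => unitCoord n (g⁻¹ * unitParam n G v)) (maurerCartan n g) v := by
    have h := (contMDiffAt_const_mul g⁻¹ g).hasFDerivAt_coord hgS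
      (by simpa using one_mem_unitSource n)
    rwa [hg, unitCoord_unitParam hv] at h
  have hTv : unitCoord n (g⁻¹ * unitParam n G v) = 0 := by simp [← hg]
  have hP' : HasFDerivAt (fun u => unitCoord n (Φ (unitParam n G u))) P
      (unitCoord n (g⁻¹ * unitParam n G v)) := by rw [hTv]; exact hP
  have hL : HasFDerivAt (fun u => unitCoord n (Φ g * unitParam n G u)) (leftDeriv n (Φ g))
      (unitCoord n (Φ (unitParam n G (unitCoord n (g⁻¹ * unitParam n G v))))) := by
    have h := (contMDiffAt_const_mul (Φ g) 1).hasFDerivAt_coord (one_mem_unitSource n)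
      (by simpa using hΦv)
    rw [unitCoord_one] at h
    rw [hTv, unitParam_zero, map_one, unitCoord_one]
    exact h
  -- The chain rule is applied to `Φ(x) = Φ(g) Φ(g⁻¹x)`.
  refine (HasFDerivAt.comp v hL (HasFDerivAt.comp v hP' hT)).congr_of_eventuallyEq ?_
  have hc1 : ContinuousAt (fun v => g⁻¹ * unitParam n G v) v :=
    ContinuousAt.comp (g := fun x : G => g⁻¹ * x)
      (contMDiffAt_const_mul (n := n) g⁻¹ (unitParam n G v)).continuousAt (continuousAt_unitParam hv)
  have hev1 : ∀ᶠ u in 𝓝 v, g⁻¹ * unitParam n G u ∈ unitSource n G := by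
    refine hc1.preimage_mem_nhds ?_
    rw [← hg, inv_mul_cancel]
    exact unitSource_mem_nhds n
  have hev2 : ∀ᶠ u in 𝓝 v, Φ (g⁻¹ * unitParam n G u) ∈ unitSource n G := by
    refine (ContinuousAt.comp (g := Φ) hc.continuousAt hc1).preimage_mem_nhds ?_
    simp only [Function.comp_apply, ← hg, inv_mul_cancel, map_one]
    exact unitSource_mem_nhds n
  filter_upwards [hev1, hev2] with u hu1 hu2
  simp only [Function.comp_apply, unitParam_unitCoord hu1, unitParam_unitCoord hu2]
  rw [← map_mul, mul_inv_cancel_left]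

/-- A homomorphism of Lie groups which is differentiable at the identity is smooth. -/
theorem MonoidHom.contMDiff_of_hasFDerivAt {Φ : G →* G} (hc : Continuous Φ) {P : E →L[ℝ] E}
    (hP : HasFDerivAt (fun u => unitCoord n (Φ (unitParam n G u))) P 0) :
    ContMDiff (𝓡 n) (𝓡 n) ∞ Φ := by
  set g : E → E := fun u => unitCoord n (Φ (unitParam n G u)) with hg
  set N : Set E := unitTarget n G ∩ (fun u => Φ (unitParam n G u)) ⁻¹' unitSource n G with hN
  have hcont : ContinuousOn (fun u => Φ (unitParam n G u)) (unitTarget n G) := fun u hu =>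
    (ContinuousAt.comp (g := Φ) hc.continuousAt (continuousAt_unitParam hu)).continuousWithinAt
  have hNo : IsOpen N := hcont.isOpen_inter_preimage (isOpen_unitTarget n) (isOpen_unitSource n)
  have h0N : (0 : E) ∈ N := ⟨zero_mem_unitTarget n, by simpa using one_mem_unitSource n⟩
  have hd : ∀ v ∈ N, HasFDerivAt g ((leftDeriv n (unitParam n G (g v))).comp
      (P.comp (maurerCartan n (unitParam n G v)))) v := fun v hv => by
    have h := MonoidHom.hasFDerivAt_coord hc hP hv.1 hv.2
    rwa [← unitParam_unitCoord (n := n) (x := Φ (unitParam n G v)) hv.2] at h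
  -- Bootstrapping: `hd` expresses the derivative of `g` by smooth maps and `g` itself, so each
  -- order of differentiability yields the next.
  have hsmooth : ∀ k : ℕ, ContDiffOn ℝ k g N := by
    intro k
    induction k with
    | zero =>
      rw [Nat.cast_zero, contDiffOn_zero]
      exact fun v hv => (hd v hv).continuousAt.continuousWithinAt
    | succ k ih =>
      rw [Nat.cast_succ, contDiffOn_succ_iff_fderiv_of_isOpen hNo]
      refine ⟨fun v hv => (hd v hv).differentiableAt.differentiableWithinAt, by simp, ?_⟩
      refine ContDiffOn.congr (f := fun v => (leftDeriv n (unitParam n G (g v))).comp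
        (P.comp (maurerCartan n (unitParam n G v)))) (fun v hv => ?_) fun v hv => (hd v hv).fderiv
      have h1 : ContDiffAt ℝ k g v := ih.contDiffAt (hNo.mem_nhds hv)
      have h2 : ContDiffAt ℝ k (fun v => leftDeriv n (unitParam n G (g v))) v :=
        ContDiffAt.comp (g := fun u => leftDeriv n (unitParam n G u)) v
          ((contDiffAt_leftDeriv (unitCoord_mem hv.2)).of_le
          (by exact_mod_cast le_top)) h1
      have h3 : ContDiffAt ℝ k (fun v => maurerCartan n (unitParam n G v)) v :=
        (contDiffAt_maurerCartan hv.1).of_le (by exact_mod_cast le_top)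
      exact (h2.clm_comp (contDiffAt_const.clm_comp h3)).contDiffWithinAt
  have hg0 : ContDiffAt ℝ ∞ g 0 := (contDiffOn_infty.2 hsmooth).contDiffAt (hNo.mem_nhds h0N)
  have h1 : ContMDiffAt (𝓡 n) (𝓡 n) ∞ Φ 1 := by
    have h2 : ContMDiffAt (𝓡 n) (𝓡 n) ∞ (fun x : G => unitParam n G (g (unitCoord n x))) 1 := by
      refine ContMDiffAt.comp_of_eq (g := unitParam n G) (f := fun x : G => g (unitCoord n x))
        (x := (1 : G)) (y := 0) (contMDiffAt_unitParam (zero_mem_unitTarget n)) ?_ (by simp [hg])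
      exact ContMDiffAt.comp_of_eq (g := g) (f := unitCoord n) (x := (1 : G)) (y := 0) hg0.contMDiffAt
        (contMDiffAt_unitCoord (one_mem_unitSource n)) (unitCoord_one n)
    refine h2.congr_of_eventuallyEq ?_
    have hev : ∀ᶠ x in 𝓝 (1 : G), Φ x ∈ unitSource n G :=
      hc.continuousAt.preimage_mem_nhds (by rw [map_one]; exact unitSource_mem_nhds n)
    filter_upwards [hev, unitSource_mem_nhds (G := G) n] with x hx hx'
    simp only [hg, unitParam_unitCoord hx', unitParam_unitCoord hx]
  intro x
  have h2 : ContMDiffAt (𝓡 n) (𝓡 n) ∞ (fun y => Φ (x⁻¹ * y)) x :=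
    ContMDiffAt.comp_of_eq (g := Φ) (f := fun y => x⁻¹ * y) (x := x) (y := 1) h1
      (contMDiffAt_const_mul x⁻¹ x) (inv_mul_cancel x)
  have h3 : ContMDiffAt (𝓡 n) (𝓡 n) ∞ (fun y => Φ x * Φ (x⁻¹ * y)) x :=
    contMDiffAt_const.mul h2
  refine h3.congr_of_eventuallyEq (Filter.Eventually.of_forall fun y => ?_)
  simp only
  rw [← map_mul, mul_inv_cancel_left]

/-- The vector field on `G` which is the right translate of the cocycle `w`, in the chart at the
identity. -/
noncomputable def cocycleField (n : ℕ) {G : Type*} [TopologicalSpace G]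
    [ChartedSpace (EuclideanSpace ℝ (Fin n)) G] [Group G] (w : G → EuclideanSpace ℝ (Fin n))
    (u : EuclideanSpace ℝ (Fin n)) : EuclideanSpace ℝ (Fin n) :=
  rightDeriv n (unitParam n G u) (w (unitParam n G u))

namespace IsCocycleOf

lemma hasStrictFDerivAt {A : E →L[ℝ] E} {w : G → E} (hw : IsCocycleOf A w) {u : E}
    (hu : u ∈ unitTarget n G) :
    HasStrictFDerivAt (fun u => w (unitParam n G u)) (cocycleForm A (unitParam n G u)) u := by
  refine hasStrictFDerivAt_of_hasFDerivAt_of_continuousAt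
    (f' := fun u => cocycleForm A (unitParam n G u)) ?_ (contDiffAt_cocycleForm A hu).continuousAt
  filter_upwards [(isOpen_unitTarget n).mem_nhds hu] with v hv using hw.hasFDerivAt hv

lemma cocycleField_zero {A : E →L[ℝ] E} {w : G → E} (hw : IsCocycleOf A w) :
    cocycleField n w 0 = 0 := by
  rw [cocycleField, unitParam_zero, hw.map_one, map_zero]

/-- Since `w` vanishes at the identity, the derivative of right translation does not contribute. -/
lemma hasStrictFDerivAt_cocycleField_zero {A : E →L[ℝ] E} {w : G → E} (hw : IsCocycleOf A w) :
    HasStrictFDerivAt (cocycleField n w) A 0 := by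
  have h := HasStrictFDerivAt.clm_apply
    ((contDiffAt_rightDeriv (G := G) (zero_mem_unitTarget n)).hasStrictFDerivAt (by simp))
    (hw.hasStrictFDerivAt (zero_mem_unitTarget n))
  refine h.congr_fderiv (ContinuousLinearMap.ext fun x => ?_)
  rw [unitParam_zero, hw.map_one, cocycleForm_one, rightDeriv_one]
  simp

lemma locallyLipschitzOn_cocycleField {A : E →L[ℝ] E} {w : G → E} (hw : IsCocycleOf A w) :
    LocallyLipschitzOn (unitTarget n G) (cocycleField n w) := by
  intro u hu
  obtain ⟨C, s, hs, hC⟩ := (HasStrictFDerivAt.clm_apply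
    ((contDiffAt_rightDeriv (G := G) hu).hasStrictFDerivAt (by simp))
    (hw.hasStrictFDerivAt hu)).exists_lipschitzOnWith
  exact ⟨C, s, mem_nhdsWithin_of_mem_nhds hs, hC⟩

/-- The product of two integral curves of the vector field of a cocycle is an integral curve. -/
lemma hasDerivAt_mul {A : E →L[ℝ] E} {w : G → E} (hw : IsCocycleOf A w) {a b : ℝ → E} {t : ℝ}
    (ha : HasDerivAt a (cocycleField n w (a t)) t) (hb : HasDerivAt b (cocycleField n w (b t)) t)
    (hat : a t ∈ unitTarget n G) (hbt : b t ∈ unitTarget n G)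
    (hab : unitParam n G (a t) * unitParam n G (b t) ∈ unitSource n G) :
    HasDerivAt (fun s => unitCoord n (unitParam n G (a s) * unitParam n G (b s)))
      (cocycleField n w (unitCoord n (unitParam n G (a t) * unitParam n G (b t)))) t := by
  set M : E × E → E := fun q => unitCoord n (unitParam n G q.1 * unitParam n G q.2) with hM
  have hMd : HasFDerivAt M (fderiv ℝ M (a t, b t)) (a t, b t) :=
    ((contDiffAt_unitCoord_mul (p := (a t, b t)) hat hbt hab).differentiableAt
      (by simp)).hasFDerivAt
  have h := hMd.comp_hasDerivAt t (ha.prodMk hb)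
  refine h.congr_deriv ?_
  set g := unitParam n G (a t) with hg
  set h := unitParam n G (b t) with hh
  have h1 : (fderiv ℝ M (a t, b t)).comp (ContinuousLinearMap.inl ℝ E E) =
      coordDeriv n (fun y => y * h) g := by
    refine (HasFDerivAt.comp (f := fun e : E => (e, b t)) (a t) hMd
      (hasFDerivAt_prodMk_left (a t) (b t))).unique ?_
    have h2 := (contMDiffAt_mul_const h g).hasFDerivAt_coord (unitParam_mem hat) hab
    rwa [hg, unitCoord_unitParam hat] at h2
  have h2 : (fderiv ℝ M (a t, b t)).comp (ContinuousLinearMap.inr ℝ E E) =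
      coordDeriv n (fun y => g * y) h := by
    refine (HasFDerivAt.comp (f := fun e : E => (a t, e)) (b t) hMd
      (hasFDerivAt_prodMk_right (a t) (b t))).unique ?_
    have h2 := (contMDiffAt_const_mul g h).hasFDerivAt_coord (unitParam_mem hbt) hab
    rwa [hh, unitCoord_unitParam hbt] at h2
  have e : ∀ x y : E, fderiv ℝ M (a t, b t) (x, y) =
      coordDeriv n (fun y => y * h) g x + coordDeriv n (fun y => g * y) h y := fun x y => by
    rw [← h1, ← h2]
    simp only [ContinuousLinearMap.comp_apply, ContinuousLinearMap.inl_apply,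
      ContinuousLinearMap.inr_apply, ← map_add, Prod.mk_add_mk, add_zero, zero_add]
  rw [e]
  have e1 := congrArg (fun L : E →L[ℝ] E => L (w g)) (rightDeriv_mul (n := n) (h := h)
    (unitParam_mem hat) hab)
  have e2 := congrArg (fun L : E →L[ℝ] E => L (w h)) (rightDeriv_mul_comp_adjointRep (n := n)
    (g := g) (unitParam_mem hbt) hab)
  -- By the cocycle identity, `w(gh)gh = (w(g)g)h + g(w(h)h)`; the two terms match the derivatives
  -- in the two factors.
  have e3 : cocycleField n w (unitCoord n (g * h)) = rightDeriv n (g * h) (w g) +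
      rightDeriv n (g * h) (adjointRep n g (w h)) := by
    rw [cocycleField, unitParam_unitCoord hab, hw.map_mul, map_add]
  rw [e3]
  exact (congrArg₂ (· + ·) e1 e2).symm

end IsCocycleOf

/-- The flow of the vector field of a cocycle vanishing on `K` consists of automorphisms which fix
`K` pointwise. -/
theorem IsCocycleOf.exists_equivariantAut [SimplyConnectedSpace G] {A : E →L[ℝ] E} {w : G → E}
    (hw : IsCocycleOf A w) {K : Subgroup G} (hKconn : IsConnected (K : Set G))
    (hwK : ∀ x ∈ K, w x = 0) :
    ∃ ε > (0 : ℝ), ∀ t ∈ Ioo (-ε) ε, ∃ φ : EquivariantAut n K, (∀ x ∈ K, φ.toMulEquiv x = x) ∧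
      φ.differential = NormedSpace.exp (t • A) := by
  have := topologicalGroup_of_lieGroup (𝓡 n) ∞ (G := G)
  have : LocallyPathConnectedSpace G := ChartedSpace.locallyPathConnectedSpace E G
  obtain ⟨ε, hε, α, L, hα, -, hs⟩ :=
    exists_local_flow hw.hasStrictFDerivAt_cocycleField_zero hw.cocycleField_zero
  refine ⟨ε, hε, ?_⟩
  have h0 : (0 : ℝ) ∈ Ioo (-ε) ε := ⟨by linarith, hε⟩
  have hmulS : ∀ᶠ p : E × E in 𝓝 0 ×ˢ 𝓝 0, unitParam n G p.1 * unitParam n G p.2 ∈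
      unitSource n G := by
    have h := (tendsto_unitParam (n := n) (G := G)).comp
      (Filter.tendsto_fst (f := 𝓝 (0 : E)) (g := 𝓝 (0 : E))) |>.mul
      ((tendsto_unitParam (n := n) (G := G)).comp
      (Filter.tendsto_snd (f := 𝓝 (0 : E)) (g := 𝓝 (0 : E))))
    rw [mul_one] at h
    exact h.eventually (unitSource_mem_nhds n)
  obtain ⟨N, hN, hNmul⟩ := Filter.eventually_prod_self_iff'.1 hmulS
  have hgood := hα _ (Filter.inter_mem hN (unitTarget_mem_nhds (G := G) n))
  -- Starting points whose whole trajectory stays in the chart and in a neighbourhood where products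
  -- remain in the chart domain.
  set good : Set E := {x | α x 0 = x ∧ ∀ t ∈ Ioo (-ε) ε,
    HasDerivAt (α x) (cocycleField n w (α x t)) t ∧ α x t ∈ N ∩ unitTarget n G} with hgooddef
  have hgood' : good ∈ 𝓝 0 := hgood
  have hlim : ∀ t ∈ Ioo (-ε) ε, Filter.Tendsto (fun x => α x t) (𝓝 0) (𝓝 0) :=
    fun t ht U hU => (hα U hU).mono fun x hx => (hx.2 t ht).2
  have hmem : ∀ x ∈ good, x ∈ N ∩ unitTarget n G := fun x hx => by
    have h := (hx.2 0 h0).2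
    rwa [hx.1] at h
  have hsol : ∀ x ∈ good, ∀ t ∈ Ioo (-ε) ε,
      HasDerivAt (α x) (cocycleField n w (α x t)) t ∧ α x t ∈ unitTarget n G := fun x hx t ht =>
    ⟨(hx.2 t ht).1, (hx.2 t ht).2.2⟩
  -- The product of two trajectories is an integral curve, so by uniqueness it is the trajectory of
  -- the product.
  have hmulα : ∀ x ∈ good, ∀ y ∈ good, unitCoord n (unitParam n G x * unitParam n G y) ∈ good →
      ∀ t ∈ Ioo (-ε) ε, unitParam n G (α (unitCoord n (unitParam n G x * unitParam n G y)) t) =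
        unitParam n G (α x t) * unitParam n G (α y t) := by
    intro x hx y hy hxy t ht
    have hS : ∀ t ∈ Ioo (-ε) ε, unitParam n G (α x t) * unitParam n G (α y t) ∈ unitSource n G :=
      fun t ht => hNmul _ (hx.2 t ht).2.1 _ (hy.2 t ht).2.1
    have h := ODE_solution_unique_of_locallyLipschitzOn hw.locallyLipschitzOn_cocycleField
      isOpen_Ioo ordConnected_Ioo (hsol _ hxy)
      (g := fun t => unitCoord n (unitParam n G (α x t) * unitParam n G (α y t)))
      (fun t ht => ⟨hw.hasDerivAt_mul (hx.2 t ht).1 (hy.2 t ht).1 (hx.2 t ht).2.2 (hy.2 t ht).2.2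
        (hS t ht), unitCoord_mem (hS t ht)⟩) h0 (by simp only [hxy.1, hx.1, hy.1]) ht
    rw [h]
    exact unitParam_unitCoord (hS t ht)
  have hhom : ∀ t ∈ Ioo (-ε) ε, ∃ Φ : G →* G, ∀ᶠ x in 𝓝 1,
      Φ x = unitParam n G (α (unitCoord n x) t) := by
    intro t ht
    refine exists_monoidHom_eventuallyEq _ ?_
    have hg1 : ∀ᶠ x in 𝓝 (1 : G), x ∈ unitSource n G ∧ unitCoord n x ∈ good :=
      Filter.Eventually.and (unitSource_mem_nhds n)
        ((tendsto_unitCoord (n := n) (G := G)).eventually hgood')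
    have hg2 : ∀ᶠ p : G × G in 𝓝 (1, 1), p.1 * p.2 ∈ unitSource n G ∧ unitCoord n (p.1 * p.2) ∈ good := by
      have h := (continuous_mul (M := G)).tendsto (1, 1)
      simp only [mul_one] at h
      exact h.eventually hg1
    rw [nhds_prod_eq] at hg2 ⊢
    filter_upwards [hg2, hg1.prod_mk hg1] with p hp ⟨hp1, hp2⟩
    have h := hmulα _ hp1.2 _ hp2.2
    rw [unitParam_unitCoord hp1.1, unitParam_unitCoord hp2.1] at h
    exact h hp.2 t ht
  choose Φ hΦ using hhom
  have hchart : ∀ t ht, ∀ᶠ u in 𝓝 0, Φ t ht (unitParam n G u) = unitParam n G (α u t) := by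
    intro t ht
    filter_upwards [(tendsto_unitParam (n := n) (G := G)).eventually (hΦ t ht),
      unitTarget_mem_nhds (G := G) n] with u hu huT
    rw [hu, unitCoord_unitParam huT]
  have hcont : ∀ t ht, Continuous (Φ t ht) := by
    intro t ht
    refine continuous_of_continuousAt_one (Φ t ht) ?_
    rw [ContinuousAt, (Φ t ht).map_one]
    refine Filter.Tendsto.congr' (Filter.EventuallyEq.symm (hΦ t ht)) ?_
    exact (tendsto_unitParam.comp (hlim t ht)).comp tendsto_unitCoord
  have hder : ∀ t ht, HasFDerivAt (fun u => unitCoord n (Φ t ht (unitParam n G u)))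
      (NormedSpace.exp (t • A)) 0 := by
    intro t ht
    refine (hs t ht).hasFDerivAt.congr_of_eventuallyEq ?_
    filter_upwards [hchart t ht, hgood'] with u hu hug
    rw [hu, unitCoord_unitParam (hug.2 t ht).2.2]
  have hsmooth : ∀ t ht, ContMDiff (𝓡 n) (𝓡 n) ∞ (Φ t ht) := fun t ht =>
    MonoidHom.contMDiff_of_hasFDerivAt (hcont t ht) (hder t ht)
  have hneg : ∀ t ∈ Ioo (-ε) ε, -t ∈ Ioo (-ε) ε := fun t ht =>
    ⟨by linarith [ht.2], by linarith [ht.1]⟩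
  have hαinv : ∀ t ∈ Ioo (-ε) ε, ∀ u ∈ good, α u t ∈ good → α (α u t) (-t) = u := by
    intro t ht u hu hut
    have h := ODE_solution_unique_of_locallyLipschitzOn hw.locallyLipschitzOn_cocycleField
      (J := Ioo (-ε) ε ∩ Ioo (-ε - t) (ε - t)) (isOpen_Ioo.inter isOpen_Ioo)
      (ordConnected_Ioo.inter ordConnected_Ioo) (f := α (α u t)) (g := fun s => α u (t + s))
      (t₀ := 0) (fun s hs => hsol _ hut s hs.1) (fun s hs => ?_)
      ⟨h0, by linarith [ht.1], by linarith [ht.2]⟩ (by simp only [add_zero, hut.1])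
      (x := -t) ⟨hneg t ht, by linarith [hε], by linarith [hε]⟩
    · simp only [add_neg_cancel] at h
      rw [h, hu.1]
    · have hs' : t + s ∈ Ioo (-ε) ε := ⟨by linarith [hs.2.1], by linarith [hs.2.2]⟩
      exact ⟨(hsol u hu _ hs').1.comp_const_add t s, (hsol u hu _ hs').2⟩
  have hinv : ∀ t ht x, Φ (-t) (hneg t ht) (Φ t ht x) = x := by
    intro t ht
    refine MonoidHom.eq_of_eventuallyEq_one (Φ := (Φ (-t) (hneg t ht)).comp (Φ t ht))
      (Ψ := MonoidHom.id G) ?_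
    have hev : ∀ᶠ u in 𝓝 (0 : E), u ∈ good ∧ α u t ∈ good ∧
        Φ (-t) (hneg t ht) (unitParam n G (α u t)) = unitParam n G (α (α u t) (-t)) :=
      Filter.Eventually.and hgood' (((hlim t ht).eventually hgood').and
        ((hlim t ht).eventually (hchart (-t) (hneg t ht))))
    filter_upwards [hΦ t ht, (tendsto_unitCoord (n := n) (G := G)).eventually hev,
      unitSource_mem_nhds (G := G) n] with x hx hx' hxS
    rw [MonoidHom.comp_apply, hx, hx'.2.2, hαinv t ht _ hx'.1 hx'.2.1, unitParam_unitCoord hxS]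
    rfl
  -- The field vanishes on `K`, so points of `K` near `1` are stationary. Connectedness of `K`
  -- extends this to all of `K`.
  have hfix : ∀ t ht, ∀ x ∈ K, Φ t ht x = x := by
    intro t ht
    have hpre : PreconnectedSpace K := isPreconnected_iff_preconnectedSpace.1 hKconn.isPreconnected
    have hev : ∀ᶠ x in 𝓝 (1 : G), x ∈ K → Φ t ht x = x := by
      filter_upwards [hΦ t ht, (tendsto_unitCoord (n := n) (G := G)).eventually hgood',
        unitSource_mem_nhds (G := G) n] with x hx hxg hxS hxK
      have h := ODE_solution_unique_of_locallyLipschitzOn hw.locallyLipschitzOn_cocycleField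
        isOpen_Ioo ordConnected_Ioo (hsol _ hxg) (g := fun _ => unitCoord n x)
        (fun s _ => ⟨?_, unitCoord_mem hxS⟩) h0 hxg.1 ht
      · rw [hx, h]
        exact unitParam_unitCoord hxS
      · rw [cocycleField, unitParam_unitCoord hxS, hwK x hxK, map_zero]
        exact hasDerivAt_const s _
    intro x hx
    refine MonoidHom.eq_of_eventuallyEq_one (G' := K) (Φ := (Φ t ht).comp K.subtype)
      (Ψ := K.subtype) ?_ ⟨x, hx⟩
    have h : ∀ᶠ x : K in 𝓝 1, (x : G) ∈ K → Φ t ht x = x :=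
      (continuous_subtype_val.tendsto (1 : K)).eventually hev
    filter_upwards [h] with y hy using hy y.2
  intro t ht
  have hinv' : ∀ x, Φ t ht (Φ (-t) (hneg t ht) x) = x := by
    have h := hinv (-t) (hneg t ht)
    simpa only [neg_neg] using h
  refine ⟨{ toMulEquiv := MonoidHom.toMulEquiv (Φ t ht) (Φ (-t) (hneg t ht))
              (MonoidHom.ext (hinv t ht)) (MonoidHom.ext hinv')
            contMDiff_toFun := hsmooth t ht
            contMDiff_invFun := hsmooth (-t) (hneg t ht)
            map_subgroup := ?_ }, hfix t ht, ?_⟩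
  · ext x
    constructor
    · rintro ⟨y, hy, rfl⟩
      have h := hfix t ht y hy
      exact h.symm ▸ hy
    · intro hx
      exact ⟨x, hx, hfix t ht x hx⟩
  · refine (diffAtOne_eq_fderiv _ ((hsmooth t ht).mdifferentiableAt (by simp)) (Φ t ht).map_one).trans ?_
    exact (hder t ht).fderiv

end Automorphisms

/-! ### Automorphisms with differential `exp(tA)` for all times -/

section OneParameterGroups

variable {n : ℕ} {G : Type*} [TopologicalSpace G] [ChartedSpace (EuclideanSpace ℝ (Fin n)) G]
  [Group G]

local notation "E" => EuclideanSpace ℝ (Fin n)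

namespace EquivariantAut

/-- The identity automorphism. -/
def refl (n : ℕ) {G : Type*} [TopologicalSpace G] [ChartedSpace (EuclideanSpace ℝ (Fin n)) G]
    [Group G] (K : Subgroup G) : EquivariantAut n K where
  toMulEquiv := MulEquiv.refl G
  contMDiff_toFun := contMDiff_id
  contMDiff_invFun := contMDiff_id
  map_subgroup := K.map_id

/-- The composition of two automorphisms. -/
def trans {K : Subgroup G} (φ ψ : EquivariantAut n K) : EquivariantAut n K where
  toMulEquiv := φ.toMulEquiv.trans ψ.toMulEquiv
  contMDiff_toFun := ψ.contMDiff_toFun.comp φ.contMDiff_toFun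
  contMDiff_invFun := φ.contMDiff_invFun.comp ψ.contMDiff_invFun
  map_subgroup := by
    have h := K.map_map ψ.toMulEquiv.toMonoidHom φ.toMulEquiv.toMonoidHom
    rw [φ.map_subgroup, ψ.map_subgroup] at h
    exact h.symm

lemma differential_refl (K : Subgroup G) :
    (refl n K).differential = ContinuousLinearMap.id ℝ E :=
  ContinuousLinearMap.ext fun X => diffAtOne_id X

lemma differential_trans {K : Subgroup G} (φ ψ : EquivariantAut n K) :
    (φ.trans ψ).differential = ψ.differential.comp φ.differential :=
  ContinuousLinearMap.ext fun X => diffAtOne_comp _ _ ψ.contMDiff_toFun φ.contMDiff_toFun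
    (map_one φ.toMulEquiv) X

end EquivariantAut

/-- A cocycle vanishing on `K` generates a one parameter group of automorphisms which fix `K`
pointwise. -/
theorem IsCocycleOf.exists_differential_eq_exp [LieGroup (𝓡 n) ∞ G] [SimplyConnectedSpace G]
    {A : E →L[ℝ] E} {w : G → E} (hw : IsCocycleOf A w) {K : Subgroup G}
    (hKconn : IsConnected (K : Set G)) (hwK : ∀ x ∈ K, w x = 0) (t : ℝ) :
    ∃ φ : EquivariantAut n K, (∀ x ∈ K, φ.toMulEquiv x = x) ∧
      φ.differential = NormedSpace.exp (t • A) := by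
  obtain ⟨ε, hε, h⟩ := hw.exists_equivariantAut hKconn hwK
  have hpow : ∀ (P : E →L[ℝ] E), (∃ φ : EquivariantAut n K, (∀ x ∈ K, φ.toMulEquiv x = x) ∧
      φ.differential = P) → ∀ m : ℕ, ∃ φ : EquivariantAut n K, (∀ x ∈ K, φ.toMulEquiv x = x) ∧
      φ.differential = P ^ m := by
    rintro P ⟨φ, hφ, rfl⟩ m
    induction m with
    | zero =>
      refine ⟨EquivariantAut.refl n K, fun x _ => rfl, ?_⟩
      rw [EquivariantAut.differential_refl, pow_zero]
      rfl
    | succ m ih =>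
      obtain ⟨ψ, hψ, hψd⟩ := ih
      refine ⟨φ.trans ψ, fun x hx => ?_, ?_⟩
      · have h1 : ψ.toMulEquiv (φ.toMulEquiv x) = x := by rw [hφ x hx, hψ x hx]
        exact h1
      · rw [EquivariantAut.differential_trans, hψd, pow_succ]
        rfl
  -- `t / m` is a time of the local flow, and the `m`-th iterate of its automorphism has
  -- differential `exp(tA)`.
  obtain ⟨m, hm⟩ := exists_nat_gt (|t| / ε)
  have hm0 : (0 : ℝ) < m := (div_nonneg (abs_nonneg t) hε.le).trans_lt hm
  have htm : t / m ∈ Ioo (-ε) ε := by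
    rw [mem_Ioo, ← abs_lt, abs_div, abs_of_pos hm0, div_lt_iff₀ hm0, mul_comm]
    rwa [div_lt_iff₀ hε] at hm
  obtain ⟨φ, hφ, hφd⟩ := hpow _ (h _ htm) m
  refine ⟨φ, hφ, hφd.trans ?_⟩
  let _ : NormedAlgebra ℚ (E →L[ℝ] E) := NormedAlgebra.restrictScalars ℚ ℝ _
  rw [← NormedSpace.exp_nsmul, ← Nat.cast_smul_eq_nsmul ℝ, smul_smul, mul_div_cancel₀ _ hm0.ne']

end OneParameterGroups

/-! ### Derivatives tested against linear functionals -/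

section WeakDerivative

variable {X Y Z : Type*} [AddCommGroup X] [Module ℝ X] [AddCommGroup Y] [Module ℝ Y]
  [AddCommGroup Z] [Module ℝ Z]

/-- The derivative of a curve in a finite dimensional vector space, without reference to a norm. -/
def HasWeakDerivAt (c : ℝ → X) (c' : X) (t : ℝ) : Prop :=
  ∀ ℓ : X →ₗ[ℝ] ℝ, HasDerivAt (fun s => ℓ (c s)) (ℓ c') t

lemma HasDerivAt.hasWeakDerivAt {W : Type*} [NormedAddCommGroup W] [NormedSpace ℝ W]
    [FiniteDimensional ℝ W] {c : ℝ → W} {c' : W} {t : ℝ} (h : HasDerivAt c c' t) :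
    HasWeakDerivAt c c' t := fun ℓ =>
  (LinearMap.toContinuousLinearMap ℓ).hasFDerivAt.comp_hasDerivAt t h

namespace HasWeakDerivAt

lemma hasDerivAt {W : Type*} [NormedAddCommGroup W] [NormedSpace ℝ W]
    [FiniteDimensional ℝ W] {c : ℝ → W} {c' : W} {t : ℝ} (h : HasWeakDerivAt c c' t) :
    HasDerivAt c c' t := by
  let b := Module.finBasis ℝ W
  have h1 : HasDerivAt (fun s => ∑ i, b.coord i (c s) • b i) (∑ i, b.coord i c' • b i) t :=
    HasDerivAt.fun_sum fun i _ => (h (b.coord i)).smul_const (b i)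
  have e : ∀ x, ∑ i, b.coord i x • b i = x := fun x => b.sum_repr x
  simpa only [e] using h1

lemma congr {c d : ℝ → X} {c' d' : X} {t : ℝ} (h : HasWeakDerivAt c c' t) (hc : ∀ s, d s = c s)
    (hc' : d' = c') : HasWeakDerivAt d d' t := by
  rwa [funext hc, hc']

lemma map {c : ℝ → X} {c' : X} {t : ℝ} (h : HasWeakDerivAt c c' t) (L : X →ₗ[ℝ] Y) :
    HasWeakDerivAt (fun s => L (c s)) (L c') t := fun ℓ => h (ℓ ∘ₗ L)

lemma map₂ [FiniteDimensional ℝ X] {c : ℝ → X} {c' : X} {d : ℝ → Y} {d' : Y} {t : ℝ}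
    (hc : HasWeakDerivAt c c' t) (hd : HasWeakDerivAt d d' t) (B : X →ₗ[ℝ] Y →ₗ[ℝ] Z) :
    HasWeakDerivAt (fun s => B (c s) (d s)) (B c' (d t) + B (c t) d') t := by
  intro ℓ
  let b := Module.finBasis ℝ X
  have e : ∀ x y, ℓ (B x y) = ∑ i, b.coord i x * ℓ (B (b i) y) := fun x y => by
    conv_lhs => rw [← b.sum_repr x]
    simp only [map_sum, map_smul, LinearMap.sum_apply, LinearMap.smul_apply, smul_eq_mul,
      Basis.coord_apply]
  have h : HasDerivAt (fun s => ∑ i, b.coord i (c s) * ℓ (B (b i) (d s)))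
      (∑ i, (b.coord i c' * ℓ (B (b i) (d t)) + b.coord i (c t) * ℓ (B (b i) d'))) t :=
    HasDerivAt.fun_sum fun i _ => (hc (b.coord i)).mul (hd (ℓ ∘ₗ B (b i)))
  rw [Finset.sum_add_distrib, ← e, ← e, ← map_add] at h
  simpa only [← e] using h

/-- In a basis, `M(c, …, c)` is a polynomial in the coordinates of `c`, and the scalar product rule
applies to each monomial. -/
lemma multilinear [FiniteDimensional ℝ X] {ι : Type*} [Fintype ι] [DecidableEq ι] {c : ℝ → X}
    {c' : X} {t : ℝ} (hc : HasWeakDerivAt c c' t) (M : MultilinearMap ℝ (fun _ : ι => X) Y) :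
    HasWeakDerivAt (fun s => M fun _ => c s)
      (∑ j, M (Function.update (fun _ => c t) j c')) t := by
  intro ℓ
  let b := Module.finBasis ℝ X
  have e : ∀ x : ι → X, ℓ (M x) =
      ∑ f : ι → Fin (finrank ℝ X), (∏ i, b.coord (f i) (x i)) * ℓ (M fun i => b (f i)) := by
    intro x
    have hx : x = fun i => ∑ j, b.coord j (x i) • b j := funext fun i => (b.sum_repr (x i)).symm
    conv_lhs => rw [hx, M.map_sum]
    simp only [MultilinearMap.map_smul_univ, map_sum, map_smul, smul_eq_mul]
  have h : HasDerivAt (fun s => ∑ f : ι → Fin (finrank ℝ X), (∏ i, b.coord (f i) (c s)) *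
      ℓ (M fun i => b (f i))) _ t :=
    HasDerivAt.fun_sum fun f _ => (HasDerivAt.fun_finsetProd (u := Finset.univ)
      fun i _ => hc (b.coord (f i))).mul_const (ℓ (M fun i => b (f i)))
  have e' : ∀ s, (∑ f : ι → Fin (finrank ℝ X), (∏ i, b.coord (f i) (c s)) *
      ℓ (M fun i => b (f i))) = ℓ (M fun _ => c s) := fun s => (e _).symm
  simp only [e'] at h
  refine h.congr_deriv ?_
  simp only [Finset.sum_mul, map_sum]
  rw [Finset.sum_comm]
  refine Finset.sum_congr rfl fun j _ => ?_
  rw [e]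
  refine Finset.sum_congr rfl fun f _ => ?_
  congr 1
  rw [← Finset.mul_prod_erase Finset.univ _ (Finset.mem_univ j), Function.update_self, mul_comm,
    smul_eq_mul, mul_comm]
  rw [mul_comm]
  congr 1
  refine Finset.prod_congr rfl fun i hi => ?_
  rw [Function.update_of_ne (Finset.ne_of_mem_erase hi)]

end HasWeakDerivAt

end WeakDerivative

/-! ### Differentiation of the pull-back of tensors -/

section TensorDerivative

variable {V : Type*} [AddCommGroup V] [Module ℝ V] {ι : Type*} {r s : ι → ℕ}

namespace TensorTuple

lemma pullback_add (h : V ≃ₗ[ℝ] V) (γ δ : TensorTuple V r s) :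
    pullback h (γ + δ) = pullback h γ + pullback h δ := by
  funext i
  refine MultilinearMap.ext fun v => ?_
  exact map_add (PiTensorProduct.map fun _ => h.symm.toLinearMap) (γ i fun j => h (v j))
    (δ i fun j => h (v j))

lemma pullback_smul (h : V ≃ₗ[ℝ] V) (a : ℝ) (γ : TensorTuple V r s) :
    pullback h (a • γ) = a • pullback h γ := by
  funext i
  refine MultilinearMap.ext fun v => ?_
  exact map_smul (PiTensorProduct.map fun _ => h.symm.toLinearMap) a (γ i fun j => h (v j))

/-- The pull-back as a linear map. -/
def pullbackₗ (h : V ≃ₗ[ℝ] V) : TensorTuple V r s →ₗ[ℝ] TensorTuple V r s where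
  toFun := pullback h
  map_add' := pullback_add h
  map_smul' := pullback_smul h

lemma pullback_trans (h k : V ≃ₗ[ℝ] V) (γ : TensorTuple V r s) :
    pullback (h.trans k) γ = pullback h (pullback k γ) := by
  funext i
  refine MultilinearMap.ext fun v => ?_
  have e := PiTensorProduct.map_comp (R := ℝ) (fun _ : Fin (s i) => h.symm.toLinearMap)
    (fun _ => k.symm.toLinearMap)
  exact congrArg (fun L => L (γ i fun j => k (h (v j)))) e

lemma pullback_refl (γ : TensorTuple V r s) : pullback (LinearEquiv.refl ℝ V) γ = γ := by
  funext i
  refine MultilinearMap.ext fun v => ?_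
  have e := PiTensorProduct.map_id (R := ℝ) (s := fun _ : Fin (s i) => V)
  exact congrArg (fun L => L (γ i v)) e

lemma theta_add (A B : V →ₗ[ℝ] V) (γ : TensorTuple V r s) :
    theta (A + B) γ = theta A γ + theta B γ := by
  funext i
  refine MultilinearMap.ext fun v => ?_
  have h1 : ∀ (C : V →ₗ[ℝ] V) j, PiTensorProduct.map (R := ℝ)
      (Function.update (fun _ : Fin (s i) => LinearMap.id) j C) =
      PiTensorProduct.mapMultilinear ℝ (fun _ : Fin (s i) => V) (fun _ => V)
        (Function.update (fun _ => LinearMap.id) j C) := fun _ _ => rfl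
  have h2 : ∀ (C : V →ₗ[ℝ] V) j, (γ i).compLinearMap
      (Function.update (fun _ => LinearMap.id) j C) =
      MultilinearMap.compLinearMapMultilinear (R := ℝ) (Function.update (fun _ => LinearMap.id) j C)
        (γ i) := fun _ _ => rfl
  have e : theta (A + B) γ i = theta A γ i + theta B γ i := by
    simp only [theta, h1, h2, MultilinearMap.map_update_add, LinearMap.add_apply]
    refine MultilinearMap.ext fun v => ?_
    simp only [sub_apply, add_apply, sum_apply,
      LinearMap.compMultilinearMap_apply, Finset.sum_add_distrib]
    rw [LinearMap.add_apply]
    abel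
  exact congrArg (fun M => M v) e

/-- The expression is multilinear in `q` copies of `g` and `p` copies of `h`. At `0` all
undifferentiated copies are the identity, and `h' = -B` gives the minus sign. -/
lemma hasWeakDerivAt_pullback_apply [FiniteDimensional ℝ V] {g h : ℝ → V →ₗ[ℝ] V} {B : V →ₗ[ℝ] V}
    (hg0 : g 0 = LinearMap.id) (hh0 : h 0 = LinearMap.id) (hg : HasWeakDerivAt g B 0)
    (hh : HasWeakDerivAt h (-B) 0) {p q : ℕ} (γ : TensorOfType V p q) :
    HasWeakDerivAt (fun t => (PiTensorProduct.map fun _ : Fin q => g t).compMultilinearMap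
        (γ.compLinearMap fun _ => h t))
      ((∑ j : Fin q, PiTensorProduct.map
        (Function.update (fun _ => LinearMap.id) j B)).compMultilinearMap γ
      - ∑ j : Fin p, γ.compLinearMap (Function.update (fun _ => LinearMap.id) j B)) 0 := by
  have h1 := hg.multilinear (PiTensorProduct.mapMultilinear ℝ (fun _ : Fin q => V) (fun _ => V))
  have h2 := (hh.multilinear (MultilinearMap.compLinearMapMultilinear (R := ℝ)
    (M₁ := fun _ : Fin p => V) (M₁' := fun _ : Fin p => V) (M₂ := ⨂[ℝ] _ : Fin q, V))).map
    (LinearMap.applyₗ γ)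
  let C : ((⨂[ℝ] _ : Fin q, V) →ₗ[ℝ] (⨂[ℝ] _ : Fin q, V)) →ₗ[ℝ] TensorOfType V p q →ₗ[ℝ]
      TensorOfType V p q :=
    LinearMap.mk₂ ℝ (fun L M => L.compMultilinearMap M) (fun _ _ _ => rfl) (fun _ _ _ => rfl)
      (fun L M N => MultilinearMap.ext fun v => map_add L (M v) (N v))
      (fun a L M => MultilinearMap.ext fun v => map_smul L a (M v))
  have h3 := h1.map₂ h2 C
  refine h3.congr (fun t => rfl) ?_
  have e0 : C (PiTensorProduct.mapMultilinear ℝ (fun _ : Fin q => V) (fun _ => V) fun _ => g 0) =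
      LinearMap.id := by
    refine LinearMap.ext fun M => MultilinearMap.ext fun v => ?_
    rw [hg0]
    have e := PiTensorProduct.map_id (R := ℝ) (s := fun _ : Fin q => V)
    exact congrArg (fun L => L (M v)) e
  rw [e0, hh0, hg0, LinearMap.id_apply]
  let T : MultilinearMap ℝ (fun _ : Fin p => V →ₗ[ℝ] V)
      (TensorOfType V p q →ₗ[ℝ] TensorOfType V p q) :=
    MultilinearMap.compLinearMapMultilinear (R := ℝ)
      (M₁ := fun _ : Fin p => V) (M₁' := fun _ : Fin p => V) (M₂ := ⨂[ℝ] _ : Fin q, V)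
  have hneg : ∑ j, T (Function.update (fun _ => LinearMap.id) j (-B)) =
      (-1 : ℝ) • ∑ j, T (Function.update (fun _ => LinearMap.id) j B) := by
    rw [Finset.smul_sum]
    refine Finset.sum_congr rfl fun j _ => ?_
    rw [← neg_one_smul ℝ B]
    exact T.map_update_smul _ _ _ _
  have hneg' : LinearMap.applyₗ γ (∑ j, T (Function.update (fun _ => LinearMap.id) j (-B))) =
      (-1 : ℝ) • ∑ j, γ.compLinearMap (Function.update (fun _ => LinearMap.id) j B) := by
    rw [hneg, map_smul, map_sum]
    rfl
  refine Eq.trans ?_ (congrArg₂ (· + ·) rfl hneg').symm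
  have hsub : ∀ x y : TensorOfType V p q, x - y = x + (-1 : ℝ) • y := fun x y =>
    (sub_eq_add_neg x y).trans (congrArg (x + ·) (neg_one_smul ℝ y).symm)
  exact hsub _ _

/-- The derivative of the pull-back along a curve of automorphisms is given by `theta`. -/
theorem hasDerivAt_pullback [Fintype ι] [FiniteDimensional ℝ V] {h : ℝ → V ≃ₗ[ℝ] V}
    {B : V →ₗ[ℝ] V} (h0 : h 0 = LinearEquiv.refl ℝ V)
    (hh : HasWeakDerivAt (fun t => (h t).toLinearMap) (-B) 0)
    (hg : HasWeakDerivAt (fun t => (h t).symm.toLinearMap) B 0) (γ : TensorTuple V r s) :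
    HasDerivAt (fun t => pullback (h t) γ) (theta B γ) 0 := by
  classical
  refine HasWeakDerivAt.hasDerivAt fun ℓ => ?_
  let ℓ' : (∀ i, TensorOfType V (r i) (s i)) →ₗ[ℝ] ℝ := ℓ
  have e : ∀ δ : ∀ i, TensorOfType V (r i) (s i), ℓ' δ =
      ∑ i, (ℓ' ∘ₗ LinearMap.single ℝ (fun i => TensorOfType V (r i) (s i)) i) (δ i) := by
    intro δ
    have hδ : ∑ i, LinearMap.single ℝ (fun i => TensorOfType V (r i) (s i)) i (δ i) = δ :=
      LinearMap.sum_single_apply _ δ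
    conv_lhs => rw [← hδ, map_sum]
    rfl
  have hsum : HasDerivAt (fun t => ∑ i, (ℓ' ∘ₗ LinearMap.single ℝ
      (fun i => TensorOfType V (r i) (s i)) i) (pullback (h t) γ i))
      (∑ i, (ℓ' ∘ₗ LinearMap.single ℝ (fun i => TensorOfType V (r i) (s i)) i) (theta B γ i)) 0 :=
    HasDerivAt.fun_sum fun i _ => hasWeakDerivAt_pullback_apply (by rw [h0]; rfl)
      (by rw [h0]; rfl) hg hh (γ i) _
  exact (hsum.congr_deriv (e (theta B γ)).symm).congr_of_eventuallyEq
    (Filter.Eventually.of_forall fun t => e (pullback (h t) γ))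

end TensorTuple

end TensorDerivative

/-! ### Pull-backs along automorphism groups and the scaling of time -/

section Solitons

lemma exp_zero_smul {𝔸 : Type*} [NormedRing 𝔸] [NormedAlgebra ℝ 𝔸] (A : 𝔸) :
    NormedSpace.exp ((0 : ℝ) • A) = 1 := by
  rw [zero_smul, NormedSpace.exp_zero]

lemma exp_neg_smul_eq {𝔸 : Type*} [NormedRing 𝔸] [NormedAlgebra ℝ 𝔸] (τ : ℝ) (A : 𝔸) :
    NormedSpace.exp ((-τ) • A) = NormedSpace.exp (τ • (-A)) := by
  rw [neg_smul, smul_neg]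

lemma exp_smul_eq_mul {𝔸 : Type*} [NormedRing 𝔸] [NormedAlgebra ℝ 𝔸] [CompleteSpace 𝔸] (A : 𝔸)
    (x τ : ℝ) : NormedSpace.exp (x • A) =
      NormedSpace.exp ((x - τ) • A) * NormedSpace.exp (τ • A) := by
  let _ : NormedAlgebra ℚ 𝔸 := NormedAlgebra.restrictScalars ℚ ℝ _
  have hc : Commute ((x - τ) • A) (τ • A) := ((Commute.refl A).smul_left _).smul_right _
  rw [← NormedSpace.exp_add_of_commute hc, ← add_smul, sub_add_cancel]

lemma hasDerivAt_exp_smul_zero {𝔸 : Type*} [NormedRing 𝔸] [NormedAlgebra ℝ 𝔸] [CompleteSpace 𝔸]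
    (A : 𝔸) : HasDerivAt (fun t : ℝ => NormedSpace.exp (t • A)) A 0 := by
  have h := hasDerivAt_exp_smul_const A (0 : ℝ)
  rwa [exp_zero_smul, one_mul] at h

/-- Taking the induced endomorphism of a quotient extends to a linear map on all endomorphisms. -/
lemma Submodule.exists_linearMap_eq_mapQ {W : Type*} [AddCommGroup W] [Module ℝ W]
    (k : Submodule ℝ W) : ∃ Φ : (W →ₗ[ℝ] W) →ₗ[ℝ] ((W ⧸ k) →ₗ[ℝ] (W ⧸ k)),
      ∀ (L : W →ₗ[ℝ] W) (h : k ≤ k.comap L), Φ L = k.mapQ k L h := by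
  -- A linear section of the projection defines `L ↦ mkQ ∘ L ∘ s` even when `L` does not preserve
  -- `k`.
  obtain ⟨s, hs⟩ := k.mkQ.exists_rightInverse_of_surjective k.range_mkQ
  have hs' : ∀ x, k.mkQ (s x) = x := fun x => LinearMap.congr_fun hs x
  refine ⟨LinearMap.llcomp ℝ (W ⧸ k) W (W ⧸ k) k.mkQ ∘ₗ LinearMap.lcomp ℝ W s,
    fun L h => LinearMap.ext fun x => ?_⟩
  have h1 : k.mapQ k L h (k.mkQ (s x)) = k.mkQ (L (s x)) := rfl
  rw [hs'] at h1
  exact h1.symm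

/-- The new time is a logarithm for `c ≠ 0` and `t` itself for `c = 0`. Its speed is `a^(α-1)` for
the scaling factor `a` of the soliton. -/
lemma exists_scaling {α : ℝ} (hα : α < 1) (c : ℝ) : ∃ τ : ℝ → ℝ, τ 0 = 0 ∧
    ContDiffOn ℝ ∞ τ (selfSimilarInterval α c) ∧
    ∀ t ∈ selfSimilarInterval α c, HasDerivAt τ ((1 - α) * c * t + 1)⁻¹ t := by
  have hu : ∀ t, HasDerivAt (fun t : ℝ => (1 - α) * c * t + 1) ((1 - α) * c) t := fun t => by
    simpa using ((hasDerivAt_id t).const_mul ((1 - α) * c)).add_const 1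
  by_cases hc : c = 0
  · refine ⟨id, rfl, contDiff_id.contDiffOn, fun t _ => ?_⟩
    simpa [hc] using hasDerivAt_id t
  · have hne : (1 - α) * c ≠ 0 := mul_ne_zero (sub_pos.2 hα).ne' hc
    refine ⟨fun t => Real.log ((1 - α) * c * t + 1) / ((1 - α) * c), by simp, ?_, fun t ht => ?_⟩
    · refine ContDiffOn.div_const (ContDiffOn.log ?_ fun t (ht : 0 < (1 - α) * c * t + 1) => ht.ne') _
      exact ((contDiff_const.mul contDiff_id).add contDiff_const).contDiffOn
    · have h := ((hu t).log (show 0 < (1 - α) * c * t + 1 from ht).ne').div_const ((1 - α) * c)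
      rwa [div_right_comm, div_self hne, one_div] at h

variable {n : ℕ} {G : Type*} [TopologicalSpace G] [ChartedSpace (EuclideanSpace ℝ (Fin n)) G]
  [Group G] [LieGroup (𝓡 n) ∞ G] {ι : Type*} {r s : ι → ℕ} {K : Subgroup G}

local notation "E" => EuclideanSpace ℝ (Fin n)

namespace EquivariantAut

lemma differential_symm_eq {φ : EquivariantAut n K} {Q : E →L[ℝ] E}
    (h : ∀ X, φ.differential (Q X) = X) : φ.symm.differential = Q := by
  refine ContinuousLinearMap.ext fun X => ?_
  conv_lhs => rw [← h X]
  exact φ.differential_symm_apply (Q X)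

/-- Because of this, automorphisms may be chosen separately for each time with no group law beyond
that of their differentials. -/
lemma pullback_congr {φ ψ : EquivariantAut n K} (h : φ.differential = ψ.differential)
    (γ : TensorTuple (OriginTangent n K) r s) : φ.pullback γ = ψ.pullback γ := by
  have e : φ.diffAtOrigin = ψ.diffAtOrigin := by
    refine LinearEquiv.ext fun x => ?_
    induction x using Submodule.Quotient.induction_on with
    | H X => exact congrArg (fun L : E →L[ℝ] E =>
        Submodule.Quotient.mk (p := subgroupLieAlgebra n K) (L X)) h
  rw [pullback, pullback, e]

lemma pullback_refl (γ : TensorTuple (OriginTangent n K) r s) :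
    (refl n K).pullback γ = γ := by
  have e : (refl n K).diffAtOrigin = LinearEquiv.refl ℝ (OriginTangent n K) := by
    refine LinearEquiv.ext fun x => ?_
    induction x using Submodule.Quotient.induction_on with
    | H X => exact congrArg (Submodule.Quotient.mk (p := subgroupLieAlgebra n K)) (diffAtOne_id X)
  rw [pullback, e, TensorTuple.pullback_refl]

lemma pullback_trans (φ ψ : EquivariantAut n K) (γ : TensorTuple (OriginTangent n K) r s) :
    (φ.trans ψ).pullback γ = φ.pullback (ψ.pullback γ) := by
  have e : (φ.trans ψ).diffAtOrigin = φ.diffAtOrigin.trans ψ.diffAtOrigin := by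
    refine LinearEquiv.ext fun x => ?_
    induction x using Submodule.Quotient.induction_on with
    | H X => exact congrArg (fun L : E →L[ℝ] E =>
        Submodule.Quotient.mk (p := subgroupLieAlgebra n K) (L X)) (differential_trans φ ψ)
  rw [pullback, e, TensorTuple.pullback_trans]
  rfl

/-- The derivative of the pull-back of a tensor by a curve of automorphisms through the
identity. -/
theorem hasDerivAt_pullback [Fintype ι]
    {Φ : (GroupLieAlgebra (𝓡 n) G →ₗ[ℝ] GroupLieAlgebra (𝓡 n) G) →ₗ[ℝ]
      (OriginTangent n K →ₗ[ℝ] OriginTangent n K)}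
    (hΦ : ∀ L h, Φ L = (subgroupLieAlgebra n K).mapQ (subgroupLieAlgebra n K) L h)
    {ψ : ℝ → EquivariantAut n K} {B : E →L[ℝ] E}
    (h0 : (ψ 0).differential = ContinuousLinearMap.id ℝ E)
    (h1 : HasDerivAt (fun t => (ψ t).differential) (-B) 0)
    (h2 : HasDerivAt (fun t => (ψ t).symm.differential) B 0)
    (γ : TensorTuple (OriginTangent n K) r s) :
    HasDerivAt (fun t => (ψ t).pullback γ) (TensorTuple.theta (Φ B.toLinearMap) γ) 0 := by
  let Ψ : (E →L[ℝ] E) →ₗ[ℝ] (OriginTangent n K →ₗ[ℝ] OriginTangent n K) :=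
    LinearMap.comp Φ (ContinuousLinearMap.coeLM ℝ : (E →L[ℝ] E) →ₗ[ℝ] (E →ₗ[ℝ] E))
  have k1 := h1.hasWeakDerivAt.map Ψ
  have k2 := h2.hasWeakDerivAt.map Ψ
  refine TensorTuple.hasDerivAt_pullback (h := fun t => (ψ t).diffAtOrigin) ?_
    (k1.congr (fun t => (hΦ _ (ψ t).differential_mem).symm) (map_neg Ψ B).symm)
    (k2.congr (fun t => (hΦ _ (ψ t).symm.differential_mem).symm) rfl) γ
  refine LinearEquiv.ext fun x => ?_
  induction x using Submodule.Quotient.induction_on with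
  | H X => exact congrArg (fun L : E →L[ℝ] E =>
      Submodule.Quotient.mk (p := subgroupLieAlgebra n K) (L X)) h0

end EquivariantAut

lemma hasDerivAt_adjointRep_curve {σ : ℝ → G} (hσ : ContMDiff 𝓘(ℝ, ℝ) (𝓡 n) ∞ σ)
    (hσ0 : σ 0 = 1) : HasDerivAt (fun t => adjointRep n (σ t))
      ((mulHessian n G - (mulHessian n G).flip) (initialVelocity n σ)) 0 := by
  have h1 := HasDerivAt.of_initialVelocity σ hσ hσ0
  have h2 : HasFDerivAt (fun u => adjointRep n (unitParam n G u))
      (mulHessian n G - (mulHessian n G).flip) (unitCoord n (σ 0)) := by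
    rw [hσ0, unitCoord_one]
    exact hasFDerivAt_adjointRep
  refine (h2.comp_hasDerivAt 0 h1).congr_of_eventuallyEq ?_
  have h3 : ∀ᶠ t in 𝓝 (0 : ℝ), σ t ∈ unitSource n G := by
    refine hσ.continuous.continuousAt.eventually ?_
    rw [hσ0]
    exact unitSource_mem_nhds n
  filter_upwards [h3] with t ht
  rw [Function.comp_apply, unitParam_unitCoord ht]

/-- Infinitesimal form of `Ad(K)`-invariance. -/
lemma IsInvariantTensor.theta_eq_zero [Fintype ι]
    {Φ : (GroupLieAlgebra (𝓡 n) G →ₗ[ℝ] GroupLieAlgebra (𝓡 n) G) →ₗ[ℝ]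
      (OriginTangent n K →ₗ[ℝ] OriginTangent n K)}
    (hΦ : ∀ L h, Φ L = (subgroupLieAlgebra n K).mapQ (subgroupLieAlgebra n K) L h)
    {γ : TensorTuple (OriginTangent n K) r s} (hγ : IsInvariantTensor γ) {Z : E}
    (hZ : Z ∈ subgroupLieAlgebra n K) :
    TensorTuple.theta (Φ ((mulHessian n G - (mulHessian n G).flip).flip Z).toLinearMap) γ = 0 := by
  obtain ⟨σ, hσ, hσK, hσ0, hσZ⟩ := hZ
  have hd : ∀ t, (EquivariantAut.conj (n := n) (⟨σ t, hσK t⟩ : K)).differential =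
      adjointRep n (σ t) := fun t => diffAtOne_conj (σ t)
  have hds : ∀ t, (EquivariantAut.conj (n := n) (⟨σ t, hσK t⟩ : K)).symm.differential =
      adjointRep n (σ t)⁻¹ := fun t => EquivariantAut.differential_symm_eq fun X => by
    rw [hd, adjointRep_apply_inv]
  have hinv : initialVelocity n (fun t => (σ t)⁻¹) = -initialVelocity n σ := by
    have h := initialVelocity_mul (fun t => (σ t)⁻¹) σ hσ.inv hσ (by simp [hσ0]) hσ0
    have h0 : initialVelocity n (fun t => (σ t)⁻¹ * σ t) = 0 := by
      have e : (fun t => (σ t)⁻¹ * σ t) = fun _ => (1 : G) := funext fun t => inv_mul_cancel _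
      rw [e, initialVelocity, mfderiv_const]
      rfl
    rw [h0] at h
    exact eq_neg_of_add_eq_zero_left h.symm
  have hflip : (mulHessian n G - (mulHessian n G).flip) Z =
      -(mulHessian n G - (mulHessian n G).flip).flip Z := by
    refine ContinuousLinearMap.ext fun X => ?_
    simp
  have hσZ' : initialVelocity n σ = Z := hσZ
  have h1 := hasDerivAt_adjointRep_curve hσ hσ0
  have h2 := hasDerivAt_adjointRep_curve hσ.inv (by simp [hσ0])
  rw [hinv, map_neg, hσZ', hflip, neg_neg] at h2
  rw [hσZ', hflip] at h1
  -- Conjugation by `σ t` has differential `Ad(σ t)`, with derivative `[Z, ·] = -[·, Z]` at `0`. The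
  -- pull-backs of `γ` are constant by invariance, so the resulting `θ`-term is zero.
  have h := EquivariantAut.hasDerivAt_pullback hΦ
    (ψ := fun t => EquivariantAut.conj (n := n) (⟨σ t, hσK t⟩ : K)) ?_
    (h1.congr_of_eventuallyEq (Filter.Eventually.of_forall hd))
    (h2.congr_of_eventuallyEq (Filter.Eventually.of_forall hds)) γ
  · refine h.unique ((hasDerivAt_const (0 : ℝ) γ).congr_of_eventuallyEq
      (Filter.Eventually.of_forall fun t => hγ _))
  · refine ContinuousLinearMap.ext fun X => ?_
    rw [hd, hσ0, adjointRep_one]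

/-- The derivative of the pull-back of a tensor by a one parameter group of automorphisms. -/
lemma hasDerivAt_pullback_of_differential_eq_exp [Fintype ι]
    {Φ : (GroupLieAlgebra (𝓡 n) G →ₗ[ℝ] GroupLieAlgebra (𝓡 n) G) →ₗ[ℝ]
      (OriginTangent n K →ₗ[ℝ] OriginTangent n K)}
    (hΦ : ∀ L h, Φ L = (subgroupLieAlgebra n K).mapQ (subgroupLieAlgebra n K) L h)
    {A : E →L[ℝ] E} {F : ℝ → EquivariantAut n K}
    (hF : ∀ τ, (F τ).differential = NormedSpace.exp (τ • (-A)))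
    (γ : TensorTuple (OriginTangent n K) r s) (τ : ℝ) :
    HasDerivAt (fun τ => (F τ).pullback γ)
      ((F τ).pullback (TensorTuple.theta (Φ A.toLinearMap) γ)) τ := by
  have hFs : ∀ τ, (F τ).symm.differential = NormedSpace.exp (τ • A) := fun τ =>
    EquivariantAut.differential_symm_eq fun X => by
      have h := exp_smul_apply_exp_neg_smul (-A) τ X
      rwa [neg_neg, ← hF τ] at h
  have h0 : HasDerivAt (fun τ => (F τ).pullback γ) (TensorTuple.theta (Φ A.toLinearMap) γ) 0 := by
    refine EquivariantAut.hasDerivAt_pullback hΦ ?_ ?_ ?_ γ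
    · exact (hF 0).trans (exp_zero_smul (-A))
    · exact (hasDerivAt_exp_smul_zero (-A)).congr_of_eventuallyEq (Filter.Eventually.of_forall hF)
    · exact (hasDerivAt_exp_smul_zero A).congr_of_eventuallyEq (Filter.Eventually.of_forall hFs)
  have h1 : HasDerivAt (fun h => (F τ).pullback ((F h).pullback γ))
      ((F τ).pullback (TensorTuple.theta (Φ A.toLinearMap) γ)) 0 :=
    (h0.hasWeakDerivAt.map (TensorTuple.pullbackₗ (F τ).diffAtOrigin)).hasDerivAt
  -- The exponential law on differentials moves the derivative from `0` to `τ`.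
  have h2 : ∀ x, (F x).pullback γ = (F τ).pullback ((F (x - τ)).pullback γ) := fun x => by
    rw [← EquivariantAut.pullback_trans]
    refine EquivariantAut.pullback_congr ?_ γ
    rw [EquivariantAut.differential_trans, hF, hF, hF]
    exact exp_smul_eq_mul (-A) x τ
  rw [← sub_self τ] at h1
  exact (HasDerivAt.comp_sub_const τ τ h1).congr_of_eventuallyEq (Filter.Eventually.of_forall h2)

end Solitons

/-! ### The self-similar solution -/

theorem proposition4p1 {n : ℕ} {G : Type*} [TopologicalSpace G] [T2Space G]
    [ChartedSpace (EuclideanSpace ℝ (Fin n)) G] [Group G] [LieGroup (𝓡 n) ∞ G]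
    [SimplyConnectedSpace G]
    (K : Subgroup G) (hKcompact : IsCompact (K : Set G)) (hKconn : IsConnected (K : Set G))
    {ι : Type*} [Fintype ι] (r s : ι → ℕ)
    (Γ : Set (TensorTuple (OriginTangent n K) r s))
    (hΓinv : ∀ γ ∈ Γ, IsInvariantTensor γ)
    (hΓaut : ∀ f : EquivariantAut n K, ∀ γ ∈ Γ, f.pullback γ ∈ Γ)
    (hΓscale : ∀ a : ℝ, 0 < a → ∀ γ ∈ Γ, a • γ ∈ Γ)
    (q : TensorTuple (OriginTangent n K) r s → TensorTuple (OriginTangent n K) r s)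
    (hqinv : ∀ γ ∈ Γ, IsInvariantTensor (q γ))
    (hqlip : LocallyLipschitzOn Γ q)
    (hqaut : ∀ f : EquivariantAut n K, ∀ γ ∈ Γ, q (f.pullback γ) = f.pullback (q γ))
    (α : ℝ) (hα : α < 1)
    (hqscale : ∀ a : ℝ, 0 < a → ∀ γ ∈ Γ, q (a • γ) = a ^ α • q γ)
    (γ : TensorTuple (OriginTangent n K) r s) (hγ : γ ∈ Γ)
    (c : ℝ) (hsol : IsSemialgebraicSoliton q γ c) :
    ∃ (a : ℝ → ℝ) (f : ℝ → EquivariantAut n K),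
      (∀ t ∈ selfSimilarInterval α c,
        a t = ((1 - α) * c * t + 1) ^ (1 / (1 - α)) ∧ a t ≠ 0) ∧
      (∀ x : G, (f 0).toMulEquiv x = x) ∧
      ContDiffOn ℝ ∞ (fun t => (f t).differential) (selfSimilarInterval α c) ∧
      IsFlowSolution Γ q γ (selfSimilarInterval α c) (fun t => a t • (f t).pullback γ) ∧
      (∀ (J : Set ℝ) (δ : ℝ → TensorTuple (OriginTangent n K) r s),
        IsOpen J → J.OrdConnected → (0 : ℝ) ∈ J → IsFlowSolution Γ q γ J δ →
          ∀ t ∈ J ∩ selfSimilarInterval α c, δ t = a t • (f t).pullback γ) ∧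
      (∀ t ∈ selfSimilarInterval α c, ∀ k ∈ K, (f t).toMulEquiv k = k) := by
  obtain ⟨D, hD, hqγ⟩ := hsol
  obtain ⟨Φ, hΦ⟩ := (subgroupLieAlgebra n K).exists_linearMap_eq_mapQ
  let Dc : EuclideanSpace ℝ (Fin n) →L[ℝ] EuclideanSpace ℝ (Fin n) :=
    LinearMap.toContinuousLinearMap
      (D.toLinearMap : EuclideanSpace ℝ (Fin n) →ₗ[ℝ] EuclideanSpace ℝ (Fin n))
  have hDc : IsDerivationOf (mulHessian n G) Dc := fun X Y => by
    have h := D.apply_lie_eq_add X Y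
    exact (congrArg D (lie_eq_mulHessian X Y).symm).trans (h.trans ((congrArg₂ (· + ·)
      (lie_eq_mulHessian X (D Y)) (lie_eq_mulHessian (D X) Y)).trans (add_comm _ _)))
  obtain ⟨Z, w, hZ, hw, hwK⟩ := exists_cocycle_eq_zero_on hDc hKcompact hKconn fun X hX => hD hX
  set N := (mulHessian n G - (mulHessian n G).flip).flip Z with hN
  -- Time is reversed because `θ(A)` is the derivative of pull-backs with differential `exp(-τA)`.
  -- The choice at `τ = 0` is replaced by the identity, which avoids proving that an automorphism is
  -- determined by its differential.
  obtain ⟨F, hF0, hFK, hFd⟩ : ∃ F : ℝ → EquivariantAut n K, F 0 = EquivariantAut.refl n K ∧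
      (∀ τ, ∀ x ∈ K, (F τ).toMulEquiv x = x) ∧
      ∀ τ, (F τ).differential = NormedSpace.exp (τ • (-(Dc + N))) := by
    classical
    choose F hFK hFd using fun τ : ℝ => hw.exists_differential_eq_exp hKconn hwK (-τ)
    refine ⟨Function.update F 0 (EquivariantAut.refl n K), Function.update_self _ _ _,
      fun τ x hx => ?_, fun τ => ?_⟩
    · by_cases hτ : τ = 0
      · subst hτ
        rw [Function.update_self]
        rfl
      · rw [Function.update_of_ne hτ]
        exact hFK τ x hx
    · by_cases hτ : τ = 0
      · subst hτ
        rw [Function.update_self, EquivariantAut.differential_refl]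
        exact (exp_zero_smul _).symm
      · rw [Function.update_of_ne hτ, hFd]
        exact exp_neg_smul_eq τ (Dc + N)
  -- The correction `N = [·, Z]` with `Z ∈ 𝔨` acts trivially on the invariant tensor `γ`.
  have htheta : TensorTuple.theta (Φ (Dc + N).toLinearMap) γ = q γ - c • γ := by
    have h1 : Φ (Dc + N).toLinearMap =
        (subgroupLieAlgebra n K).mapQ _ D.toLinearMap hD + Φ N.toLinearMap := by
      rw [← hΦ]
      exact map_add Φ _ _
    rw [h1, TensorTuple.theta_add, (hΓinv γ hγ).theta_eq_zero hΦ hZ, hqγ, add_zero,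
      add_sub_cancel_left]
  obtain ⟨τ, hτ0, hτs, hτd⟩ := exists_scaling hα c
  have hα' : 1 - α ≠ 0 := (sub_pos.2 hα).ne'
  set I := selfSimilarInterval α c with hI
  have hIpos : ∀ t ∈ I, 0 < (1 - α) * c * t + 1 := fun t ht => ht
  let a : ℝ → ℝ := fun t => ((1 - α) * c * t + 1) ^ (1 / (1 - α))
  have hapos : ∀ t ∈ I, 0 < a t := fun t ht => Real.rpow_pos_of_pos (hIpos t ht) _
  have haα : ∀ t ∈ I, a t ^ α = ((1 - α) * c * t + 1) ^ (1 / (1 - α) - 1) := fun t ht => by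
    rw [← Real.rpow_mul (hIpos t ht).le]
    congr 1
    field_simp
    ring
  -- Together with `a' = a^α c`, this lets the common factor `a^α` be taken out of both terms of the
  -- derivative of the solution.
  have haτ : ∀ t ∈ I, a t * ((1 - α) * c * t + 1)⁻¹ = a t ^ α := fun t ht => by
    rw [haα t ht, Real.rpow_sub_one (hIpos t ht).ne', div_eq_mul_inv]
  have had : ∀ t ∈ I, HasDerivAt a (a t ^ α * c) t := fun t ht => by
    have hu : HasDerivAt (fun t : ℝ => (1 - α) * c * t + 1) ((1 - α) * c) t := by
      simpa using ((hasDerivAt_id t).const_mul ((1 - α) * c)).add_const 1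
    refine (hu.rpow_const (Or.inl (hIpos t ht).ne')).congr_deriv ?_
    rw [haα t ht]
    field_simp
  have hsolution : IsFlowSolution Γ q γ I (fun t => a t • (F (τ t)).pullback γ) := by
    refine ⟨?_, fun t ht => hΓscale _ (hapos t ht) _ (hΓaut _ _ hγ), fun t ht => ?_⟩
    · simp only [a, hτ0, hF0, EquivariantAut.pullback_refl]
      simp
    · have h1 : HasDerivAt (fun t => (F (τ t)).pullback γ) _ t :=
        (hasDerivAt_pullback_of_differential_eq_exp hΦ hFd γ (τ t)).scomp t (hτd t ht)
      refine ((had t ht).smul h1).congr_deriv ?_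
      rw [hqscale _ (hapos t ht) _ (hΓaut _ _ hγ), hqaut _ _ hγ, htheta, smul_smul, haτ t ht,
        mul_smul, ← smul_add]
      congr 1
      have h2 : q γ = (q γ - c • γ) + c • γ := (sub_add_cancel _ _).symm
      conv_rhs => rw [h2]
      rw [EquivariantAut.pullback, EquivariantAut.pullback, EquivariantAut.pullback,
        TensorTuple.pullback_add, TensorTuple.pullback_smul]
  have hIopen : IsOpen I := isOpen_lt continuous_const (by fun_prop)
  have hI0 : (0 : ℝ) ∈ I := by simp [hI, selfSimilarInterval]
  have hIconn : I.OrdConnected := by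
    have hconv : Convex ℝ I := by
      have h : I = (fun t => (1 - α) * c * t) ⁻¹' Ioi (-1) := by
        ext t
        simp only [hI, selfSimilarInterval, mem_ofPred_eq, mem_preimage, mem_Ioi]
        constructor <;> intro h <;> linarith
      rw [h]
      exact (convex_Ioi _).is_linear_preimage (IsLinearMap.isLinearMap_smul ((1 - α) * c))
    exact hconv.ordConnected
  refine ⟨a, fun t => F (τ t), fun t ht => ⟨rfl, (hapos t ht).ne'⟩, fun x => ?_, ?_, hsolution,
    fun J δ hJ hJc hJ0 hδ t ht => ?_, fun t _ k hk => hFK _ k hk⟩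
  · exact (congrArg (fun t => (F t).toMulEquiv x) hτ0).trans
      (congrArg (fun φ : EquivariantAut n K => φ.toMulEquiv x) hF0)
  · have hexp : ContDiff ℝ ∞ (NormedSpace.exp : (EuclideanSpace ℝ (Fin n) →L[ℝ]
        EuclideanSpace ℝ (Fin n)) → _) := contDiff_iff_contDiffAt.2 fun x =>
      (NormedSpace.exp_analytic x).contDiffAt
    simp only [hFd]
    exact hexp.comp_contDiffOn (hτs.smul contDiffOn_const)
  · exact ODE_solution_unique_of_locallyLipschitzOn hqlip (hJ.inter hIopen) (hJc.inter hIconn)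
      (fun t ht => ⟨hδ.hasDerivAt t ht.1, hδ.mem t ht.1⟩)
      (fun t ht => ⟨hsolution.hasDerivAt t ht.2, hsolution.mem t ht.2⟩) ⟨hJ0, hI0⟩
      (hδ.initial.trans hsolution.initial.symm) ht
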